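/- Let $k$ be a field and let $(R,\mathfrak m)$, $(S,\mathfrak n)$ be standard graded $k$-algebras (noetherian $\mathbb N$-graded, with degree-zero part $k$, generated over $k$ in degree $1$), with graded maximal ideals $\mathfrak m,\mathfrak n$. Let $I\subseteq R$ and $J\subseteq S$ be non-zero proper homogeneous ideals, let $T=R\otimes_k S$ with its total grading, and let $P=I+J\subseteq T$, where $I$ and $J$ also denote the ideals they generate in $T$. Terminology, for a standard graded $k$-algebra $A$ with graded maximal ideal $\mathfrak a$: - A degree-preserving map $\phi:M\to N$ of graded $A$-modules is *Tor-vanishing* if $\operatorname{Tor}^A_i(k,\phi)=0$ for all $i\ge 0$. It is *doubly Tor-vanishing* if there are (possibly non-minimal) graded free resolutions $F$ of $M$ and $G$ of $N$ and a degree-preserving lifting $\varphi:F\to G$ of $\phi$ with $\varphi(F)\subseteq \mathfrak a^2G$. - A proper homogeneous ideal $Q$ of $A$ is *of small type* (resp. *of doubly small type*) if for every $r\ge 1$ the inclusion $Q^r\to Q^{r-1}$ is Tor-vanishing (resp. doubly Tor-vanishing), where $Q^0=A$. - For homogeneous ideals with $Q=Q_1+Q_2$, this decomposition is a *Betti splitting*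 if $\beta_i(Q)=\beta_i(Q_1)+\beta_i(Q_2)+\beta_{i-1}(Q_1\cap Q_2)$ for all $i\ge 0$, where $\beta_i(M)=\dim_k\operatorname{Tor}^A_i(k,M)$ and $\beta_{-1}=0$. (Zero ideals are allowed here.) Then: (i) If $I$ and $J$ are of small type, then for all $r\ge 0$ and $s\ge 1$ the decomposition $I^rP^s=I^{r+1}P^{s-1}+I^rJ^s$ holds and is a Betti splitting. Furthermore, $P$ is of small type. (ii) If $I$ and $J$ are of doubly small type, then for all $r\ge 0$ and $s\ge 1$ the inclusion maps $I^{r+1}J^s\to I^rJ^s$ and $I^{r+1}J^s\to I^{r+1}P^{s-1}$ are doubly Tor-vanishing. Furthermore, $P$ is of doubly small type. -/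

import Mathlib

open CategoryTheory
open scoped TensorProduct

universe u

noncomputable section

namespace MixedSum

section Graded

variable {k R : Type u} [Field k] [CommRing R] [Algebra k R]

/-- A standard graded `k`-algebra: a noetherian `ℕ`-graded ring `R = ⨁ R_n` with `R_0 = k`,
generated over `k` by elements of degree one. (That `R = ⨁ R_n` is a graded algebra is the
separate instance `GradedAlgebra 𝒜`.) -/
structure IsStandardGraded (𝒜 : ℕ → Submodule k R) : Prop where
  nontrivial : Nontrivial R
  noetherian : IsNoetherianRing R
  degree_zero : 𝒜 0 = LinearMap.range (Algebra.linearMap k R)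
  generated : Algebra.adjoin k (𝒜 1 : Set R) = ⊤

/-- The graded maximal ideal `𝔪`, generated by the homogeneous elements of positive degree. -/
def gradedMax (𝒜 : ℕ → Submodule k R) : Ideal R :=
  Ideal.span {x : R | ∃ n : ℕ, 1 ≤ n ∧ x ∈ 𝒜 n}

/-- The map `Tor_i^R(k, f)`, where the residue field `k` is the `R`-module `R ⧸ 𝔪`. -/
def torMap (𝒜 : ℕ → Submodule k R) {M N : Type u} [AddCommGroup M] [Module R M]
    [AddCommGroup N] [Module R N] (i : ℕ) (f : M →ₗ[R] N) :
    ((Tor (ModuleCat.{u} R) i).obj (ModuleCat.of R (R ⧸ gradedMax 𝒜))).obj (ModuleCat.of R M) ⟶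
    ((Tor (ModuleCat.{u} R) i).obj (ModuleCat.of R (R ⧸ gradedMax 𝒜))).obj (ModuleCat.of R N) :=
  ((Tor (ModuleCat.{u} R) i).obj (ModuleCat.of R (R ⧸ gradedMax 𝒜))).map (ModuleCat.ofHom f)

/-- `f` is Tor-vanishing: `Tor_i^R(k, f) = 0` for all `i ≥ 0`. -/
def IsTorVanishing (𝒜 : ℕ → Submodule k R) {M N : Type u} [AddCommGroup M] [Module R M]
    [AddCommGroup N] [Module R N] (f : M →ₗ[R] N) : Prop :=
  ∀ i : ℕ, torMap 𝒜 i f = 0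

/-- The `i`-th Betti number `β_i(M) = dim_k Tor_i^R(k, M)`. -/
def betti (𝒜 : ℕ → Submodule k R) (i : ℕ) (M : Type u) [AddCommGroup M] [Module R M] :
    Cardinal.{u} :=
  Module.rank k ((ModuleCat.restrictScalars (algebraMap k R)).obj
    (((Tor (ModuleCat.{u} R) i).obj (ModuleCat.of R (R ⧸ gradedMax 𝒜))).obj (ModuleCat.of R M)))

/-- `P = I + J` is a Betti splitting: `β_i(P) = β_i(I) + β_i(J) + β_{i-1}(I ∩ J)` for all
`i ≥ 0`, where `β_{-1} = 0`. -/
def IsBettiSplitting (𝒜 : ℕ → Submodule k R) (P I J : Ideal R) : Prop :=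
  P = I + J ∧
    ∀ i : ℕ, betti 𝒜 i P =
      betti 𝒜 i I + betti 𝒜 i J +
        (if i = 0 then 0 else betti 𝒜 (i - 1) (I ⊓ J : Ideal R))

/-- The component of degree `z ∈ ℤ` of `R`, which is zero if `z < 0`. -/
def component (𝒜 : ℕ → Submodule k R) : ℤ → Submodule k R
  | Int.ofNat n => 𝒜 n
  | Int.negSucc _ => ⊥

/-- The grading that a homogeneous ideal `I` inherits from `R`. -/
def idealComponent (𝒜 : ℕ → Submodule k R) (I : Ideal R) (z : ℤ) : AddSubgroup I :=
  (component 𝒜 z).toAddSubgroup.comap (Submodule.subtype I).toAddMonoidHom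

/-- A (possibly non-minimal) graded free resolution
`⋯ → F_1 → F_0 → M → 0` of the graded `R`-module `M = ⨁ M_z`. Here `F_n = ⨁_{j ∈ ι n} R(-deg j)`
is free on a homogeneous basis, and the maps preserve degrees. -/
structure GradedFreeResolution (𝒜 : ℕ → Submodule k R) {M : Type u} [AddCommGroup M] [Module R M]
    (ℳ : ℤ → AddSubgroup M) where
  ι : ℕ → Type u
  deg : ∀ n, ι n → ℤ
  d : ∀ n, (ι (n + 1) →₀ R) →ₗ[R] (ι n →₀ R)
  aug : (ι 0 →₀ R) →ₗ[R] M
  d_deg : ∀ n (j : ι (n + 1)) (i : ι n),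
    d n (Finsupp.single j 1) i ∈ component 𝒜 (deg (n + 1) j - deg n i)
  aug_deg : ∀ j : ι 0, aug (Finsupp.single j 1) ∈ ℳ (deg 0 j)
  aug_surjective : Function.Surjective aug
  exact_aug : Function.Exact (d 0) aug
  exact_d : ∀ n, Function.Exact (d (n + 1)) (d n)

/-- A lifting of `f : M → N` to graded free resolutions: a degree-preserving map of complexes
`F → G` that is compatible with the augmentations. -/
structure GradedLifting {𝒜 : ℕ → Submodule k R} {M N : Type u} [AddCommGroup M] [Module R M]
    [AddCommGroup N] [Module R N] {ℳ : ℤ → AddSubgroup M} {𝒩 : ℤ → AddSubgroup N}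
    (F : GradedFreeResolution 𝒜 ℳ) (G : GradedFreeResolution 𝒜 𝒩) (f : M →ₗ[R] N) where
  map : ∀ n, (F.ι n →₀ R) →ₗ[R] (G.ι n →₀ R)
  map_deg : ∀ n (j : F.ι n) (i : G.ι n),
    map n (Finsupp.single j 1) i ∈ component 𝒜 (F.deg n j - G.deg n i)
  comm_aug : G.aug ∘ₗ map 0 = f ∘ₗ F.aug
  comm_d : ∀ n, G.d n ∘ₗ map (n + 1) = map n ∘ₗ F.d n

/-- `f : M → N` is doubly Tor-vanishing: for some graded free resolutions `F` of `M` and `G` of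
`N` it has a lifting `φ : F → G` with `φ(F) ⊆ 𝔪² G`. -/
def IsDoublyTorVanishing (𝒜 : ℕ → Submodule k R) {M N : Type u} [AddCommGroup M] [Module R M]
    [AddCommGroup N] [Module R N] (ℳ : ℤ → AddSubgroup M) (𝒩 : ℤ → AddSubgroup N)
    (f : M →ₗ[R] N) : Prop :=
  ∃ (F : GradedFreeResolution 𝒜 ℳ) (G : GradedFreeResolution 𝒜 𝒩) (φ : GradedLifting F G f),
    ∀ n, LinearMap.range (φ.map n) ≤ (gradedMax 𝒜) ^ 2 • (⊤ : Submodule R (G.ι n →₀ R))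

/-- `I` is contained in `J` and the inclusion map `I → J` is Tor-vanishing. -/
def InclusionTorVanishing (𝒜 : ℕ → Submodule k R) (I J : Ideal R) : Prop :=
  ∃ h : I ≤ J, IsTorVanishing 𝒜 (Submodule.inclusion h)

/-- `I` is contained in `J` and the inclusion map `I → J` is doubly Tor-vanishing. -/
def InclusionDoublyTorVanishing (𝒜 : ℕ → Submodule k R) (I J : Ideal R) : Prop :=
  ∃ h : I ≤ J, IsDoublyTorVanishing 𝒜 (idealComponent 𝒜 I) (idealComponent 𝒜 J)
    (Submodule.inclusion h)

/-- `I` is of small type: `I^r → I^{r-1}` is Tor-vanishing for all `r ≥ 1`. -/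
def IsSmallType (𝒜 : ℕ → Submodule k R) (I : Ideal R) : Prop :=
  ∀ r : ℕ, 1 ≤ r → InclusionTorVanishing 𝒜 (I ^ r) (I ^ (r - 1))

/-- `I` is of doubly small type: `I^r → I^{r-1}` is doubly Tor-vanishing for all `r ≥ 1`. -/
def IsDoublySmallType (𝒜 : ℕ → Submodule k R) (I : Ideal R) : Prop :=
  ∀ r : ℕ, 1 ≤ r → InclusionDoublyTorVanishing 𝒜 (I ^ r) (I ^ (r - 1))

end Graded

section Tensor

variable {k R S : Type u} [Field k] [CommRing R] [Algebra k R] [CommRing S] [Algebra k S]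

/-- The total grading of `R ⊗_k S`: its component of degree `n` is `∑_{i+j=n} R_i ⊗_k S_j`. -/
def tensorGrading (𝒜 : ℕ → Submodule k R) (ℬ : ℕ → Submodule k S) (n : ℕ) :
    Submodule k (R ⊗[k] S) :=
  ⨆ p ∈ Finset.HasAntidiagonal.antidiagonal n, Submodule.map₂ (TensorProduct.mk k R S) (𝒜 p.1) (ℬ p.2)

/-- The ideal of `R ⊗_k S` generated by an ideal of `R`. -/
def extendLeft (I : Ideal R) : Ideal (R ⊗[k] S) :=
  I.map (Algebra.TensorProduct.includeLeft : R →ₐ[k] R ⊗[k] S)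

/-- The ideal of `R ⊗_k S` generated by an ideal of `S`. -/
def extendRight (J : Ideal S) : Ideal (R ⊗[k] S) :=
  J.map (Algebra.TensorProduct.includeRight : S →ₐ[k] R ⊗[k] S)

/-- The mixed sum `P = I + J ⊆ R ⊗_k S`. -/
def mixedSum (I : Ideal R) (J : Ideal S) : Ideal (R ⊗[k] S) :=
  extendLeft I + extendRight J

end Tensor

end MixedSum

end

noncomputable section

namespace MixedSum

/-! Both parts rest on one explicit construction with free resolutions whose connecting maps have
small matrix entries. Let `F a` resolve `I ^ a` and `G b` resolve `J ^ b`, and let `φ a`, `ψ b` lift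
the inclusions of consecutive powers. In part (i) their entries can be taken in `𝔪` and `𝔫`, in part
(ii) in `𝔪²` and `𝔫²`.

For part (i) such lifts come from Tor-vanishing, whatever the resolutions are
(`InclusionTorVanishing.hasLift`): any lift is zero on the homology of the complexes reduced modulo
`𝔪`. These are complexes of vector spaces, so it is null-homotopic there, and subtracting a lifted
homotopy moves its entries into `𝔪`. No minimality is needed. For part (ii) the lifts are given, but
between unrelated resolutions. Composing with comparison maps keeps the entries in the ideal
(`HasLift.of_resolutions`), and extracting the degree-preserving part restores the grading.

Over the field `k`, the complex `F r ⊗ G s` resolves `I ^ r * J ^ s` (`tensorCx_isRes`), and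
extended ideals satisfy `I ⊓ J = I * J`. Hence `I ^ r * P ^ (s + 1)` is the sum of `I ^ (r + 1) * P
^ s` and `I ^ r * J ^ (s + 1)`, with intersection `I ^ (r + 1) * J ^ (s + 1)`
(`mixedSum_decomposition`, `mixedSum_inf`). By Mayer–Vietoris the mapping cone of the lifts from the
intersection to the two summands resolves the sum (`cone_isRes`). Iterating on `s` gives the
resolution `tot`.

The attaching maps of each cone are `φ ⊗ 1` and `1 ⊗ ψ` followed by an inclusion, so they have small
entries. Modulo the maximal ideal the cone is therefore a direct sum and Betti numbers add
(`isBettiSplitting_of_hasLift`); in part (ii) the same maps are the required doubly small lifts.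
Finally `P ^ (s + 1) → P ^ s` lifts to `totMap`, a map of iterated cones whose blocks are again of
the form `φ ⊗ 1` and `1 ⊗ ψ`; the squares involved commute strictly because these two kinds of maps
commute (`totMap_isLift`). -/

/-- A free module with homogeneous basis `X`, a differential and an augmentation to `R`:
the raw data of a free resolution of an ideal, with all homological degrees put together. -/
structure Cx (R : Type u) [CommRing R] where
  X : Type u
  h : X → ℕ
  deg : X → ℤ
  D : (X →₀ R) →ₗ[R] (X →₀ R)
  aug : (X →₀ R) →ₗ[R] R

/-! ### Free resolutions of ideals and the comparison theorem. -/

section Basic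

variable {R : Type u} [CommRing R]

/-- `F` is a free resolution of the ideal `A`. -/
structure Cx.IsRes (F : Cx R) (A : Ideal R) : Prop where
  D_h : ∀ j i, F.D (Finsupp.single j 1) i ≠ 0 → F.h j = F.h i + 1
  aug_h : ∀ j, F.h j ≠ 0 → F.aug (Finsupp.single j 1) = 0
  D_D : ∀ x, F.D (F.D x) = 0
  aug_D : ∀ x, F.aug (F.D x) = 0
  exact : ∀ x, F.D x = 0 → F.aug x = 0 → ∃ y, F.D y = x
  range_aug : LinearMap.range F.aug = A

/-- A chain map of resolutions compatible with the augmentations, with matrix entries in `c`. -/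
structure IsLift (F G : Cx R) (c : Ideal R) (φ : (F.X →₀ R) →ₗ[R] (G.X →₀ R)) : Prop where
  comm_D : ∀ x, G.D (φ x) = φ (F.D x)
  comm_aug : ∀ x, G.aug (φ x) = F.aug x
  mem : ∀ x i, φ x i ∈ c

/-- Existence of a lift. -/
def HasLift (F G : Cx R) (c : Ideal R) : Prop := ∃ φ, IsLift F G c φ

theorem linearMap_ext_single {X : Type*} {N : Type*} [AddCommGroup N] [Module R N]
    {f g : (X →₀ R) →ₗ[R] N} (h : ∀ j, f (Finsupp.single j 1) = g (Finsupp.single j 1)) :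
    f = g := by
  ext j; simpa using h j

theorem apply_mem_of_single {X Y : Type*} {c : Ideal R} (φ : (X →₀ R) →ₗ[R] (Y →₀ R))
    (hφ : ∀ j i, φ (Finsupp.single j 1) i ∈ c) (x : X →₀ R) (i : Y) : φ x i ∈ c := by
  induction x using Finsupp.induction_linear with
  | zero => simp
  | add f g hf hg => simpa using c.add_mem hf hg
  | single j a =>
    rw [← mul_one a, ← smul_eq_mul, ← Finsupp.smul_single, map_smul]
    exact c.mul_mem_left _ (hφ j i)

theorem apply_mem_of_mem {X Y : Type*} {c : Ideal R} (φ : (X →₀ R) →ₗ[R] (Y →₀ R))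
    (x : X →₀ R) (hx : ∀ j, x j ∈ c) (i : Y) : φ x i ∈ c := by
  rw [← Finsupp.sum_single x, Finsupp.sum, map_sum, Finsupp.finsetSum_apply]
  refine c.sum_mem fun j _ => ?_
  rw [← mul_one (x j), ← smul_eq_mul, ← Finsupp.smul_single, map_smul]
  exact c.mul_mem_right _ (hx j)

theorem mem_smul_top_iff {X : Type*} {c : Ideal R} (x : X →₀ R) :
    x ∈ c • (⊤ : Submodule R (X →₀ R)) ↔ ∀ i, x i ∈ c := by
  constructor
  · intro hx i
    refine Submodule.smul_induction_on hx (fun r hr n _ => ?_) (fun a b ha hb => ?_)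
    · exact c.mul_mem_right _ hr
    · exact c.add_mem ha hb
  · intro hx
    rw [← Finsupp.sum_single x]
    refine Submodule.sum_mem _ fun i _ => ?_
    rw [← mul_one (x i), ← smul_eq_mul, ← Finsupp.smul_single]
    exact Submodule.smul_mem_smul (hx i) trivial

/-- Ideals absorb the entries of the other factor, so smallness of either factor passes to the
composite. This is what allows small lifts to be moved along comparison maps. -/
theorem IsLift.comp {F G H : Cx R} {c c' : Ideal R} {φ : (F.X →₀ R) →ₗ[R] (G.X →₀ R)}
    {ψ : (G.X →₀ R) →ₗ[R] (H.X →₀ R)} (hψ : IsLift G H c' ψ) (hφ : IsLift F G c φ) :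
    IsLift F H (c ⊓ c') (ψ ∘ₗ φ) where
  comm_D x := by simp [hψ.comm_D, hφ.comm_D]
  comm_aug x := by simp [hψ.comm_aug, hφ.comm_aug]
  mem x i := ⟨apply_mem_of_mem ψ _ (hφ.mem x) i, hψ.mem _ i⟩

theorem IsLift.mono {F G : Cx R} {c c' : Ideal R} {φ : (F.X →₀ R) →ₗ[R] (G.X →₀ R)}
    (h : IsLift F G c φ) (hc : c ≤ c') : IsLift F G c' φ :=
  ⟨h.comm_D, h.comm_aug, fun x i => hc (h.mem x i)⟩

theorem HasLift.comp_left {F G H : Cx R} {c : Ideal R} (h₁ : HasLift F G c)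
    (h₂ : HasLift G H ⊤) : HasLift F H c := by
  obtain ⟨φ, hφ⟩ := h₁
  obtain ⟨ψ, hψ⟩ := h₂
  exact ⟨_, (hψ.comp hφ).mono inf_le_left⟩

theorem HasLift.comp_right {F G H : Cx R} {c : Ideal R} (h₁ : HasLift F G ⊤)
    (h₂ : HasLift G H c) : HasLift F H c := by
  obtain ⟨φ, hφ⟩ := h₁
  obtain ⟨ψ, hψ⟩ := h₂
  exact ⟨_, (hψ.comp hφ).mono inf_le_right⟩

/-- Projection to the basis elements of homological degree `n`. -/
def Cx.proj (F : Cx R) (n : ℕ) : (F.X →₀ R) →ₗ[R] (F.X →₀ R) :=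
  Finsupp.linearCombination R fun j => if F.h j = n then Finsupp.single j 1 else 0

theorem Cx.proj_single (F : Cx R) (n : ℕ) (j : F.X) (a : R) :
    F.proj n (Finsupp.single j a) = if F.h j = n then Finsupp.single j a else 0 := by
  simp [Cx.proj]

theorem Cx.proj_apply (F : Cx R) (n : ℕ) (x : F.X →₀ R) (i : F.X) :
    F.proj n x i = if F.h i = n then x i else 0 := by
  induction x using Finsupp.induction_linear with
  | zero => simp
  | add f g hf hg => simp only [map_add, Finsupp.add_apply, hf, hg]; split_ifs <;> simp
  | single j a =>
    rw [F.proj_single]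
    by_cases hij : j = i
    · subst hij; split_ifs <;> simp
    · split_ifs <;> simp [hij]

theorem Cx.IsRes.D_proj_succ {F : Cx R} {A : Ideal R} (hF : F.IsRes A) (n : ℕ) (x : F.X →₀ R) :
    F.D (F.proj (n + 1) x) = F.proj n (F.D x) := by
  suffices h : F.D ∘ₗ F.proj (n + 1) = F.proj n ∘ₗ F.D from LinearMap.congr_fun h x
  refine linearMap_ext_single fun j => ?_
  ext i
  simp only [LinearMap.comp_apply, F.proj_apply, F.proj_single]
  by_cases h0 : F.D (Finsupp.single j 1) i = 0
  · split_ifs <;> simp [h0]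
  · have := hF.D_h j i h0
    by_cases hj : F.h j = n + 1
    · rw [if_pos hj, if_pos (by omega)]
    · rw [if_neg hj, if_neg (by omega)]; simp

theorem Cx.IsRes.D_proj_zero {F : Cx R} {A : Ideal R} (hF : F.IsRes A) (x : F.X →₀ R) :
    F.D (F.proj 0 x) = 0 := by
  suffices h : F.D ∘ₗ F.proj 0 = 0 from LinearMap.congr_fun h x
  refine linearMap_ext_single fun j => ?_
  ext i
  simp only [LinearMap.comp_apply, F.proj_single]
  by_cases h0 : F.D (Finsupp.single j 1) i = 0
  · split_ifs <;> simp [h0]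
  · have := hF.D_h j i h0
    rw [if_neg (by omega)]; simp

theorem Cx.IsRes.aug_proj_zero {F : Cx R} {A : Ideal R} (hF : F.IsRes A) (x : F.X →₀ R) :
    F.aug (F.proj 0 x) = F.aug x := by
  suffices h : F.aug ∘ₗ F.proj 0 = F.aug from LinearMap.congr_fun h x
  refine linearMap_ext_single fun j => ?_
  simp only [LinearMap.comp_apply, F.proj_single]
  by_cases h0 : F.h j = 0
  · simp [h0]
  · simp [h0, hF.aug_h j h0]

/-- All homological degrees share one module, so a preimage under the augmentation need not be a
cycle. Its degree-zero part is one, and it keeps the augmentation. -/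
theorem Cx.IsRes.exists_cycle {F : Cx R} {A : Ideal R} (hF : F.IsRes A) {a : R} (ha : a ∈ A) :
    ∃ x, F.D x = 0 ∧ F.aug x = a := by
  rw [← hF.range_aug] at ha
  obtain ⟨x, rfl⟩ := ha
  exact ⟨F.proj 0 x, hF.D_proj_zero x, hF.aug_proj_zero x⟩

theorem Cx.IsRes.aug_mem {F : Cx R} {A : Ideal R} (hF : F.IsRes A) (x : F.X →₀ R) :
    F.aug x ∈ A := by
  rw [← hF.range_aug]; exact ⟨x, rfl⟩

theorem IsLift.le {F G : Cx R} {A B : Ideal R} {c : Ideal R} {φ : (F.X →₀ R) →ₗ[R] (G.X →₀ R)}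
    (hφ : IsLift F G c φ) (hF : F.IsRes A) (hG : G.IsRes B) : A ≤ B := by
  intro a ha
  obtain ⟨x, -, rfl⟩ := hF.exists_cycle ha
  rw [← hφ.comm_aug]; exact hG.aug_mem _

open Classical in
/-- The comparison map, built degree by degree from choices of preimages. -/
def compareAux (F G : Cx R) : ℕ → ((F.X →₀ R) →ₗ[R] (G.X →₀ R))
  | 0 => Finsupp.linearCombination R fun j =>
      if h : ∃ y, G.D y = 0 ∧ G.aug y = F.aug (Finsupp.single j 1) then h.choose else 0
  | n + 1 => Finsupp.linearCombination R fun j =>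
      if h : ∃ y, G.D y = compareAux F G n (F.D (Finsupp.single j 1)) ∧ G.aug y = 0
      then h.choose else 0

theorem Cx.apply_eq_of_eq_on_degree {F : Cx R} {N : Type*} [AddCommGroup N] [Module R N]
    (f g : (F.X →₀ R) →ₗ[R] N) (n : ℕ)
    (h : ∀ j, F.h j = n → f (Finsupp.single j 1) = g (Finsupp.single j 1)) (x : F.X →₀ R)
    (hx : ∀ i, x i ≠ 0 → F.h i = n) : f x = g x := by
  rw [← Finsupp.sum_single x, Finsupp.sum, map_sum, map_sum]
  refine Finset.sum_congr rfl fun i hi => ?_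
  rw [← mul_one (x i), ← smul_eq_mul, ← Finsupp.smul_single, map_smul, map_smul,
    h i (hx i (by simpa using hi))]

/-- Comparison theorem: an inclusion of ideals lifts to free resolutions. -/
theorem hasLift_top {F G : Cx R} {A B : Ideal R} (hF : F.IsRes A) (hG : G.IsRes B)
    (hAB : A ≤ B) : HasLift F G ⊤ := by
  classical
  have h0 : ∀ j, G.D (compareAux F G 0 (Finsupp.single j 1)) = 0 ∧
      G.aug (compareAux F G 0 (Finsupp.single j 1)) = F.aug (Finsupp.single j 1) := by
    intro j
    have hex := hG.exists_cycle (hAB (hF.aug_mem (Finsupp.single j 1)))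
    simp only [compareAux, Finsupp.linearCombination_single, one_smul]
    rw [dif_pos hex]
    exact hex.choose_spec
  have hs : ∀ n j (hex : ∃ y, G.D y = compareAux F G n (F.D (Finsupp.single j 1)) ∧ G.aug y = 0),
      compareAux F G (n + 1) (Finsupp.single j 1) = hex.choose := by
    intro n j hex
    rw [compareAux, Finsupp.linearCombination_single, one_smul, dif_pos hex]
  -- The restriction on `F.h j` is essential: on basis elements of other degrees `compareAux` may
  -- take its default value `0`.
  have hstep : ∀ n j, F.h j = n + 1 →
      G.D (compareAux F G (n + 1) (Finsupp.single j 1)) =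
        compareAux F G n (F.D (Finsupp.single j 1)) ∧
      G.aug (compareAux F G (n + 1) (Finsupp.single j 1)) = 0 := by
    intro n
    induction n with
    | zero =>
      intro j hj
      have hex : ∃ y, G.D y = compareAux F G 0 (F.D (Finsupp.single j 1)) ∧ G.aug y = 0 := by
        obtain ⟨y, hy⟩ := hG.exact (compareAux F G 0 (F.D (Finsupp.single j 1)))
          (by
            have : G.D ∘ₗ compareAux F G 0 = 0 := linearMap_ext_single fun j => (h0 j).1
            exact LinearMap.congr_fun this _)
          (by
            have : G.aug ∘ₗ compareAux F G 0 = F.aug := linearMap_ext_single fun j => (h0 j).2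
            exact (LinearMap.congr_fun this _).trans (hF.aug_D _))
        -- The degree-zero part of `y` has no boundary and carries the whole augmentation, so
        -- removing it kills `G.aug y` and leaves `G.D y` unchanged.
        exact ⟨y - G.proj 0 y, by rw [map_sub, hy, hG.D_proj_zero, sub_zero],
          by rw [map_sub, hG.aug_proj_zero, sub_self]⟩
      rw [hs _ _ hex]
      exact hex.choose_spec
    | succ n ih =>
      intro j hj
      have hd : ∀ i, F.D (Finsupp.single j 1) i ≠ 0 → F.h i = n + 1 := fun i hi => by
        have := hF.D_h j i hi; omega
      have hex : ∃ y, G.D y = compareAux F G (n + 1) (F.D (Finsupp.single j 1)) ∧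
          G.aug y = 0 := by
        obtain ⟨y, hy⟩ := hG.exact (compareAux F G (n + 1) (F.D (Finsupp.single j 1)))
          (by
            refine (Cx.apply_eq_of_eq_on_degree (G.D ∘ₗ compareAux F G (n + 1))
              (compareAux F G n ∘ₗ F.D) (n + 1) (fun j hj => (ih j hj).1) _ hd).trans ?_
            simp [hF.D_D])
          (Cx.apply_eq_of_eq_on_degree (G.aug ∘ₗ compareAux F G (n + 1)) 0 (n + 1)
              (fun j hj => (ih j hj).2) _ hd)
        exact ⟨y - G.proj 0 y, by rw [map_sub, hy, hG.D_proj_zero, sub_zero],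
          by rw [map_sub, hG.aug_proj_zero, sub_self]⟩
      rw [hs _ _ hex]
      exact hex.choose_spec
  -- Each basis element uses the map built for its own homological degree, so default values never
  -- enter.
  let φ : (F.X →₀ R) →ₗ[R] (G.X →₀ R) :=
    Finsupp.linearCombination R fun j => compareAux F G (F.h j) (Finsupp.single j 1)
  have hφ : ∀ j, φ (Finsupp.single j 1) = compareAux F G (F.h j) (Finsupp.single j 1) := by
    intro j; simp [φ]
  refine ⟨φ, fun x => ?_, fun x => ?_, fun _ _ => trivial⟩
  · suffices h : G.D ∘ₗ φ = φ ∘ₗ F.D from LinearMap.congr_fun h x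
    refine linearMap_ext_single fun j => ?_
    rw [LinearMap.comp_apply, LinearMap.comp_apply, hφ]
    obtain hj | ⟨n, hj⟩ : F.h j = 0 ∨ ∃ n, F.h j = n + 1 := by
      cases F.h j <;> simp
    · have : F.D (Finsupp.single j 1) = 0 := by
        ext i; by_contra hne; have := hF.D_h j i hne; omega
      rw [this, map_zero, hj, (h0 j).1]
    · rw [hj, (hstep n j hj).1]
      refine Cx.apply_eq_of_eq_on_degree _ _ n (fun i hi => ?_) _
        (fun i hi => by have := hF.D_h j i hi; omega)
      rw [hφ, hi]
  · suffices h : G.aug ∘ₗ φ = F.aug from LinearMap.congr_fun h x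
    refine linearMap_ext_single fun j => ?_
    rw [LinearMap.comp_apply, hφ]
    obtain hj | ⟨n, hj⟩ : F.h j = 0 ∨ ∃ n, F.h j = n + 1 := by
      cases F.h j <;> simp
    · rw [hj, (h0 j).2]
    · rw [hj, (hstep n j hj).2, hF.aug_h j (by omega)]

/-- A lift with entries in `c` exists for all resolutions as soon as it exists for some. -/
theorem HasLift.of_resolutions {F G F' G' : Cx R} {A B c : Ideal R} (h : HasLift F G c)
    (hF : F.IsRes A) (hG : G.IsRes B) (hF' : F'.IsRes A) (hG' : G'.IsRes B) :
    HasLift F' G' c :=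
  ((hasLift_top hF' hF le_rfl).comp_right h).comp_left (hasLift_top hG hG' le_rfl)

end Basic

/-! ### Null-homotopies over the residue field and their lifts. -/

section Homotopy

/-- Over a field the surjection onto the range splits, and the splitting extends to the whole
target. -/
theorem exists_generalized_inverse {K V W : Type*} [Field K] [AddCommGroup V] [Module K V]
    [AddCommGroup W] [Module K W] (f : V →ₗ[K] W) : ∃ g : W →ₗ[K] V, ∀ x, f (g (f x)) = f x := by
  obtain ⟨s, hs⟩ := f.rangeRestrict.exists_rightInverse_of_surjective
    (LinearMap.range_eq_top.2 f.surjective_rangeRestrict)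
  obtain ⟨g, hg⟩ := s.exists_extend
  refine ⟨g, fun x => ?_⟩
  have h1 : g (f x) = s ⟨f x, x, rfl⟩ := LinearMap.congr_fun hg ⟨f x, x, rfl⟩
  have h2 := congrArg Subtype.val (LinearMap.congr_fun hs ⟨f x, x, rfl⟩)
  rw [h1]; exact h2

/-- Over a field, a map of differential modules that sends cycles to boundaries is
null-homotopic. -/
theorem exists_nullhomotopy {K V W : Type*} [Field K] [AddCommGroup V] [Module K V]
    [AddCommGroup W] [Module K W] (D : V →ₗ[K] V) (D' : W →ₗ[K] W) (f : V →ₗ[K] W)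
    (hD : ∀ x, D (D x) = 0) (hf : ∀ x, D' (f x) = f (D x))
    (hker : ∀ x, D x = 0 → ∃ y, D' y = f x) :
    ∃ h : V →ₗ[K] W, ∀ x, D' (h x) + h (D x) = f x := by
  obtain ⟨σ, hσ⟩ := exists_generalized_inverse D
  obtain ⟨τ, hτ⟩ := exists_generalized_inverse D'
  -- Put `z = x - σ (D x)`, a cycle. The first term has boundary `f (D (σ z))`. The second has
  -- boundary `f (z - D (σ z))`, since this is the image of a cycle and hence a boundary, on which
  -- `τ` inverts `D'`. Together they give `f z`, and evaluating the homotopy at `D x` gives the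
  -- missing `f (σ (D x))`.
  refine ⟨(f ∘ₗ σ ∘ₗ D ∘ₗ σ + τ ∘ₗ f ∘ₗ (LinearMap.id - D ∘ₗ σ)) ∘ₗ (LinearMap.id - σ ∘ₗ D),
    fun x => ?_⟩
  have h1 : D (x - σ (D x)) = 0 := by rw [map_sub, hσ, sub_self]
  set z := x - σ (D x) with hz
  have h2 : D' (τ (f (z - D (σ z)))) = f (z - D (σ z)) := by
    obtain ⟨y, hy⟩ := hker (z - D (σ z)) (by rw [map_sub, h1, hD, sub_zero])
    rw [← hy, hτ]
  simp only [LinearMap.comp_apply, LinearMap.add_apply, LinearMap.sub_apply, LinearMap.id_apply,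
    ← hz, hD, hσ, map_zero, sub_zero, sub_self, add_zero, map_add, h2]
  rw [hf, hσ, ← map_add, ← map_add]
  congr 1
  rw [hz]; abel

variable {R : Type u} [CommRing R] (m : Ideal R)

/-- Reduction of coefficients modulo an ideal. -/
def redCoeff (X : Type*) : (X →₀ R) →ₗ[R] (X →₀ R ⧸ m) :=
  Finsupp.mapRange.linearMap (Algebra.linearMap R (R ⧸ m))

theorem redCoeff_surjective (X : Type*) : Function.Surjective (redCoeff m X) :=
  Finsupp.mapRange_surjective _ (map_zero _) Ideal.Quotient.mk_surjective

theorem redCoeff_eq_zero_iff {X : Type*} (x : X →₀ R) :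
    redCoeff m X x = 0 ↔ ∀ i, x i ∈ m := by
  rw [Finsupp.ext_iff]
  exact forall_congr' fun i => Ideal.Quotient.eq_zero_iff_mem

/-- Reduction of a matrix modulo an ideal. -/
def redMap {X Y : Type*} (φ : (X →₀ R) →ₗ[R] (Y →₀ R)) :
    (X →₀ R ⧸ m) →ₗ[R ⧸ m] (Y →₀ R ⧸ m) :=
  Finsupp.linearCombination (R ⧸ m) fun j => redCoeff m Y (φ (Finsupp.single j 1))

theorem redMap_redCoeff {X Y : Type*} (φ : (X →₀ R) →ₗ[R] (Y →₀ R)) (x : X →₀ R) :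
    redMap m φ (redCoeff m X x) = redCoeff m Y (φ x) := by
  suffices h : ((redMap m φ).restrictScalars R) ∘ₗ redCoeff m X = redCoeff m Y ∘ₗ φ from
    LinearMap.congr_fun h x
  ext j i
  simp [redMap, redCoeff]

/-- The part of a map that preserves the homological degree. -/
def degreePart (F G : Cx R) (ψ : (F.X →₀ R) →ₗ[R] (G.X →₀ R)) : (F.X →₀ R) →ₗ[R] (G.X →₀ R) :=
  Finsupp.linearCombination R fun j => G.proj (F.h j) (ψ (Finsupp.single j 1))

theorem degreePart_single (F G : Cx R) (ψ : (F.X →₀ R) →ₗ[R] (G.X →₀ R)) (j : F.X) :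
    degreePart F G ψ (Finsupp.single j 1) = G.proj (F.h j) (ψ (Finsupp.single j 1)) := by
  simp [degreePart]

theorem degreePart_proj (F G : Cx R) (ψ : (F.X →₀ R) →ₗ[R] (G.X →₀ R)) (n : ℕ)
    (x : F.X →₀ R) : degreePart F G ψ (F.proj n x) = G.proj n (degreePart F G ψ x) := by
  suffices h : degreePart F G ψ ∘ₗ F.proj n = G.proj n ∘ₗ degreePart F G ψ from
    LinearMap.congr_fun h x
  refine linearMap_ext_single fun j => ?_
  ext i
  simp only [LinearMap.comp_apply, F.proj_single, degreePart_single, G.proj_apply]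
  by_cases hj : F.h j = n
  · rw [if_pos hj, degreePart_single, G.proj_apply, hj]
    split_ifs <;> rfl
  · rw [if_neg hj, map_zero, Finsupp.zero_apply]
    split_ifs <;> first | rfl | omega

/-- The differentials lower homological degree by exactly one, so the degree-preserving part of a
commuting map still commutes. Compatibility with the augmentations is assumed in degree zero only,
because a correction by an ungraded homotopy may destroy it elsewhere. -/
theorem IsLift.degreePart {F G : Cx R} {A B c : Ideal R} (hF : F.IsRes A) (hG : G.IsRes B)
    {ψ : (F.X →₀ R) →ₗ[R] (G.X →₀ R)} (hD : ∀ x, G.D (ψ x) = ψ (F.D x))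
    (haug : ∀ j, F.h j = 0 → G.aug (ψ (Finsupp.single j 1)) = F.aug (Finsupp.single j 1))
    (hc : ∀ x i, ψ x i ∈ c) : IsLift F G c (degreePart F G ψ) where
  comm_D x := by
    suffices h : G.D ∘ₗ MixedSum.degreePart F G ψ = MixedSum.degreePart F G ψ ∘ₗ F.D from
      LinearMap.congr_fun h x
    refine linearMap_ext_single fun j => ?_
    rw [LinearMap.comp_apply, LinearMap.comp_apply, degreePart_single]
    obtain hj | ⟨n, hj⟩ : F.h j = 0 ∨ ∃ n, F.h j = n + 1 := by
      cases F.h j <;> simp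
    · have : F.D (Finsupp.single j 1) = 0 := by
        ext i; by_contra hne; have := hF.D_h j i hne; omega
      rw [this, map_zero, hj, hG.D_proj_zero]
    · rw [hj, hG.D_proj_succ, hD]
      symm
      exact Cx.apply_eq_of_eq_on_degree (MixedSum.degreePart F G ψ) (G.proj n ∘ₗ ψ) n
        (fun i hi => by rw [degreePart_single, hi]; rfl) _
        (fun i hi => by have := hF.D_h j i hi; omega)
  comm_aug x := by
    suffices h : G.aug ∘ₗ MixedSum.degreePart F G ψ = F.aug from LinearMap.congr_fun h x
    refine linearMap_ext_single fun j => ?_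
    rw [LinearMap.comp_apply, degreePart_single]
    by_cases hj : F.h j = 0
    · rw [hj, hG.aug_proj_zero, haug j hj]
    · rw [hF.aug_h j hj]
      suffices h : ∀ y, G.aug (G.proj (F.h j) y) = 0 from h _
      intro y
      have : G.aug ∘ₗ G.proj (F.h j) = 0 := linearMap_ext_single fun i => by
        rw [LinearMap.comp_apply, G.proj_single]
        split_ifs with hi
        · rw [hG.aug_h i (by omega)]; rfl
        · simp
      exact LinearMap.congr_fun this y
  mem := apply_mem_of_single _ fun j i => by
    rw [degreePart_single, G.proj_apply]
    split_ifs
    · exact hc _ _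
    · exact c.zero_mem

/-- A lift that is zero on `H(F ⊗ R ⧸ m)` can be modified by a homotopy so that its entries
lie in `m`. -/
theorem IsLift.hasLift_of_zero_on_homology [hm : m.IsMaximal] {F G : Cx R} {A B : Ideal R}
    (hF : F.IsRes A) (hG : G.IsRes B)
    {φ : (F.X →₀ R) →ₗ[R] (G.X →₀ R)} (hφ : IsLift F G ⊤ φ)
    (h0 : ∀ x, (∀ i, F.D x i ∈ m) → ∃ y, ∀ i, (φ x - G.D y) i ∈ m) : HasLift F G m := by
  let _ := Ideal.Quotient.field m
  obtain ⟨h, hh⟩ := exists_nullhomotopy (redMap m F.D) (redMap m G.D) (redMap m φ)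
    (fun x => by
      obtain ⟨x, rfl⟩ := redCoeff_surjective m _ x
      simp only [redMap_redCoeff, hF.D_D, map_zero])
    (fun x => by
      obtain ⟨x, rfl⟩ := redCoeff_surjective m _ x
      simp only [redMap_redCoeff, hφ.comm_D])
    (fun x hx => by
      obtain ⟨x, rfl⟩ := redCoeff_surjective m _ x
      rw [redMap_redCoeff, redCoeff_eq_zero_iff] at hx
      obtain ⟨y, hy⟩ := h0 x hx
      refine ⟨redCoeff m _ y, ?_⟩
      rw [← redCoeff_eq_zero_iff, map_sub, sub_eq_zero] at hy
      rw [redMap_redCoeff, redMap_redCoeff, hy])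
  choose s hs using redCoeff_surjective m G.X
  let H : (F.X →₀ R) →ₗ[R] (G.X →₀ R) :=
    Finsupp.linearCombination R fun j => s (h (redCoeff m F.X (Finsupp.single j 1)))
  have hH : ∀ x, redCoeff m G.X (H x) = h (redCoeff m F.X x) := by
    intro x
    suffices hyp : redCoeff m G.X ∘ₗ H = (h.restrictScalars R) ∘ₗ redCoeff m F.X from
      LinearMap.congr_fun hyp x
    refine linearMap_ext_single fun j => ?_
    simp [H, hs]
  -- `H` lifts the homotopy `h` on basis elements, so the corrected map is zero modulo `m`. Nothing
  -- forces `H` to raise the homological degree by one; taking the degree-preserving part at the end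
  -- repairs this.
  refine ⟨_, IsLift.degreePart hF hG (ψ := φ - (G.D ∘ₗ H + H ∘ₗ F.D)) (fun x => ?_)
    (fun j hj => ?_) (fun x => ?_)⟩
  · simp [hF.D_D, hG.D_D, hφ.comm_D]
  · have : F.D (Finsupp.single j 1) = 0 := by
      ext i; by_contra hne; have := hF.D_h j i hne; omega
    simp [this, hG.aug_D, hφ.comm_aug]
  · rw [← redCoeff_eq_zero_iff]
    simp only [LinearMap.sub_apply, LinearMap.add_apply, LinearMap.comp_apply, map_sub, map_add,
      hH, ← redMap_redCoeff, hh, sub_self]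

end Homotopy

/-! ### Passage to chain complexes and projective resolutions in `ModuleCat`. -/

section Resolution

variable {R : Type u} [CommRing R]

/-- The basis elements of homological degree `n`. -/
abbrev Cx.Xn (F : Cx R) (n : ℕ) : Type u := {j : F.X // F.h j = n}

/-- Inclusion of the part of homological degree `n`. -/
def Cx.incl (F : Cx R) (n : ℕ) : (F.Xn n →₀ R) →ₗ[R] (F.X →₀ R) :=
  Finsupp.lmapDomain R R Subtype.val

/-- Restriction to the part of homological degree `n`. -/
def Cx.restr (F : Cx R) (n : ℕ) : (F.X →₀ R) →ₗ[R] (F.Xn n →₀ R) :=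
  Finsupp.lsubtypeDomain {j : F.X | F.h j = n}

theorem Cx.incl_single (F : Cx R) (n : ℕ) (j : F.Xn n) (a : R) :
    F.incl n (Finsupp.single j a) = Finsupp.single j.1 a := by
  simp [Cx.incl]

theorem Cx.restr_apply (F : Cx R) (n : ℕ) (x : F.X →₀ R) (j : F.Xn n) :
    F.restr n x j = x j.1 := rfl

theorem Cx.restr_incl (F : Cx R) (n : ℕ) (x : F.Xn n →₀ R) : F.restr n (F.incl n x) = x := by
  ext j
  rw [F.restr_apply]
  exact Finsupp.mapDomain_apply Subtype.val_injective x j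

theorem Cx.incl_restr (F : Cx R) (n : ℕ) (x : F.X →₀ R) :
    F.incl n (F.restr n x) = F.proj n x := by
  ext i
  rw [F.proj_apply]
  split_ifs with hi
  · subst hi
    exact Finsupp.mapDomain_apply Subtype.val_injective (F.restr (F.h i) x) ⟨i, rfl⟩
  · exact Finsupp.mapDomain_of_notMem_range _ _ (by rintro ⟨j, rfl⟩; exact hi j.2)

theorem Cx.proj_incl (F : Cx R) (n : ℕ) (x : F.Xn n →₀ R) :
    F.proj n (F.incl n x) = F.incl n x := by
  rw [← F.incl_restr, F.restr_incl]

/-- The block of the differential between homological degrees `n` and `p`. -/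
def Cx.dd (F : Cx R) (n p : ℕ) : (F.Xn n →₀ R) →ₗ[R] (F.Xn p →₀ R) :=
  F.restr p ∘ₗ F.D ∘ₗ F.incl n

theorem Cx.IsRes.incl_dd {F : Cx R} {A : Ideal R} (hF : F.IsRes A) (n : ℕ)
    (x : F.Xn (n + 1) →₀ R) : F.incl n (F.dd (n + 1) n x) = F.D (F.incl (n + 1) x) := by
  simp only [Cx.dd, LinearMap.comp_apply]
  rw [F.incl_restr, ← hF.D_proj_succ, F.proj_incl]

theorem Cx.IsRes.D_incl_zero {F : Cx R} {A : Ideal R} (hF : F.IsRes A)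
    (x : F.Xn 0 →₀ R) : F.D (F.incl 0 x) = 0 := by
  rw [← F.proj_incl, hF.D_proj_zero]

theorem Cx.IsRes.dd_restr {F : Cx R} {A : Ideal R} (hF : F.IsRes A) (n : ℕ)
    (x : F.X →₀ R) : F.dd (n + 1) n (F.restr (n + 1) x) = F.restr n (F.D x) := by
  simp only [Cx.dd, LinearMap.comp_apply]
  rw [F.incl_restr, hF.D_proj_succ, ← F.incl_restr, F.restr_incl]

theorem Cx.IsRes.dd_eq_zero {F : Cx R} {A : Ideal R} (hF : F.IsRes A) {n p : ℕ}
    (h : p + 1 ≠ n) : F.dd n p = 0 := by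
  refine linearMap_ext_single fun j => ?_
  ext i
  simp only [Cx.dd, LinearMap.comp_apply, F.incl_single, F.restr_apply]
  by_contra hne
  have := hF.D_h _ _ hne
  have h1 := j.2
  have h2 := i.2
  omega

theorem Cx.IsRes.dd_dd {F : Cx R} {A : Ideal R} (hF : F.IsRes A) (n : ℕ)
    (x : F.Xn (n + 2) →₀ R) : F.dd (n + 1) n (F.dd (n + 2) (n + 1) x) = 0 := by
  have : F.dd (n + 2) (n + 1) x = F.restr (n + 1) (F.D (F.incl (n + 2) x)) := rfl
  rw [this, hF.dd_restr, hF.D_D, map_zero]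

theorem Cx.IsRes.exact_dd {F : Cx R} {A : Ideal R} (hF : F.IsRes A) (n : ℕ)
    (x : F.Xn (n + 1) →₀ R) (hx : F.dd (n + 1) n x = 0) : ∃ y, F.dd (n + 2) (n + 1) y = x := by
  obtain ⟨y, hy⟩ := hF.exact (F.incl (n + 1) x) (by rw [← hF.incl_dd, hx, map_zero])
    (by
      have : F.aug ∘ₗ F.incl (n + 1) = 0 := linearMap_ext_single fun j => by
        rw [LinearMap.comp_apply, F.incl_single]
        exact hF.aug_h _ (by have := j.2; omega)
      exact LinearMap.congr_fun this x)
  exact ⟨F.restr (n + 2) y, by rw [hF.dd_restr, hy, F.restr_incl]⟩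

theorem Cx.IsRes.exact_aug {F : Cx R} {A : Ideal R} (hF : F.IsRes A)
    (x : F.Xn 0 →₀ R) (hx : F.aug (F.incl 0 x) = 0) : ∃ y, F.dd 1 0 y = x := by
  obtain ⟨y, hy⟩ := hF.exact (F.incl 0 x) (hF.D_incl_zero x) hx
  exact ⟨F.restr 1 y, by rw [hF.dd_restr, hy, F.restr_incl]⟩

/-- The augmentation onto the resolved ideal. -/
def Cx.IsRes.augTo {F : Cx R} {A : Ideal R} (hF : F.IsRes A) : (F.Xn 0 →₀ R) →ₗ[R] A :=
  (F.aug ∘ₗ F.incl 0).codRestrict A fun _ => hF.aug_mem _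

theorem Cx.IsRes.augTo_surjective {F : Cx R} {A : Ideal R} (hF : F.IsRes A) :
    Function.Surjective hF.augTo := by
  rintro ⟨a, ha⟩
  rw [← hF.range_aug] at ha
  obtain ⟨x, rfl⟩ := ha
  refine ⟨F.restr 0 x, Subtype.ext ?_⟩
  change F.aug (F.incl 0 (F.restr 0 x)) = _
  rw [F.incl_restr, hF.aug_proj_zero]

/-- The chain complex underlying a free resolution. -/
def Cx.IsRes.chainComplex {F : Cx R} {A : Ideal R} (hF : F.IsRes A) :
    ChainComplex (ModuleCat.{u} R) ℕ where
  X n := ModuleCat.of R (F.Xn n →₀ R)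
  d n p := ModuleCat.ofHom (F.dd n p)
  shape n p h := by
    rw [hF.dd_eq_zero (by simpa using h)]; rfl
  d_comp_d' := by
    rintro _ _ n rfl rfl
    rw [← ModuleCat.ofHom_comp]
    ext1
    exact LinearMap.ext (hF.dd_dd n)

/-- The projective resolution given by a free resolution of an ideal. -/
def Cx.IsRes.projectiveResolution {F : Cx R} {A : Ideal R} (hF : F.IsRes A) :
    ProjectiveResolution (ModuleCat.of R A) where
  complex := hF.chainComplex
  projective n := by
    change Projective (ModuleCat.of R (F.Xn n →₀ R))
    infer_instance
  π := (ChainComplex.toSingle₀Equiv _ _).symm ⟨ModuleCat.ofHom hF.augTo, by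
    change ModuleCat.ofHom (F.dd 1 0) ≫ _ = _
    rw [← ModuleCat.ofHom_comp]
    ext1
    refine LinearMap.ext fun x => Subtype.ext ?_
    change F.aug (F.incl 0 (F.dd 1 0 x)) = 0
    rw [hF.incl_dd, hF.aug_D]⟩
  quasiIso := ⟨fun n => by
    cases n
    -- In degree zero the quasi-isomorphism condition is exactness at the degree-zero term together
    -- with surjectivity of the augmentation. In positive degrees the target has no homology and
    -- plain exactness remains.
    · rw [ChainComplex.quasiIsoAt₀_iff, ShortComplex.quasiIso_iff_of_zeros']
      · let S : ShortComplex (ModuleCat.{u} R) := ShortComplex.mk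
          (ModuleCat.ofHom (F.dd 1 0)) (ModuleCat.ofHom hF.augTo) (by
            rw [← ModuleCat.ofHom_comp]
            ext1
            refine LinearMap.ext fun x => Subtype.ext ?_
            change F.aug (F.incl 0 (F.dd 1 0 x)) = 0
            rw [hF.incl_dd, hF.aug_D])
        refine (ShortComplex.exact_and_epi_g_iff_of_iso (S₂ := S) ?_).2 ⟨?_, ?_⟩
        · exact ShortComplex.isoMk (Iso.refl _) (Iso.refl _) (Iso.refl _)
            (by simp [S]; rfl) (by
              refine (Category.id_comp _).trans (Eq.trans ?_ (Category.comp_id _).symm)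
              exact (ChainComplex.toSingle₀Equiv_symm_apply_f_zero (C := hF.chainComplex)
                (X := ModuleCat.of R A) (ModuleCat.ofHom hF.augTo) S.zero).symm)
        · rw [ShortComplex.moduleCat_exact_iff]
          intro x hx
          exact hF.exact_aug x (congrArg Subtype.val hx)
        · rw [ModuleCat.epi_iff_surjective]
          exact hF.augTo_surjective
      · change ModuleCat.ofHom (F.dd 0 0) = 0
        rw [hF.dd_eq_zero (by omega)]; rfl
      all_goals rfl
    · rw [quasiIsoAt_iff_exactAt']
      · rename_i n
        rw [HomologicalComplex.exactAt_iff' _ (n + 1 + 1) (n + 1) n (by simp) (by simp)]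
        rw [ShortComplex.moduleCat_exact_iff]
        exact fun x hx => hF.exact_dd n x hx
      · apply ChainComplex.exactAt_succ_single_obj⟩

/-- The chain map given by a lift. -/
def IsLift.chainMap {F G : Cx R} {A B c : Ideal R} (hF : F.IsRes A) (hG : G.IsRes B)
    {φ : (F.X →₀ R) →ₗ[R] (G.X →₀ R)} (hφ : IsLift F G c φ) :
    hF.chainComplex ⟶ hG.chainComplex where
  f n := ModuleCat.ofHom (G.restr n ∘ₗ φ ∘ₗ F.incl n)
  comm' := by
    rintro _ n rfl
    change ModuleCat.ofHom _ ≫ ModuleCat.ofHom (G.dd _ _) = ModuleCat.ofHom (F.dd _ _) ≫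
      ModuleCat.ofHom _
    rw [← ModuleCat.ofHom_comp, ← ModuleCat.ofHom_comp]
    ext1
    refine LinearMap.ext fun x => ?_
    simp only [LinearMap.comp_apply, hF.incl_dd, hG.dd_restr, ModuleCat.hom_ofHom, hφ.comm_D]

end Resolution

/-! ### Homology of the reduced complex in terms of chains and matrix entries. -/

section TorHomology

open MonoidalCategory in
/-- Tensoring modules with `R ⧸ m` on the left. -/
abbrev quotTensor {R : Type u} [CommRing R] (m : Ideal R) :
    ModuleCat.{u} R ⥤ ModuleCat.{u} R :=
  (tensoringLeft (ModuleCat.{u} R)).obj (ModuleCat.of R (R ⧸ m))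

variable {R : Type u} [CommRing R] (m : Ideal R)

/-- Tensoring a free module `L` with `R ⧸ m` gives `L / mL`. This turns every vanishing question in
the tensored complex into one about coordinates. -/
theorem one_tmul_eq_zero_iff {X : Type u} (x : X →₀ R) :
    (1 : R ⧸ m) ⊗ₜ[R] x = 0 ↔ ∀ i, x i ∈ m := by
  rw [← mem_smul_top_iff, ← Submodule.Quotient.mk_eq_zero,
    ← LinearEquiv.map_eq_zero_iff (TensorProduct.quotTensorEquivQuotSMul (X →₀ R) m), ← map_one (Ideal.Quotient.mk m),
    TensorProduct.quotTensorEquivQuotSMul_mk_tmul, one_smul]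

theorem exists_one_tmul {M : Type u} [AddCommGroup M] [Module R M] (w : (R ⧸ m) ⊗[R] M) :
    ∃ x : M, (1 : R ⧸ m) ⊗ₜ[R] x = w := by
  induction w with
  | zero => exact ⟨0, TensorProduct.tmul_zero _ _⟩
  | add a b ha hb =>
    obtain ⟨x, rfl⟩ := ha
    obtain ⟨y, rfl⟩ := hb
    exact ⟨x + y, TensorProduct.tmul_add _ _ _⟩
  | tmul r x =>
    obtain ⟨r, rfl⟩ := Ideal.Quotient.mk_surjective r
    refine ⟨r • x, ?_⟩
    rw [← TensorProduct.smul_tmul]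
    congr 1
    rw [Algebra.smul_def, mul_one]; rfl

/-- Homology embeds into the opcycles, that is, the cokernel of `S.f`, where the class of a cycle
becomes the class of the underlying element. -/
theorem homologyπ_eq_zero_iff (S : ShortComplex (ModuleCat.{u} R)) (c : S.cycles) :
    S.homologyπ c = 0 ↔ ∃ y, S.f y = S.iCycles c := by
  have h1 : S.homologyι (S.homologyπ c) = S.pOpcycles (S.iCycles c) := by
    rw [← ConcreteCategory.comp_apply, S.homology_π_ι, ConcreteCategory.comp_apply]
  have h2 : Function.Injective S.homologyι := (ModuleCat.mono_iff_injective _).1 inferInstance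
  rw [← map_eq_zero_iff S.homologyι.hom h2]
  change S.homologyι (S.homologyπ c) = 0 ↔ _
  rw [h1, ShortComplex.moduleCat_pOpcycles_eq_zero_iff]
  rfl

/-- Chains of degree `n` whose boundary vanishes modulo `m`. -/
def Cx.Z (F : Cx R) (n : ℕ) : Submodule R (F.X →₀ R) where
  carrier := {x | F.proj n x = x ∧ ∀ i, F.D x i ∈ m}
  add_mem' := fun {a b} ha hb => ⟨by rw [map_add, ha.1, hb.1], fun i => by
    rw [map_add]; exact m.add_mem (ha.2 i) (hb.2 i)⟩
  zero_mem' := ⟨map_zero _, fun i => by simp⟩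
  smul_mem' := fun r x hx => ⟨by rw [map_smul, hx.1], fun i => by
    rw [map_smul]; exact m.mul_mem_left r (hx.2 i)⟩

/-- The complex `R ⧸ m ⊗ F`. -/
abbrev Cx.IsRes.tensored {F : Cx R} {A : Ideal R} (hF : F.IsRes A) :
    ChainComplex (ModuleCat.{u} R) ℕ :=
  ((quotTensor m).mapHomologicalComplex _).obj hF.chainComplex

/-- The class `1 ⊗ x` of a chain. -/
def Cx.one_tmul (F : Cx R) (n : ℕ) : (F.X →₀ R) →ₗ[R] (R ⧸ m) ⊗[R] (F.Xn n →₀ R) :=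
  TensorProduct.mk R (R ⧸ m) _ 1 ∘ₗ F.restr n

theorem Cx.IsRes.g_one_tmul {F : Cx R} {A : Ideal R} (hF : F.IsRes A) (n : ℕ) (x : F.Z m n) :
    ((hF.tensored m).sc n).g (F.one_tmul m n x.1) = 0 := by
  change (1 : R ⧸ m) ⊗ₜ[R] (F.dd n ((ComplexShape.down ℕ).next n) (F.restr n x.1)) = 0
  rw [one_tmul_eq_zero_iff]
  intro i
  simp only [Cx.dd, LinearMap.comp_apply, F.restr_apply, F.incl_restr, x.2.1]
  exact x.2.2 _

/-- The homology class of a chain that is a cycle modulo `m`. -/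
def Cx.IsRes.cls {F : Cx R} {A : Ideal R} (hF : F.IsRes A) (n : ℕ) :
    F.Z m n →ₗ[R] (hF.tensored m).homology n :=
  (((hF.tensored m).sc n).liftCycles
    (ModuleCat.ofHom (F.one_tmul m n ∘ₗ (F.Z m n).subtype) : ModuleCat.of R (F.Z m n) ⟶ _)
    (by ext x; exact hF.g_one_tmul m n x) ≫ (hF.tensored m).homologyπ n).hom

theorem Cx.IsRes.exists_cls {F : Cx R} {A : Ideal R} (hF : F.IsRes A) (n : ℕ) (x : F.Z m n) :
    ∃ c : (hF.tensored m).cycles n, (hF.tensored m).homologyπ n c = hF.cls m n x ∧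
      (hF.tensored m).iCycles n c = F.one_tmul m n x.1 := by
  let f : ModuleCat.of R (F.Z m n) ⟶ ((hF.tensored m).sc n).X₂ :=
    ModuleCat.ofHom (F.one_tmul m n ∘ₗ (F.Z m n).subtype)
  have hf : f ≫ ((hF.tensored m).sc n).g = 0 := by ext x; exact hF.g_one_tmul m n x
  refine ⟨((hF.tensored m).sc n).liftCycles f hf x, rfl, ?_⟩
  exact ConcreteCategory.congr_hom (((hF.tensored m).sc n).liftCycles_i f hf) x

theorem Cx.boundary_iff {F : Cx R} {A : Ideal R} (hF : F.IsRes A) {n p : ℕ} (hp : p = n + 1)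
    (x : F.X →₀ R) (hx : F.proj n x = x) :
    (∃ y, ∀ i, (F.dd p n y - F.restr n x) i ∈ m) ↔ ∃ y, ∀ i, (x - F.D y) i ∈ m := by
  subst hp
  constructor
  · rintro ⟨y, hy⟩
    refine ⟨F.incl (n + 1) y, fun i => ?_⟩
    have h1 : x - F.D (F.incl (n + 1) y) = F.incl n (F.restr n x - F.dd (n + 1) n y) := by
      rw [map_sub, hF.incl_dd, F.incl_restr, hx]
    rw [h1]
    refine apply_mem_of_mem _ _ (fun j => ?_) i
    rw [← neg_sub, Finsupp.neg_apply]
    exact m.neg_mem (hy j)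
  · rintro ⟨y, hy⟩
    refine ⟨F.restr (n + 1) y, fun i => ?_⟩
    rw [hF.dd_restr, ← neg_sub, ← map_sub, Finsupp.neg_apply]
    exact m.neg_mem (hy _)

/-- Together with `cls_surjective` this presents the homology as chains that are cycles modulo `m`,
up to boundaries modulo `m`. Later arguments use only this presentation. -/
theorem Cx.IsRes.cls_eq_zero_iff {F : Cx R} {A : Ideal R} (hF : F.IsRes A) (n : ℕ)
    (x : F.Z m n) : hF.cls m n x = 0 ↔ ∃ y, ∀ i, (x.1 - F.D y) i ∈ m := by
  obtain ⟨c, hc, hc'⟩ := hF.exists_cls m n x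
  rw [← hc, ← Cx.boundary_iff m hF (p := (ComplexShape.down ℕ).prev n) (by simp) x.1 x.2.1]
  refine (homologyπ_eq_zero_iff ((hF.tensored m).sc n) c).trans ?_
  change (∃ y, ((hF.tensored m).sc n).f y = (hF.tensored m).iCycles n c) ↔ _
  rw [hc']
  have key : ∀ y : F.Xn ((ComplexShape.down ℕ).prev n) →₀ R,
      ((hF.tensored m).sc n).f ((1 : R ⧸ m) ⊗ₜ[R] y) = F.one_tmul m n x.1 ↔
        ∀ i, (F.dd ((ComplexShape.down ℕ).prev n) n y - F.restr n x.1) i ∈ m := fun y => by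
    change (1 : R ⧸ m) ⊗ₜ[R] (F.dd ((ComplexShape.down ℕ).prev n) n y) =
      (1 : R ⧸ m) ⊗ₜ[R] F.restr n x.1 ↔ _
    rw [← sub_eq_zero, ← TensorProduct.tmul_sub, one_tmul_eq_zero_iff]
  constructor
  · rintro ⟨w, hw⟩
    obtain ⟨y, rfl⟩ := exists_one_tmul (M := F.Xn ((ComplexShape.down ℕ).prev n) →₀ R) m w
    exact ⟨y, (key y).1 hw⟩
  · rintro ⟨y, hy⟩
    exact ⟨_, (key y).2 hy⟩

/-- The alternative `n = 0` covers the bottom of the complex, where `(ComplexShape.down ℕ).next` is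
only a default value and the differential vanishes anyway. -/
theorem Cx.mem_of_dd {F : Cx R} {A : Ideal R} (hF : F.IsRes A) {n p : ℕ}
    (hp : p + 1 = n ∨ n = 0) (x : F.Xn n →₀ R) (hx : ∀ i, F.dd n p x i ∈ m) (i : F.X) :
    F.D (F.incl n x) i ∈ m := by
  obtain rfl | rfl := hp
  · rw [← hF.incl_dd]
    exact apply_mem_of_mem _ _ hx i
  · rw [hF.D_incl_zero]; exact m.zero_mem

theorem Cx.IsRes.cls_surjective {F : Cx R} {A : Ideal R} (hF : F.IsRes A) (n : ℕ) :
    Function.Surjective (hF.cls m n) := by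
  intro z
  obtain ⟨c, rfl⟩ := (ModuleCat.epi_iff_surjective ((hF.tensored m).homologyπ n)).1
    inferInstance z
  obtain ⟨x, hx⟩ := exists_one_tmul (M := F.Xn n →₀ R) m ((hF.tensored m).iCycles n c)
  have hg : ((hF.tensored m).sc n).g ((hF.tensored m).iCycles n c) = 0 :=
    ConcreteCategory.congr_hom (((hF.tensored m).sc n).iCycles_g) c
  have hg' : (1 : R ⧸ m) ⊗ₜ[R] (F.dd n ((ComplexShape.down ℕ).next n) x) = 0 := by
    rw [← hx] at hg
    exact hg
  rw [one_tmul_eq_zero_iff] at hg'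
  let z : F.Z m n := ⟨F.incl n x, F.proj_incl n x, Cx.mem_of_dd m hF (by
    cases n <;> simp) x hg'⟩
  refine ⟨z, ?_⟩
  obtain ⟨c', hc, hc'⟩ := hF.exists_cls m n z
  rw [← hc]
  congr 1
  refine (ModuleCat.mono_iff_injective ((hF.tensored m).iCycles n)).1 inferInstance ?_
  rw [hc', ← hx]
  change (1 : R ⧸ m) ⊗ₜ[R] F.restr n (F.incl n x) = _
  rw [F.restr_incl]
  rfl

/-- Congruence modulo `m` is enough because `1 ⊗ _` kills `m`. Taking `x' = 0` shows that maps with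
entries in `m` vanish on homology; taking `x' = φ x` serves the converse. -/
theorem IsLift.map_cls {F G : Cx R} {A B c : Ideal R} (hF : F.IsRes A) (hG : G.IsRes B)
    {φ : (F.X →₀ R) →ₗ[R] (G.X →₀ R)} (hφ : IsLift F G c φ) (n : ℕ)
    (x : F.Z m n) (x' : G.Z m n) (hx : ∀ i, (G.proj n (φ x.1) - x'.1) i ∈ m) :
    HomologicalComplex.homologyMap
      (((quotTensor m).mapHomologicalComplex _).map (hφ.chainMap hF hG)) n (hF.cls m n x) =
      hG.cls m n x' := by
  obtain ⟨c, hc, hc'⟩ := hF.exists_cls m n x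
  obtain ⟨d, hd, hd'⟩ := hG.exists_cls m n x'
  rw [← hc, ← hd]
  set f := ((quotTensor m).mapHomologicalComplex (ComplexShape.down ℕ)).map (hφ.chainMap hF hG)
  have h1 := ConcreteCategory.congr_hom (HomologicalComplex.homologyπ_naturality f n) c
  refine h1.trans ?_
  change (hG.tensored m).homologyπ n (HomologicalComplex.cyclesMap f n c) = _
  congr 1
  refine (ModuleCat.mono_iff_injective ((hG.tensored m).iCycles n)).1 inferInstance ?_
  have h2 : (hG.tensored m).iCycles n (HomologicalComplex.cyclesMap f n c) =
    f.f n ((hF.tensored m).iCycles n c) :=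
    ConcreteCategory.congr_hom (HomologicalComplex.cyclesMap_i f n) c
  rw [h2, hc', hd']
  change (1 : R ⧸ m) ⊗ₜ[R] (G.restr n (φ (F.incl n (F.restr n x.1)))) =
    (1 : R ⧸ m) ⊗ₜ[R] (G.restr n x'.1)
  rw [← sub_eq_zero, ← TensorProduct.tmul_sub, one_tmul_eq_zero_iff, F.incl_restr, x.2.1]
  intro i
  have := hx i.1
  rw [Finsupp.sub_apply, G.proj_apply, if_pos i.2] at this
  exact this

end TorHomology

/-! ### Tor-vanishing is the existence of a lift with entries in the maximal ideal. -/

section TorVanishing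

variable {k R : Type u} [Field k] [CommRing R] [Algebra k R] (𝒜 : ℕ → Submodule k R)

/-- `Tor` computed by a free resolution. -/
def Cx.IsRes.torIso {F : Cx R} {A : Ideal R} (hF : F.IsRes A) (i : ℕ) :
    ((Tor (ModuleCat.{u} R) i).obj (ModuleCat.of R (R ⧸ gradedMax 𝒜))).obj (ModuleCat.of R A) ≅
      (hF.tensored (gradedMax 𝒜)).homology i :=
  hF.projectiveResolution.isoLeftDerivedObj (quotTensor (gradedMax 𝒜)) i

/-- Left derived functors may be computed on any chain map compatible with the augmentations, so
every lift computes `Tor` of the inclusion. -/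
theorem IsLift.torMap_comp {F G : Cx R} {A B c : Ideal R} (hF : F.IsRes A) (hG : G.IsRes B)
    {φ : (F.X →₀ R) →ₗ[R] (G.X →₀ R)} (hφ : IsLift F G c φ) (hAB : A ≤ B) (i : ℕ) :
    torMap 𝒜 i (Submodule.inclusion hAB) ≫ (hG.torIso 𝒜 i).hom =
      (hF.torIso 𝒜 i).hom ≫ HomologicalComplex.homologyMap
        (((quotTensor (gradedMax 𝒜)).mapHomologicalComplex _).map (hφ.chainMap hF hG)) i := by
  refine ProjectiveResolution.isoLeftDerivedObj_hom_naturality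
    (ModuleCat.ofHom (Submodule.inclusion hAB)) hF.projectiveResolution hG.projectiveResolution
    (hφ.chainMap hF hG) ?_ (quotTensor (gradedMax 𝒜)) i
  have h1 : hF.projectiveResolution.π.f 0 = ModuleCat.ofHom hF.augTo :=
    ChainComplex.toSingle₀Equiv_symm_apply_f_zero (C := hF.chainComplex)
      (X := ModuleCat.of R A) (ModuleCat.ofHom hF.augTo) _
  have h2 : hG.projectiveResolution.π.f 0 = ModuleCat.ofHom hG.augTo :=
    ChainComplex.toSingle₀Equiv_symm_apply_f_zero (C := hG.chainComplex)
      (X := ModuleCat.of R B) (ModuleCat.ofHom hG.augTo) _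
  rw [h1, h2]
  ext x
  refine Subtype.ext ?_
  change G.aug (G.incl 0 (G.restr 0 (φ (F.incl 0 x)))) = F.aug (F.incl 0 x)
  rw [G.incl_restr, hG.aug_proj_zero, hφ.comm_aug]

theorem IsLift.isTorVanishing {F G : Cx R} {A B : Ideal R} (hF : F.IsRes A) (hG : G.IsRes B)
    {φ : (F.X →₀ R) →ₗ[R] (G.X →₀ R)} (hφ : IsLift F G (gradedMax 𝒜) φ) :
    IsTorVanishing 𝒜 (Submodule.inclusion (hφ.le hF hG)) := by
  intro i
  rw [← cancel_mono (hG.torIso 𝒜 i).hom, hφ.torMap_comp 𝒜 hF hG]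
  have : HomologicalComplex.homologyMap
      (((quotTensor (gradedMax 𝒜)).mapHomologicalComplex _).map (hφ.chainMap hF hG)) i = 0 := by
    ext z
    obtain ⟨x, rfl⟩ := hF.cls_surjective (gradedMax 𝒜) i z
    refine (hφ.map_cls (gradedMax 𝒜) hF hG i x 0 fun j => ?_).trans (map_zero _)
    change (G.proj i (φ x.1) - 0) j ∈ _
    rw [sub_zero, G.proj_apply]
    split_ifs
    · exact hφ.mem _ _
    · exact Ideal.zero_mem _
  rw [this, Limits.comp_zero, Limits.zero_comp]

theorem inclusionTorVanishing_of_hasLift {F G : Cx R} {A B : Ideal R} (hF : F.IsRes A)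
    (hG : G.IsRes B) (h : HasLift F G (gradedMax 𝒜)) : InclusionTorVanishing 𝒜 A B := by
  obtain ⟨φ, hφ⟩ := h
  exact ⟨hφ.le hF hG, hφ.isTorVanishing 𝒜 hF hG⟩

/-- A comparison lift acts as zero on the homology modulo the maximal ideal, so a homotopy moves its
entries into that ideal. This works for every pair of resolutions, hence one resolution per power of
an ideal suffices. -/
theorem InclusionTorVanishing.hasLift [hm : (gradedMax 𝒜).IsMaximal] {F G : Cx R}
    {A B : Ideal R} (hF : F.IsRes A) (hG : G.IsRes B) (h : InclusionTorVanishing 𝒜 A B) :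
    HasLift F G (gradedMax 𝒜) := by
  obtain ⟨hAB, hvan⟩ := h
  obtain ⟨φ₀, hφ₀⟩ := hasLift_top hF hG hAB
  have hφ := IsLift.degreePart hF hG hφ₀.comm_D (fun j _ => hφ₀.comm_aug _) hφ₀.mem
  set φ := degreePart F G φ₀ with hφdef
  have hproj : ∀ n x, φ (F.proj n x) = G.proj n (φ x) := degreePart_proj F G φ₀
  refine hφ.hasLift_of_zero_on_homology (gradedMax 𝒜) hF hG fun x hx => ?_
  -- The homotopy criterion concerns chains of mixed homological degree, while `Tor` sees one degree
  -- at a time; `x` is the sum of finitely many homogeneous parts.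
  have hsum : ∃ N, ∑ n ∈ Finset.range N, F.proj n x = x := by
    refine ⟨x.support.sup F.h + 1, ?_⟩
    ext i
    rw [Finsupp.finsetSum_apply]
    simp only [F.proj_apply, Finset.sum_ite_eq, Finset.mem_range]
    split_ifs with hi
    · rfl
    · by_contra hne
      exact hi (Nat.lt_succ_of_le (Finset.le_sup (f := F.h)
        (Finsupp.mem_support_iff.2 (Ne.symm hne))))
  have hn : ∀ n, ∃ y, ∀ i, (φ (F.proj n x) - G.D y) i ∈ gradedMax 𝒜 := by
    intro n
    have hZ : F.proj n x ∈ F.Z (gradedMax 𝒜) n := by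
      refine ⟨by rw [← F.incl_restr n x, F.proj_incl], fun i => ?_⟩
      cases n with
      | zero => rw [hF.D_proj_zero]; exact Ideal.zero_mem _
      | succ n =>
        rw [hF.D_proj_succ, F.proj_apply]
        split_ifs
        · exact hx i
        · exact Ideal.zero_mem _
    have hZ' : φ (F.proj n x) ∈ G.Z (gradedMax 𝒜) n :=
      ⟨by rw [← hproj, hZ.1], fun i => by
        rw [hφ.comm_D]; exact apply_mem_of_mem _ _ hZ.2 i⟩
    rw [← hG.cls_eq_zero_iff (gradedMax 𝒜) n ⟨_, hZ'⟩,
      ← hφ.map_cls (gradedMax 𝒜) hF hG n ⟨_, hZ⟩ ⟨_, hZ'⟩ fun i => by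
        change (G.proj n (φ (F.proj n x)) - φ (F.proj n x)) i ∈ _
        rw [hZ'.1, sub_self]; exact Ideal.zero_mem _]
    have h0 : (hF.torIso 𝒜 n).hom ≫ HomologicalComplex.homologyMap
        (((quotTensor (gradedMax 𝒜)).mapHomologicalComplex _).map (hφ.chainMap hF hG)) n =
        (hF.torIso 𝒜 n).hom ≫ 0 := by
      rw [← hφ.torMap_comp 𝒜 hF hG hAB, hvan n, Limits.zero_comp, Limits.comp_zero]
    rw [(cancel_epi _).1 h0]
    rfl
  obtain ⟨N, hN⟩ := hsum
  choose y hy using hn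
  refine ⟨∑ n ∈ Finset.range N, y n, fun i => ?_⟩
  rw [← hN, map_sum, map_sum, ← Finset.sum_sub_distrib, Finsupp.finsetSum_apply]
  exact Ideal.sum_mem _ fun n _ => hy n i

end TorVanishing

/-! ### Betti numbers as dimensions of homology. -/

section Betti

variable {k R : Type u} [Field k] [CommRing R] [Algebra k R] (𝒜 : ℕ → Submodule k R)

variable (k) in
/-- The dimension over `k` of an `R`-module. -/
def rankOver (N : Type u) [AddCommGroup N] [Module R N] : Cardinal.{u} :=
  Module.rank k ((ModuleCat.restrictScalars (algebraMap k R)).obj (ModuleCat.of R N))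

theorem rankOver_congr {N N' : Type u} [AddCommGroup N] [Module R N] [AddCommGroup N']
    [Module R N'] (e : N ≃ₗ[R] N') : rankOver (R := R) k N = rankOver (R := R) k N' :=
  ((ModuleCat.restrictScalars (algebraMap k R)).mapIso e.toModuleIso).toLinearEquiv.rank_eq

theorem rankOver_prod {N N' : Type u} [AddCommGroup N] [Module R N] [AddCommGroup N']
    [Module R N'] :
    rankOver (R := R) k (N × N') = rankOver (R := R) k N + rankOver (R := R) k N' := by
  rw [rankOver, rankOver, rankOver, ← rank_prod']
  refine LinearEquiv.rank_eq (R := k) (M := (ModuleCat.restrictScalars (algebraMap k R)).obj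
    (ModuleCat.of R (N × N'))) (M₁ := (ModuleCat.restrictScalars (algebraMap k R)).obj
    (ModuleCat.of R N) × (ModuleCat.restrictScalars (algebraMap k R)).obj (ModuleCat.of R N'))
    { toFun := fun x => x, invFun := fun x => x, left_inv := fun _ => rfl,
      right_inv := fun _ => rfl, map_add' := fun _ _ => rfl, map_smul' := fun _ _ => rfl }

theorem Cx.IsRes.betti_eq {F : Cx R} {A : Ideal R} (hF : F.IsRes A) (i : ℕ) :
    betti 𝒜 i A = rankOver (R := R) k ((hF.tensored (gradedMax 𝒜)).homology i) :=
  ((ModuleCat.restrictScalars (algebraMap k R)).mapIso (hF.torIso 𝒜 i)).toLinearEquiv.rank_eq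

/-- `θ` and the class map are surjections from the same module with the same kernel, so their
targets are isomorphic. -/
theorem Cx.IsRes.betti_eq_of_surjective {F : Cx R} {A : Ideal R} (hF : F.IsRes A) (i : ℕ)
    {N : Type u} [AddCommGroup N] [Module R N] (θ : F.Z (gradedMax 𝒜) i →ₗ[R] N)
    (hθ : Function.Surjective θ)
    (hker : ∀ x, θ x = 0 ↔ ∃ y, ∀ j, (x.1 - F.D y) j ∈ gradedMax 𝒜) :
    betti 𝒜 i A = rankOver (R := R) k N := by
  rw [hF.betti_eq 𝒜]
  have h : LinearMap.ker (hF.cls (gradedMax 𝒜) i) = LinearMap.ker θ := by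
    ext x
    rw [LinearMap.mem_ker, LinearMap.mem_ker, hker, hF.cls_eq_zero_iff]
  let e₁ := LinearMap.quotKerEquivOfSurjective (M := F.Z (gradedMax 𝒜) i) (hF.cls (gradedMax 𝒜) i) (hF.cls_surjective _ i)
  let e₂ := LinearMap.quotKerEquivOfSurjective (M := F.Z (gradedMax 𝒜) i) θ hθ
  exact rankOver_congr (e₁.symm ≪≫ₗ Submodule.quotEquivOfEq _ _ h ≪≫ₗ e₂)

end Betti

/-! ### Mapping cones of resolutions and maps between them. -/

section Cone

variable {R : Type u} [CommRing R]

/-- The map has entries only between basis elements of equal homological degree. -/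
def PreservesH (F G : Cx R) (φ : (F.X →₀ R) →ₗ[R] (G.X →₀ R)) : Prop :=
  ∀ j i, φ (Finsupp.single j 1) i ≠ 0 → F.h j = G.h i

theorem degreePart_preservesH (F G : Cx R) (ψ : (F.X →₀ R) →ₗ[R] (G.X →₀ R)) :
    PreservesH F G (degreePart F G ψ) := by
  intro j i h
  rw [degreePart_single, G.proj_apply] at h
  by_contra hne
  exact h (if_neg (Ne.symm hne))

theorem HasLift.exists_preservesH {F G : Cx R} {A B c : Ideal R} (hF : F.IsRes A)
    (hG : G.IsRes B) (h : HasLift F G c) : ∃ φ, IsLift F G c φ ∧ PreservesH F G φ := by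
  obtain ⟨φ, hφ⟩ := h
  exact ⟨_, IsLift.degreePart hF hG hφ.comm_D (fun j _ => hφ.comm_aug _) hφ.mem,
    degreePart_preservesH _ _ _⟩

variable (R) in
/-- Splitting vectors indexed by a threefold disjoint union into blocks. -/
def blocks (X Y Z : Type u) :
    (X ⊕ (Y ⊕ Z) →₀ R) ≃ₗ[R] (X →₀ R) × (Y →₀ R) × (Z →₀ R) :=
  Finsupp.sumFinsuppLEquivProdFinsupp R ≪≫ₗ
    (LinearEquiv.refl R (X →₀ R)).prodCongr (Finsupp.sumFinsuppLEquivProdFinsupp R)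

section Blocks

variable {X Y Z : Type u}

@[simp] theorem blocks_fst_apply (x : X ⊕ (Y ⊕ Z) →₀ R) (i : X) :
    (blocks R X Y Z x).1 i = x (Sum.inl i) := rfl

@[simp] theorem blocks_snd_fst_apply (x : X ⊕ (Y ⊕ Z) →₀ R) (i : Y) :
    (blocks R X Y Z x).2.1 i = x (Sum.inr (Sum.inl i)) := rfl

@[simp] theorem blocks_snd_snd_apply (x : X ⊕ (Y ⊕ Z) →₀ R) (i : Z) :
    (blocks R X Y Z x).2.2 i = x (Sum.inr (Sum.inr i)) := rfl

@[simp] theorem blocks_symm_inl (v : (X →₀ R) × (Y →₀ R) × (Z →₀ R)) (i : X) :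
    (blocks R X Y Z).symm v (Sum.inl i) = v.1 i := by
  rw [← blocks_fst_apply, LinearEquiv.apply_symm_apply]

@[simp] theorem blocks_symm_inr_inl (v : (X →₀ R) × (Y →₀ R) × (Z →₀ R)) (i : Y) :
    (blocks R X Y Z).symm v (Sum.inr (Sum.inl i)) = v.2.1 i := by
  rw [← blocks_snd_fst_apply, LinearEquiv.apply_symm_apply]

@[simp] theorem blocks_symm_inr_inr (v : (X →₀ R) × (Y →₀ R) × (Z →₀ R)) (i : Z) :
    (blocks R X Y Z).symm v (Sum.inr (Sum.inr i)) = v.2.2 i := by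
  rw [← blocks_snd_snd_apply, LinearEquiv.apply_symm_apply]

@[simp] theorem blocks_single_inl (j : X) (a : R) :
    blocks R X Y Z (Finsupp.single (Sum.inl j) a) = (Finsupp.single j a, 0, 0) := by
  classical
  refine Prod.ext ?_ (Prod.ext ?_ ?_) <;> ext i <;> simp [Finsupp.single_apply]

@[simp] theorem blocks_single_inr_inl (j : Y) (a : R) :
    blocks R X Y Z (Finsupp.single (Sum.inr (Sum.inl j)) a) = (0, Finsupp.single j a, 0) := by
  classical
  refine Prod.ext ?_ (Prod.ext ?_ ?_) <;> ext i <;> simp [Finsupp.single_apply]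

@[simp] theorem blocks_single_inr_inr (j : Z) (a : R) :
    blocks R X Y Z (Finsupp.single (Sum.inr (Sum.inr j)) a) = (0, 0, Finsupp.single j a) := by
  classical
  refine Prod.ext ?_ (Prod.ext ?_ ?_) <;> ext i <;> simp [Finsupp.single_apply]

end Blocks

/-- The differential of a mapping cone, in block form. -/
def coneD (A B K : Cx R) (φ : (K.X →₀ R) →ₗ[R] (A.X →₀ R)) (ψ : (K.X →₀ R) →ₗ[R] (B.X →₀ R)) :
    (A.X →₀ R) × (B.X →₀ R) × (K.X →₀ R) →ₗ[R] (A.X →₀ R) × (B.X →₀ R) × (K.X →₀ R) where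
  toFun v := (A.D v.1 + φ v.2.2, B.D v.2.1 - ψ v.2.2, -K.D v.2.2)
  map_add' v w := by
    simp only [Prod.fst_add, Prod.snd_add, map_add, Prod.mk_add_mk]
    refine Prod.ext ?_ (Prod.ext ?_ ?_) <;> simp only <;> abel
  map_smul' r v := by
    simp [smul_sub]

/-- The mapping cone of `(φ, -ψ) : K → A ⊕ B`. -/
abbrev cone (A B K : Cx R) (φ : (K.X →₀ R) →ₗ[R] (A.X →₀ R)) (ψ : (K.X →₀ R) →ₗ[R] (B.X →₀ R)) :
    Cx R where
  X := A.X ⊕ (B.X ⊕ K.X)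
  h := Sum.elim A.h (Sum.elim B.h fun j => K.h j + 1)
  deg := Sum.elim A.deg (Sum.elim B.deg K.deg)
  D := (blocks R A.X B.X K.X).symm.toLinearMap ∘ₗ coneD A B K φ ψ ∘ₗ
    (blocks R A.X B.X K.X).toLinearMap
  aug := (A.aug.coprod (B.aug.coprod 0)) ∘ₗ (blocks R A.X B.X K.X).toLinearMap

variable {A B K : Cx R} {φ : (K.X →₀ R) →ₗ[R] (A.X →₀ R)} {ψ : (K.X →₀ R) →ₗ[R] (B.X →₀ R)}

theorem cone_D (v : (A.X →₀ R) × (B.X →₀ R) × (K.X →₀ R)) :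
    (cone A B K φ ψ).D ((blocks R A.X B.X K.X).symm v) = (blocks R A.X B.X K.X).symm
      (A.D v.1 + φ v.2.2, B.D v.2.1 - ψ v.2.2, -K.D v.2.2) := by
  simp [cone, coneD]

theorem cone_aug (v : (A.X →₀ R) × (B.X →₀ R) × (K.X →₀ R)) :
    (cone A B K φ ψ).aug ((blocks R A.X B.X K.X).symm v) = A.aug v.1 + B.aug v.2.1 := by
  simp [cone]

/-- This is the Mayer–Vietoris sequence `0 → a ⊓ b → a ⊕ b → a + b → 0` on the level of resolutions.
-/
theorem cone_isRes {a b : Ideal R} (hA : A.IsRes a) (hB : B.IsRes b) (hK : K.IsRes (a ⊓ b))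
    {c c' : Ideal R} (hφ : IsLift K A c φ) (hψ : IsLift K B c' ψ) (hφh : PreservesH K A φ)
    (hψh : PreservesH K B ψ) : (cone A B K φ ψ).IsRes (a + b) where
  D_h := by
    rintro (j | j | j) (i | i | i) <;> intro h <;>
      simp only [cone, coneD, LinearMap.comp_apply, LinearEquiv.coe_coe, blocks_single_inl,
        blocks_single_inr_inl, blocks_single_inr_inr, LinearMap.coe_mk, AddHom.coe_mk,
        blocks_symm_inl, blocks_symm_inr_inl, blocks_symm_inr_inr, map_zero, add_zero, zero_add,
        sub_zero, zero_sub, neg_zero, Finsupp.neg_apply, ne_eq, neg_eq_zero] at h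
    · exact hA.D_h j i h
    · exact absurd rfl h
    · exact absurd rfl h
    · exact absurd rfl h
    · exact hB.D_h j i h
    · exact absurd rfl h
    · exact congrArg (· + 1) (hφh j i h)
    · exact congrArg (· + 1) (hψh j i h)
    · exact congrArg (· + 1) (hK.D_h j i h)
  aug_h := by
    rintro (j | j | j) h
    · simpa [cone] using hA.aug_h j h
    · simpa [cone] using hB.aug_h j h
    · simp [cone]
  D_D x := by
    obtain ⟨v, rfl⟩ := (blocks R A.X B.X K.X).symm.surjective x
    rw [cone_D, cone_D, map_eq_zero_iff _ (LinearEquiv.injective _)]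
    refine Prod.ext ?_ (Prod.ext ?_ ?_) <;>
      simp [hA.D_D, hB.D_D, hK.D_D, hφ.comm_D, hψ.comm_D]
  aug_D x := by
    obtain ⟨v, rfl⟩ := (blocks R A.X B.X K.X).symm.surjective x
    rw [cone_D, cone_aug]
    simp [hA.aug_D, hB.aug_D, hφ.comm_aug, hψ.comm_aug]
  exact x hx hx' := by
    obtain ⟨⟨p, q, r⟩, rfl⟩ := (blocks R A.X B.X K.X).symm.surjective x
    rw [cone_D, map_eq_zero_iff _ (LinearEquiv.injective _)] at hx
    rw [cone_aug] at hx'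
    obtain ⟨h1, h2, h3⟩ : A.D p + φ r = 0 ∧ B.D q - ψ r = 0 ∧ -K.D r = 0 := by
      simpa [Prod.ext_iff] using hx
    rw [neg_eq_zero] at h3
    have hr : K.aug r = 0 := by
      rw [← hφ.comm_aug, eq_neg_of_add_eq_zero_right h1, map_neg, hA.aug_D, neg_zero]
    obtain ⟨r₀, rfl⟩ := hK.exact r h3 hr
    have hpq : A.aug p = -B.aug q := eq_neg_of_add_eq_zero_left hx'
    have hpmem : A.aug p + K.aug r₀ ∈ a ⊓ b := by
      refine add_mem ⟨hA.aug_mem p, ?_⟩ (hK.aug_mem r₀)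
      rw [hpq]; exact b.neg_mem (hB.aug_mem q)
    -- The preimage `r₀` of `r` is only determined up to cycles. Correcting it by the cycle `s`,
    -- whose augmentation is `A.aug p + K.aug r₀`, makes the augmentations of both remaining
    -- components vanish, so that exactness of `A` and `B` applies.
    obtain ⟨s, hs, hs'⟩ := hK.exists_cycle hpmem
    obtain ⟨p', hp'⟩ := hA.exact (p + φ r₀ - φ s)
      (by rw [map_sub, map_add, hφ.comm_D, hφ.comm_D, hs, map_zero, sub_zero, h1])
      (by rw [map_sub, map_add, hφ.comm_aug, hφ.comm_aug, hs', sub_self])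
    obtain ⟨q', hq'⟩ := hB.exact (q - ψ r₀ + ψ s)
      (by rw [map_add, map_sub, hψ.comm_D, hψ.comm_D, hs, map_zero, add_zero, h2])
      (by rw [map_add, map_sub, hψ.comm_aug, hψ.comm_aug, hs', hpq]; ring)
    refine ⟨(blocks R A.X B.X K.X).symm (p', q', s - r₀), ?_⟩
    rw [cone_D]
    refine congrArg _ (Prod.ext ?_ (Prod.ext ?_ ?_))
    · simp only [hp', map_sub]; abel
    · simp only [hq', map_sub]; abel
    · simp only [map_sub, hs]; abel
  range_aug := by
    ext x
    rw [Submodule.add_eq_sup, Submodule.mem_sup]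
    constructor
    · rintro ⟨y, rfl⟩
      obtain ⟨v, rfl⟩ := (blocks R A.X B.X K.X).symm.surjective y
      rw [cone_aug]
      exact ⟨_, hA.aug_mem _, _, hB.aug_mem _, rfl⟩
    · rintro ⟨y, hy, z, hz, rfl⟩
      obtain ⟨p, -, rfl⟩ := hA.exists_cycle hy
      obtain ⟨q, -, rfl⟩ := hB.exists_cycle hz
      exact ⟨(blocks R A.X B.X K.X).symm (p, q, 0), by rw [cone_aug]⟩

/-- The inclusion of the second summand in a cone. -/
def coneInr (A B K : Cx R) (φ : (K.X →₀ R) →ₗ[R] (A.X →₀ R))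
    (ψ : (K.X →₀ R) →ₗ[R] (B.X →₀ R)) : (B.X →₀ R) →ₗ[R] ((cone A B K φ ψ).X →₀ R) :=
  (blocks R A.X B.X K.X).symm.toLinearMap ∘ₗ LinearMap.inr R _ _ ∘ₗ LinearMap.inl R _ _

theorem coneInr_apply (x : B.X →₀ R) :
    coneInr A B K φ ψ x = (blocks R A.X B.X K.X).symm (0, x, 0) := rfl

theorem coneInr_isLift : IsLift B (cone A B K φ ψ) ⊤ (coneInr A B K φ ψ) where
  comm_D x := by rw [coneInr_apply, coneInr_apply, cone_D]; simp
  comm_aug x := by rw [coneInr_apply, cone_aug]; simp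
  mem _ _ := trivial

theorem coneInr_preservesH : PreservesH B (cone A B K φ ψ) (coneInr A B K φ ψ) := by
  classical
  rintro j (i | i | i) h
  · rw [coneInr_apply, blocks_symm_inl] at h
    exact absurd rfl h
  · rw [coneInr_apply, blocks_symm_inr_inl, Finsupp.single_apply] at h
    by_cases hji : j = i
    · rw [hji]; rfl
    · exact absurd (if_neg hji) h
  · rw [coneInr_apply, blocks_symm_inr_inr] at h
    exact absurd rfl h

/-- A block diagonal map of cones. -/
def coneMap {A' B' K' : Cx R} (φ : (K.X →₀ R) →ₗ[R] (A.X →₀ R))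
    (ψ : (K.X →₀ R) →ₗ[R] (B.X →₀ R)) (φ' : (K'.X →₀ R) →ₗ[R] (A'.X →₀ R))
    (ψ' : (K'.X →₀ R) →ₗ[R] (B'.X →₀ R)) (α : (A.X →₀ R) →ₗ[R] (A'.X →₀ R))
    (β : (B.X →₀ R) →ₗ[R] (B'.X →₀ R)) (γ : (K.X →₀ R) →ₗ[R] (K'.X →₀ R)) :
    ((cone A B K φ ψ).X →₀ R) →ₗ[R] ((cone A' B' K' φ' ψ').X →₀ R) :=
  (blocks R A'.X B'.X K'.X).symm.toLinearMap ∘ₗ (α.prodMap (β.prodMap γ)) ∘ₗ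
    (blocks R A.X B.X K.X).toLinearMap

theorem coneMap_apply {A' B' K' : Cx R} {φ' : (K'.X →₀ R) →ₗ[R] (A'.X →₀ R)}
    {ψ' : (K'.X →₀ R) →ₗ[R] (B'.X →₀ R)} (α : (A.X →₀ R) →ₗ[R] (A'.X →₀ R))
    (β : (B.X →₀ R) →ₗ[R] (B'.X →₀ R)) (γ : (K.X →₀ R) →ₗ[R] (K'.X →₀ R))
    (v : (A.X →₀ R) × (B.X →₀ R) × (K.X →₀ R)) :
    coneMap φ ψ φ' ψ' α β γ ((blocks R A.X B.X K.X).symm v) =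
      (blocks R A'.X B'.X K'.X).symm (α v.1, β v.2.1, γ v.2.2) := by
  simp [coneMap]

/-- The squares `h1` and `h2` commute on the nose, not merely up to homotopy, so no off-diagonal
blocks are needed. -/
theorem coneMap_isLift {A' B' K' : Cx R} {φ' : (K'.X →₀ R) →ₗ[R] (A'.X →₀ R)}
    {ψ' : (K'.X →₀ R) →ₗ[R] (B'.X →₀ R)} {α : (A.X →₀ R) →ₗ[R] (A'.X →₀ R)}
    {β : (B.X →₀ R) →ₗ[R] (B'.X →₀ R)} {γ : (K.X →₀ R) →ₗ[R] (K'.X →₀ R)} {c : Ideal R}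
    (hα : IsLift A A' c α) (hβ : IsLift B B' c β) (hγ : IsLift K K' c γ)
    (h1 : ∀ x, α (φ x) = φ' (γ x)) (h2 : ∀ x, β (ψ x) = ψ' (γ x)) :
    IsLift (cone A B K φ ψ) (cone A' B' K' φ' ψ') c (coneMap φ ψ φ' ψ' α β γ) where
  comm_D x := by
    obtain ⟨v, rfl⟩ := (blocks R A.X B.X K.X).symm.surjective x
    rw [coneMap_apply, cone_D, cone_D, coneMap_apply]
    simp [hα.comm_D, hβ.comm_D, hγ.comm_D, h1, h2]
  comm_aug x := by
    obtain ⟨v, rfl⟩ := (blocks R A.X B.X K.X).symm.surjective x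
    rw [coneMap_apply, cone_aug, cone_aug, hα.comm_aug, hβ.comm_aug]
  mem x := by
    obtain ⟨v, rfl⟩ := (blocks R A.X B.X K.X).symm.surjective x
    rw [coneMap_apply]
    rintro (i | i | i)
    · rw [blocks_symm_inl]; exact hα.mem _ _
    · rw [blocks_symm_inr_inl]; exact hβ.mem _ _
    · rw [blocks_symm_inr_inr]; exact hγ.mem _ _

/-- The map out of a cone given by maps out of the two summands of its target. -/
def coneDesc {G : Cx R} (φ : (K.X →₀ R) →ₗ[R] (A.X →₀ R))
    (ψ : (K.X →₀ R) →ₗ[R] (B.X →₀ R)) (α : (A.X →₀ R) →ₗ[R] (G.X →₀ R))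
    (β : (B.X →₀ R) →ₗ[R] (G.X →₀ R)) : ((cone A B K φ ψ).X →₀ R) →ₗ[R] (G.X →₀ R) :=
  (α.coprod (β.coprod 0)) ∘ₗ (blocks R A.X B.X K.X).toLinearMap

theorem coneDesc_apply {G : Cx R} (α : (A.X →₀ R) →ₗ[R] (G.X →₀ R))
    (β : (B.X →₀ R) →ₗ[R] (G.X →₀ R)) (v : (A.X →₀ R) × (B.X →₀ R) × (K.X →₀ R)) :
    coneDesc φ ψ α β ((blocks R A.X B.X K.X).symm v) = α v.1 + β v.2.1 := by
  simp [coneDesc]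

theorem coneDesc_coneInr {G : Cx R} (α : (A.X →₀ R) →ₗ[R] (G.X →₀ R))
    (β : (B.X →₀ R) →ₗ[R] (G.X →₀ R)) (x : B.X →₀ R) :
    coneDesc φ ψ α β (coneInr A B K φ ψ x) = β x := by
  rw [coneInr_apply, coneDesc_apply, map_zero, zero_add]

/-- Since `α ∘ φ = β ∘ ψ` strictly, the block on `K` can be taken to be zero. -/
theorem coneDesc_isLift {G : Cx R} {α : (A.X →₀ R) →ₗ[R] (G.X →₀ R)}
    {β : (B.X →₀ R) →ₗ[R] (G.X →₀ R)} {c : Ideal R} (hα : IsLift A G c α) (hβ : IsLift B G c β)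
    (h : ∀ x, α (φ x) = β (ψ x)) : IsLift (cone A B K φ ψ) G c (coneDesc φ ψ α β) where
  comm_D x := by
    obtain ⟨v, rfl⟩ := (blocks R A.X B.X K.X).symm.surjective x
    rw [coneDesc_apply, cone_D, coneDesc_apply]
    simp [hα.comm_D, hβ.comm_D, h]
  comm_aug x := by
    obtain ⟨v, rfl⟩ := (blocks R A.X B.X K.X).symm.surjective x
    rw [coneDesc_apply, cone_aug, map_add, hα.comm_aug, hβ.comm_aug]
  mem x i := by
    obtain ⟨v, rfl⟩ := (blocks R A.X B.X K.X).symm.surjective x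
    rw [coneDesc_apply]
    exact c.add_mem (hα.mem _ _) (hβ.mem _ _)

end Cone

/-! ### Small attaching maps give Betti splittings. -/

section BettiSplitting

variable {R : Type u} [CommRing R] {m : Ideal R} {A B K : Cx R}
  {φ : (K.X →₀ R) →ₗ[R] (A.X →₀ R)} {ψ : (K.X →₀ R) →ₗ[R] (B.X →₀ R)}

theorem blocks_symm_mem_iff {X Y Z : Type u} (v : (X →₀ R) × (Y →₀ R) × (Z →₀ R)) :
    (∀ i, (blocks R X Y Z).symm v i ∈ m) ↔
      (∀ i, v.1 i ∈ m) ∧ (∀ i, v.2.1 i ∈ m) ∧ ∀ i, v.2.2 i ∈ m := by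
  constructor
  · intro h
    refine ⟨fun i => ?_, fun i => ?_, fun i => ?_⟩
    · simpa using h (Sum.inl i)
    · simpa using h (Sum.inr (Sum.inl i))
    · simpa using h (Sum.inr (Sum.inr i))
  · rintro ⟨h1, h2, h3⟩ (i | i | i)
    · simpa using h1 i
    · simpa using h2 i
    · simpa using h3 i

theorem Cx.proj_eq_self_iff (F : Cx R) (n : ℕ) (x : F.X →₀ R) :
    F.proj n x = x ↔ ∀ i, x i ≠ 0 → F.h i = n := by
  rw [Finsupp.ext_iff]
  refine forall_congr' fun i => ?_
  rw [F.proj_apply]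
  by_cases h : F.h i = n
  · simp [h]
  · simp [h, eq_comm]

/-- The attaching maps vanish modulo `m`, so modulo `m` the cone is the direct sum of `A`, `B` and
`K` shifted by one. The next lemma is the counterpart for boundaries. -/
theorem cone_mem_Z_iff (hφ : ∀ x i, φ x i ∈ m) (hψ : ∀ x i, ψ x i ∈ m) (n : ℕ)
    (v : (A.X →₀ R) × (B.X →₀ R) × (K.X →₀ R)) :
    (blocks R A.X B.X K.X).symm v ∈ (cone A B K φ ψ).Z m n ↔
      v.1 ∈ A.Z m n ∧ v.2.1 ∈ B.Z m n ∧
        ((∀ i, v.2.2 i ≠ 0 → K.h i + 1 = n) ∧ ∀ i, K.D v.2.2 i ∈ m) := by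
  have h1 : (cone A B K φ ψ).proj n ((blocks R A.X B.X K.X).symm v) =
      (blocks R A.X B.X K.X).symm v ↔ A.proj n v.1 = v.1 ∧ B.proj n v.2.1 = v.2.1 ∧
        ∀ i, v.2.2 i ≠ 0 → K.h i + 1 = n := by
    refine (Cx.proj_eq_self_iff _ n _).trans ?_
    rw [Cx.proj_eq_self_iff, Cx.proj_eq_self_iff]
    constructor
    · intro h
      refine ⟨fun i hi => ?_, fun i hi => ?_, fun i hi => ?_⟩
      · exact h (Sum.inl i) (by rwa [blocks_symm_inl])
      · exact h (Sum.inr (Sum.inl i)) (by rwa [blocks_symm_inr_inl])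
      · exact h (Sum.inr (Sum.inr i)) (by rwa [blocks_symm_inr_inr])
    · rintro ⟨h1, h2, h3⟩ (i | i | i) hi
      · rw [blocks_symm_inl] at hi; exact h1 i hi
      · rw [blocks_symm_inr_inl] at hi; exact h2 i hi
      · rw [blocks_symm_inr_inr] at hi; exact h3 i hi
  have h2 : (∀ i, (cone A B K φ ψ).D ((blocks R A.X B.X K.X).symm v) i ∈ m) ↔
      (∀ i, A.D v.1 i ∈ m) ∧ (∀ i, B.D v.2.1 i ∈ m) ∧ ∀ i, K.D v.2.2 i ∈ m := by
    rw [cone_D, blocks_symm_mem_iff]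
    refine and_congr (forall_congr' fun i => ?_) (and_congr (forall_congr' fun i => ?_)
      (forall_congr' fun i => ?_))
    · rw [Finsupp.add_apply]; exact m.add_mem_iff_left (hφ _ _)
    · rw [Finsupp.sub_apply]; exact Submodule.sub_mem_iff_left m (hψ _ _)
    · rw [Finsupp.neg_apply]; exact m.neg_mem_iff
  change _ ∧ _ ↔ (_ ∧ _) ∧ (_ ∧ _) ∧ _ ∧ _
  rw [h1, h2]
  tauto

theorem cone_boundary_iff (hφ : ∀ x i, φ x i ∈ m) (hψ : ∀ x i, ψ x i ∈ m)
    (v : (A.X →₀ R) × (B.X →₀ R) × (K.X →₀ R)) :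
    (∃ y, ∀ i, ((blocks R A.X B.X K.X).symm v - (cone A B K φ ψ).D y) i ∈ m) ↔
      (∃ y, ∀ i, (v.1 - A.D y) i ∈ m) ∧ (∃ y, ∀ i, (v.2.1 - B.D y) i ∈ m) ∧
        ∃ y, ∀ i, (v.2.2 - K.D y) i ∈ m := by
  have key : ∀ w : (A.X →₀ R) × (B.X →₀ R) × (K.X →₀ R),
      (∀ i, ((blocks R A.X B.X K.X).symm v -
        (cone A B K φ ψ).D ((blocks R A.X B.X K.X).symm w)) i ∈ m) ↔
      (∀ i, (v.1 - A.D w.1) i ∈ m) ∧ (∀ i, (v.2.1 - B.D w.2.1) i ∈ m) ∧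
        ∀ i, (v.2.2 - K.D (-w.2.2)) i ∈ m := by
    intro w
    rw [cone_D, ← map_sub, blocks_symm_mem_iff]
    refine and_congr (forall_congr' fun i => ?_) (and_congr (forall_congr' fun i => ?_)
      (forall_congr' fun i => ?_))
    · change (v.1 - (A.D w.1 + φ w.2.2)) i ∈ m ↔ _
      rw [← sub_sub, Finsupp.sub_apply _ (φ _)]; exact Submodule.sub_mem_iff_left m (hφ _ _)
    · change (v.2.1 - (B.D w.2.1 - ψ w.2.2)) i ∈ m ↔ _
      rw [← sub_add, Finsupp.add_apply]; exact m.add_mem_iff_left (hψ _ _)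
    · rw [map_neg]; rfl
  constructor
  · rintro ⟨y, hy⟩
    obtain ⟨w, rfl⟩ := (blocks R A.X B.X K.X).symm.surjective y
    obtain ⟨h1, h2, h3⟩ := (key w).1 hy
    exact ⟨⟨_, h1⟩, ⟨_, h2⟩, ⟨_, h3⟩⟩
  · rintro ⟨⟨y, h1⟩, ⟨z, h2⟩, ⟨t, h3⟩⟩
    exact ⟨_, (key (y, z, -t)).2 ⟨h1, h2, by simpa using h3⟩⟩

variable {k : Type u} [Field k] [Algebra k R] (𝒜 : ℕ → Submodule k R)

/-- The cone over small lifts is a resolution of `a + b` that splits after reduction, so its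
homology is the direct sum of the three homologies. Dimensions then add as cardinals, without
minimality or finiteness. -/
theorem isBettiSplitting_of_hasLift {a b p : Ideal R} (hp : p = a + b) (hA : A.IsRes a)
    (hB : B.IsRes b) (hK : K.IsRes (a ⊓ b)) (hKA : HasLift K A (gradedMax 𝒜))
    (hKB : HasLift K B (gradedMax 𝒜)) : IsBettiSplitting 𝒜 p a b := by
  subst hp
  refine ⟨rfl, fun n => ?_⟩
  obtain ⟨φ, hφ, hφh⟩ := hKA.exists_preservesH hK hA
  obtain ⟨ψ, hψ, hψh⟩ := hKB.exists_preservesH hK hB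
  have hC := cone_isRes hA hB hK hφ hψ hφh hψh
  set m := gradedMax 𝒜
  have hZ : ∀ x : (cone A B K φ ψ).Z m n, _ := fun x =>
    (cone_mem_Z_iff hφ.mem hψ.mem n (blocks R A.X B.X K.X x.1)).1
      (by rw [LinearEquiv.symm_apply_apply]; exact x.2)
  have hbd : ∀ x : (cone A B K φ ψ).Z m n, _ := fun x =>
    cone_boundary_iff hφ.mem hψ.mem (blocks R A.X B.X K.X x.1)
  simp only [LinearEquiv.symm_apply_apply] at hbd
  let E := (blocks R A.X B.X K.X).toLinearMap ∘ₗ ((cone A B K φ ψ).Z m n).subtype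
  let pA : (cone A B K φ ψ).Z m n →ₗ[R] A.Z m n :=
    (LinearMap.fst R _ _ ∘ₗ E).codRestrict _ fun x => (hZ x).1
  let pB : (cone A B K φ ψ).Z m n →ₗ[R] B.Z m n :=
    (LinearMap.fst R _ _ ∘ₗ LinearMap.snd R _ _ ∘ₗ E).codRestrict _ fun x => (hZ x).2.1
  cases n with
  | zero =>
    rw [if_pos rfl, add_zero, hA.betti_eq 𝒜, hB.betti_eq 𝒜, ← rankOver_prod]
    refine hC.betti_eq_of_surjective 𝒜 0
      ((hA.cls m 0 ∘ₗ pA).prod (hB.cls m 0 ∘ₗ pB)) ?_ ?_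
    · rintro ⟨y, z⟩
      obtain ⟨y, rfl⟩ := hA.cls_surjective m 0 y
      obtain ⟨z, rfl⟩ := hB.cls_surjective m 0 z
      refine ⟨⟨(blocks R A.X B.X K.X).symm (y.1, z.1, 0),
        (cone_mem_Z_iff hφ.mem hψ.mem 0 _).2 ⟨y.2, z.2, by simp⟩⟩, ?_⟩
      refine Prod.ext (congrArg (hA.cls m 0) (Subtype.ext ?_))
        (congrArg (hB.cls m 0) (Subtype.ext ?_))
      · change (blocks R A.X B.X K.X ((blocks R A.X B.X K.X).symm _)).1 = _
        rw [LinearEquiv.apply_symm_apply]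
      · change (blocks R A.X B.X K.X ((blocks R A.X B.X K.X).symm _)).2.1 = _
        rw [LinearEquiv.apply_symm_apply]
    · intro x
      rw [hbd]
      refine Prod.ext_iff.trans ?_
      refine (and_congr (hA.cls_eq_zero_iff m 0 _) (hB.cls_eq_zero_iff m 0 _)).trans ?_
      refine and_congr Iff.rfl ⟨fun h => ⟨h, 0, fun i => ?_⟩, fun h => h.1⟩
      -- The shifted copy of `K` has no basis elements in degree zero, which accounts for `β_{-1} =
      -- 0`.
      rw [map_zero, sub_zero]
      by_cases h0 : (blocks R A.X B.X K.X x.1).2.2 i = 0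
      · rw [h0]; exact m.zero_mem
      · exact absurd ((hZ x).2.2.1 i h0) (by omega)
  | succ n =>
    let pK : (cone A B K φ ψ).Z m (n + 1) →ₗ[R] K.Z m n :=
      (LinearMap.snd R _ _ ∘ₗ LinearMap.snd R _ _ ∘ₗ E).codRestrict _ fun x =>
        ⟨(K.proj_eq_self_iff n _).2 fun i hi => by
          have := (hZ x).2.2.1 i hi; omega, (hZ x).2.2.2⟩
    rw [if_neg (by omega), add_assoc, hA.betti_eq 𝒜, hB.betti_eq 𝒜, Nat.add_sub_cancel,
      hK.betti_eq 𝒜, ← rankOver_prod, ← rankOver_prod]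
    refine hC.betti_eq_of_surjective 𝒜 (n + 1) ((hA.cls m (n + 1) ∘ₗ pA).prod
      ((hB.cls m (n + 1) ∘ₗ pB).prod (hK.cls m n ∘ₗ pK))) ?_ ?_
    · rintro ⟨y, z, t⟩
      obtain ⟨y, rfl⟩ := hA.cls_surjective m (n + 1) y
      obtain ⟨z, rfl⟩ := hB.cls_surjective m (n + 1) z
      obtain ⟨t, rfl⟩ := hK.cls_surjective m n t
      refine ⟨⟨(blocks R A.X B.X K.X).symm (y.1, z.1, t.1),
        (cone_mem_Z_iff hφ.mem hψ.mem (n + 1) _).2 ⟨y.2, z.2, fun i hi => ?_, t.2.2⟩⟩, ?_⟩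
      · rw [(K.proj_eq_self_iff n _).1 t.2.1 i hi]
      refine Prod.ext (congrArg (hA.cls m (n + 1)) (Subtype.ext ?_)) (Prod.ext
        (congrArg (hB.cls m (n + 1)) (Subtype.ext ?_)) (congrArg (hK.cls m n) (Subtype.ext ?_)))
      · change (blocks R A.X B.X K.X ((blocks R A.X B.X K.X).symm _)).1 = _
        rw [LinearEquiv.apply_symm_apply]
      · change (blocks R A.X B.X K.X ((blocks R A.X B.X K.X).symm _)).2.1 = _
        rw [LinearEquiv.apply_symm_apply]
      · change (blocks R A.X B.X K.X ((blocks R A.X B.X K.X).symm _)).2.2 = _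
        rw [LinearEquiv.apply_symm_apply]
    · intro x
      rw [hbd]
      refine Prod.ext_iff.trans ?_
      exact and_congr (hA.cls_eq_zero_iff m _ _) (Prod.ext_iff.trans <| and_congr (hB.cls_eq_zero_iff m _ _)
        (hK.cls_eq_zero_iff m _ _))

end BettiSplitting

/-! ### Contractions over the ground field and the sign operator. -/

section Contraction

variable {k R : Type u} [Field k] [CommRing R] [Algebra k R]

/-- Projection to the basis elements whose homological degree has the given parity. -/
def Cx.parity (F : Cx R) (b : ℕ) : (F.X →₀ R) →ₗ[R] (F.X →₀ R) :=
  Finsupp.linearCombination R fun j => if F.h j % 2 = b then Finsupp.single j 1 else 0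

theorem Cx.parity_single (F : Cx R) (b : ℕ) (j : F.X) :
    F.parity b (Finsupp.single j 1) = if F.h j % 2 = b then Finsupp.single j 1 else 0 := by
  simp [Cx.parity]

theorem Cx.parity_parity (F : Cx R) (b c : ℕ) (x : F.X →₀ R) :
    F.parity b (F.parity c x) = if b = c then F.parity b x else 0 := by
  suffices h : F.parity b ∘ₗ F.parity c = if b = c then F.parity b else 0 by
    refine (LinearMap.congr_fun h x).trans ?_
    split_ifs <;> rfl
  refine linearMap_ext_single fun j => ?_
  rw [LinearMap.comp_apply, F.parity_single]
  split_ifs with h1 h2 h2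
  · rw [F.parity_single, h2]
  · rw [F.parity_single, if_neg (by omega)]; rfl
  · rw [map_zero, F.parity_single, if_neg (by omega)]
  · simp

theorem Cx.parity_add (F : Cx R) (x : F.X →₀ R) : F.parity 0 x + F.parity 1 x = x := by
  suffices h : F.parity 0 + F.parity 1 = LinearMap.id from LinearMap.congr_fun h x
  refine linearMap_ext_single fun j => ?_
  rw [LinearMap.add_apply, F.parity_single, F.parity_single]
  have : F.h j % 2 = 0 ∨ F.h j % 2 = 1 := by omega
  rcases this with h | h <;> simp [h]

theorem Cx.IsRes.D_parity {F : Cx R} {A : Ideal R} (hF : F.IsRes A) {b c : ℕ} (hbc : b + c = 1)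
    (x : F.X →₀ R) : F.D (F.parity b x) = F.parity c (F.D x) := by
  suffices h : F.D ∘ₗ F.parity b = F.parity c ∘ₗ F.D from LinearMap.congr_fun h x
  have happ : ∀ (x : F.X →₀ R) i, F.parity c x i = if F.h i % 2 = c then x i else 0 := by
    classical
    intro x i
    induction x using Finsupp.induction_linear with
    | zero => simp
    | add f g hf hg => simp only [map_add, Finsupp.add_apply, hf, hg]; split_ifs <;> simp
    | single j a =>
      rw [← mul_one a, ← smul_eq_mul, ← Finsupp.smul_single, map_smul, F.parity_single]
      by_cases hij : j = i
      · subst hij; split_ifs <;> simp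
      · split_ifs <;> simp [hij]
  refine linearMap_ext_single fun j => ?_
  ext i
  rw [LinearMap.comp_apply, LinearMap.comp_apply, F.parity_single, happ]
  by_cases h0 : F.D (Finsupp.single j 1) i = 0
  · split_ifs <;> simp [h0]
  · have := hF.D_h j i h0
    by_cases hj : F.h j % 2 = b
    · rw [if_pos hj, if_pos (by omega)]
    · rw [if_neg hj, if_neg (by omega)]; simp

theorem Cx.IsRes.aug_parity_one {F : Cx R} {A : Ideal R} (hF : F.IsRes A) (x : F.X →₀ R) :
    F.aug (F.parity 1 x) = 0 := by
  suffices h : F.aug ∘ₗ F.parity 1 = 0 from LinearMap.congr_fun h x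
  refine linearMap_ext_single fun j => ?_
  rw [LinearMap.comp_apply, F.parity_single]
  split_ifs with h
  · exact hF.aug_h j (by rintro h0; simp [h0] at h)
  · simp

/-- The sign `(-1)^h`. -/
def Cx.sign (F : Cx R) : (F.X →₀ R) →ₗ[R] (F.X →₀ R) := F.parity 0 - F.parity 1

theorem Cx.IsRes.sign_D {F : Cx R} {A : Ideal R} (hF : F.IsRes A) (x : F.X →₀ R) :
    F.D (F.sign x) = -F.sign (F.D x) := by
  simp only [Cx.sign, LinearMap.sub_apply, map_sub, hF.D_parity (b := 0) (c := 1) rfl,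
    hF.D_parity (b := 1) (c := 0) rfl, neg_sub]

theorem Cx.IsRes.aug_sign {F : Cx R} {A : Ideal R} (hF : F.IsRes A) (x : F.X →₀ R) :
    F.aug (F.sign x) = F.aug x := by
  conv_rhs => rw [← F.parity_add x]
  simp [Cx.sign, hF.aug_parity_one]

variable (k) in
/-- A free resolution has a contraction over the ground field, of odd degree. -/
theorem Cx.IsRes.exists_contraction {F : Cx R} {A : Ideal R} (hF : F.IsRes A) :
    ∃ (i : R →ₗ[k] (F.X →₀ R)) (h : (F.X →₀ R) →ₗ[k] (F.X →₀ R)),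
      (∀ x, F.D (h x) + h (F.D x) = x - i (F.aug x)) ∧ (∀ r, F.D (i r) = 0) ∧
      (∀ r, F.sign (i r) = i r) ∧ ∀ x, F.sign (h x) = -h (F.sign x) := by
  obtain ⟨i₀, hi₀⟩ := exists_generalized_inverse (F.aug.restrictScalars k)
  let i : R →ₗ[k] (F.X →₀ R) := (F.proj 0).restrictScalars k ∘ₗ i₀
  have hDi : ∀ r, F.D (i r) = 0 := fun r => hF.D_proj_zero _
  have haug : ∀ x, F.aug (i (F.aug x)) = F.aug x := fun x =>
    (hF.aug_proj_zero _).trans (hi₀ x)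
  have hpar : ∀ r, F.parity 0 (i r) = i r := by
    intro r
    suffices h : F.parity 0 ∘ₗ F.proj 0 = F.proj 0 from LinearMap.congr_fun h _
    refine linearMap_ext_single fun j => ?_
    rw [LinearMap.comp_apply, F.proj_single]
    split_ifs with hj
    · rw [F.parity_single, hj, if_pos rfl]
    · simp
  have hpar1 : ∀ r, F.parity 1 (i r) = 0 := fun r => by
    rw [← hpar r, F.parity_parity, if_neg (by omega)]
  -- For a cycle `x`, the element `x - i (F.aug x)` is a cycle with zero augmentation, hence a
  -- boundary by exactness.
  obtain ⟨h₀, hh₀⟩ := exists_nullhomotopy (F.D.restrictScalars k) (F.D.restrictScalars k)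
    (LinearMap.id - i ∘ₗ F.aug.restrictScalars k) hF.D_D
    (fun x => by simp [hDi, hF.aug_D])
    (fun x hx => by
      refine hF.exact _ ?_ ?_
      · have : F.D x = 0 := hx
        simp [this, hDi]
      · simp [haug])
  have hh : ∀ x, F.D (h₀ x) + h₀ (F.D x) = x - i (F.aug x) := hh₀
  let e : ℕ → (F.X →₀ R) →ₗ[k] (F.X →₀ R) := fun b => (F.parity b).restrictScalars k
  -- `h₀` ignores homological degrees. Its parity-switching part is still a contraction, because
  -- `F.D` switches parity and `i` has values in even degrees, and it anticommutes with `F.sign`.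
  refine ⟨i, e 0 ∘ₗ h₀ ∘ₗ e 1 + e 1 ∘ₗ h₀ ∘ₗ e 0, fun x => ?_, hDi, fun r => ?_, fun x => ?_⟩
  · have h1 := congrArg (F.parity 1) (hh (F.parity 1 x))
    have h2 := congrArg (F.parity 0) (hh (F.parity 0 x))
    rw [hF.aug_parity_one, map_zero, sub_zero, F.parity_parity, if_pos rfl, map_add,
      ← hF.D_parity (b := 0) (c := 1) rfl, hF.D_parity (b := 1) (c := 0) rfl] at h1
    have h3 : F.aug (F.parity 0 x) = F.aug x := by
      conv_rhs => rw [← F.parity_add x]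
      rw [map_add, hF.aug_parity_one, add_zero]
    rw [h3, map_sub, hpar, F.parity_parity, if_pos rfl, map_add,
      ← hF.D_parity (b := 1) (c := 0) rfl, hF.D_parity (b := 0) (c := 1) rfl] at h2
    change F.D (F.parity 0 (h₀ (F.parity 1 x)) + F.parity 1 (h₀ (F.parity 0 x))) +
      (F.parity 0 (h₀ (F.parity 1 (F.D x))) + F.parity 1 (h₀ (F.parity 0 (F.D x)))) = _
    have h4 := F.parity_add x
    rw [map_add]
    calc _ = (F.D (F.parity 0 (h₀ (F.parity 1 x))) + F.parity 1 (h₀ (F.parity 0 (F.D x)))) +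
        (F.D (F.parity 1 (h₀ (F.parity 0 x))) + F.parity 0 (h₀ (F.parity 1 (F.D x)))) := by abel
      _ = _ := by rw [h1, h2, ← add_sub_assoc, add_comm (F.parity 1 x), h4]
  · simp [Cx.sign, hpar, hpar1]
  · change F.sign (F.parity 0 (h₀ (F.parity 1 x)) + F.parity 1 (h₀ (F.parity 0 x))) =
      -(F.parity 0 (h₀ (F.parity 1 (F.sign x))) + F.parity 1 (h₀ (F.parity 0 (F.sign x))))
    simp [Cx.sign, F.parity_parity]
    abel

end Contraction

/-! ### The tensor product over `k` of two resolutions. -/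

section TensorResolution

variable {k R S : Type u} [Field k] [CommRing R] [Algebra k R] [CommRing S] [Algebra k S]

variable (k) in
/-- The external product of coordinate vectors. -/
def tp {X Y : Type u} : (X →₀ R) →ₗ[k] (Y →₀ S) →ₗ[k] (X × Y →₀ R ⊗[k] S) :=
  (TensorProduct.mk k (X →₀ R) (Y →₀ S)).compr₂ (finsuppTensorFinsupp k k R S X Y).toLinearMap

theorem tp_def {X Y : Type u} (a : X →₀ R) (b : Y →₀ S) :
    tp k a b = finsuppTensorFinsupp k k R S X Y (a ⊗ₜ b) := rfl

theorem tp_apply {X Y : Type u} (a : X →₀ R) (b : Y →₀ S) (p : X × Y) :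
    tp k a b p = a p.1 ⊗ₜ b p.2 :=
  finsuppTensorFinsupp_apply k k R S X Y a b p.1 p.2

theorem tp_single {X Y : Type u} (x : X) (y : Y) (r : R) (s : S) :
    tp k (Finsupp.single x r) (Finsupp.single y s) = Finsupp.single (x, y) (r ⊗ₜ[k] s) :=
  finsuppTensorFinsupp_single k k R S X Y x r y s

theorem tp_induction {X Y : Type u} {p : (X × Y →₀ R ⊗[k] S) → Prop} (h0 : p 0)
    (htp : ∀ a b, p (tp k a b)) (hadd : ∀ x y, p x → p y → p (x + y))
    (z : X × Y →₀ R ⊗[k] S) : p z := by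
  obtain ⟨w, rfl⟩ := (finsuppTensorFinsupp k k R S X Y).surjective z
  induction w with
  | zero => rwa [map_zero]
  | tmul a b => exact htp a b
  | add a b ha hb => rw [map_add]; exact hadd _ _ ha hb

/-- The linear map over `R ⊗ S` with prescribed bilinear values on external products. -/
def boxLift {X Y : Type u} {N : Type u} [AddCommGroup N] [Module (R ⊗[k] S) N]
    (f : X → Y → N) : (X × Y →₀ R ⊗[k] S) →ₗ[R ⊗[k] S] N :=
  Finsupp.linearCombination (R ⊗[k] S) fun p => f p.1 p.2

theorem boxLift_single {X Y : Type u} {N : Type u} [AddCommGroup N] [Module (R ⊗[k] S) N]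
    (f : X → Y → N) (x : X) (y : Y) (r : R) (s : S) :
    boxLift f (tp k (Finsupp.single x r) (Finsupp.single y s)) = (r ⊗ₜ[k] s) • f x y := by
  rw [tp_single, boxLift, Finsupp.linearCombination_single]

/-- The tensor product of two matrices. -/
def box {X Y X' Y' : Type u} (f : (X →₀ R) →ₗ[R] (X' →₀ R)) (g : (Y →₀ S) →ₗ[S] (Y' →₀ S)) :
    (X × Y →₀ R ⊗[k] S) →ₗ[R ⊗[k] S] (X' × Y' →₀ R ⊗[k] S) :=
  boxLift fun x y => tp k (f (Finsupp.single x 1)) (g (Finsupp.single y 1))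

/-- The tensor product of two augmentations. -/
def boxAug {X Y : Type u} (f : (X →₀ R) →ₗ[R] R) (g : (Y →₀ S) →ₗ[S] S) :
    (X × Y →₀ R ⊗[k] S) →ₗ[R ⊗[k] S] R ⊗[k] S :=
  boxLift fun x y => f (Finsupp.single x 1) ⊗ₜ[k] g (Finsupp.single y 1)

theorem smul_tp {X Y : Type u} (r : R) (s : S) (a : X →₀ R) (b : Y →₀ S) :
    (r ⊗ₜ[k] s) • tp k a b = tp k (r • a) (s • b) := by
  ext p
  simp [tp_apply]

@[simp] theorem box_tp {X Y X' Y' : Type u} (f : (X →₀ R) →ₗ[R] (X' →₀ R))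
    (g : (Y →₀ S) →ₗ[S] (Y' →₀ S)) (a : X →₀ R) (b : Y →₀ S) :
    box f g (tp k a b) = tp k (f a) (g b) := by
  induction a using Finsupp.induction_linear with
  | zero => simp
  | add a a' ha ha' => simp [ha, ha']
  | single x r =>
    induction b using Finsupp.induction_linear with
    | zero => simp
    | add b b' hb hb' => simp [hb, hb']
    | single y s =>
      rw [box, boxLift_single, smul_tp, ← map_smul, ← map_smul, Finsupp.smul_single,
        Finsupp.smul_single, smul_eq_mul, smul_eq_mul, mul_one, mul_one]

@[simp] theorem boxAug_tp {X Y : Type u} (f : (X →₀ R) →ₗ[R] R) (g : (Y →₀ S) →ₗ[S] S)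
    (a : X →₀ R) (b : Y →₀ S) : boxAug f g (tp k a b) = f a ⊗ₜ[k] g b := by
  induction a using Finsupp.induction_linear with
  | zero => simp
  | add a a' ha ha' => simp [ha, ha', TensorProduct.add_tmul]
  | single x r =>
    induction b using Finsupp.induction_linear with
    | zero => simp
    | add b b' hb hb' => simp [hb, hb', TensorProduct.tmul_add]
    | single y s =>
      rw [boxAug, boxLift_single, smul_eq_mul, Algebra.TensorProduct.tmul_mul_tmul,
        ← smul_eq_mul, ← smul_eq_mul, ← map_smul, ← map_smul, Finsupp.smul_single,
        Finsupp.smul_single, smul_eq_mul, smul_eq_mul, mul_one, mul_one]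

variable (k) in
/-- The tensor product over `k` of two resolutions. -/
abbrev tensorCx (F : Cx R) (G : Cx S) : Cx (R ⊗[k] S) where
  X := F.X × G.X
  h := fun p => F.h p.1 + G.h p.2
  deg := fun p => F.deg p.1 + G.deg p.2
  D := box F.D LinearMap.id + box F.sign G.D
  aug := boxAug F.aug G.aug

variable {F : Cx R} {G : Cx S}

theorem tensorCx_D_tp (a : F.X →₀ R) (b : G.X →₀ S) :
    (tensorCx k F G).D (tp k a b) = tp k (F.D a) b + tp k (F.sign a) (G.D b) := by
  simp

theorem tensorCx_D_apply_single (p q : F.X × G.X) :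
    (tensorCx k F G).D (Finsupp.single p 1) q =
      F.D (Finsupp.single p.1 1) q.1 ⊗ₜ[k] Finsupp.single p.2 (1 : S) q.2 +
        F.sign (Finsupp.single p.1 1) q.1 ⊗ₜ[k] G.D (Finsupp.single p.2 1) q.2 := by
  have : (Finsupp.single p 1 : F.X × G.X →₀ R ⊗[k] S) =
      tp k (Finsupp.single p.1 1) (Finsupp.single p.2 1) := by
    rw [tp_single]; rfl
  rw [this, tensorCx_D_tp, Finsupp.add_apply, tp_apply, tp_apply]

theorem Cx.sign_single_eq_zero (F : Cx R) {x y : F.X} (h : x ≠ y) :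
    F.sign (Finsupp.single x 1) y = 0 := by
  rw [Cx.sign, LinearMap.sub_apply, F.parity_single, F.parity_single]
  split_ifs <;> simp [h]

theorem range_boxAug {X Y : Type u} {A : Ideal R} {B : Ideal S} {f : (X →₀ R) →ₗ[R] R}
    {g : (Y →₀ S) →ₗ[S] S} (hf : LinearMap.range f = A) (hg : LinearMap.range g = B) :
    LinearMap.range (boxAug (k := k) f g) = extendLeft A * extendRight B := by
  apply le_antisymm
  · rintro _ ⟨z, rfl⟩
    induction z using tp_induction (k := k) with
    | h0 => rw [map_zero]; exact Ideal.zero_mem _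
    | htp a b =>
      rw [boxAug_tp, show f a ⊗ₜ[k] g b = (f a ⊗ₜ[k] (1 : S)) * ((1 : R) ⊗ₜ[k] g b) by simp]
      refine Ideal.mul_mem_mul (Ideal.mem_map_of_mem Algebra.TensorProduct.includeLeft ?_)
        (Ideal.mem_map_of_mem Algebra.TensorProduct.includeRight ?_)
      · rw [← hf]; exact ⟨a, rfl⟩
      · rw [← hg]; exact ⟨b, rfl⟩
    | hadd x y hx hy => rw [map_add]; exact Ideal.add_mem _ hx hy
  · rw [extendLeft, extendRight, Ideal.map, Ideal.map, Ideal.span_mul_span', Ideal.span_le]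
    rintro _ ⟨_, ⟨r, hr, rfl⟩, _, ⟨s, hs, rfl⟩, rfl⟩
    rw [← hf] at hr
    rw [← hg] at hs
    obtain ⟨a, rfl⟩ := hr
    obtain ⟨b, rfl⟩ := hs
    exact ⟨tp k a b, by simp⟩

/-- Exactness is an explicit Künneth argument. From contractions `h`, `h'` over `k`, the map `h ⊗ 1
+ (i ∘ aug) ⊗ h'` is a homotopy from the identity to `(i ⊗ i') ∘ aug`. It is only `k`-linear, which
suffices for exactness. The sign in the differential gives `D² = 0`, and the oddness of `h` cancels
the cross terms. -/
theorem tensorCx_isRes {A : Ideal R} {B : Ideal S} (hF : F.IsRes A) (hG : G.IsRes B) :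
    (tensorCx k F G).IsRes (extendLeft A * extendRight B) where
  D_h p q h := by
    classical
    rw [tensorCx_D_apply_single] at h
    change F.h p.1 + G.h p.2 = F.h q.1 + G.h q.2 + 1
    by_cases h1 : F.D (Finsupp.single p.1 1) q.1 ⊗ₜ[k] Finsupp.single p.2 (1 : S) q.2 = 0
    · rw [h1, zero_add] at h
      have h2 : G.D (Finsupp.single p.2 1) q.2 ≠ 0 := fun h0 => h (by
        rw [h0, TensorProduct.tmul_zero])
      have h3 : p.1 = q.1 := by
        by_contra hne
        exact h (by rw [F.sign_single_eq_zero hne, TensorProduct.zero_tmul])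
      rw [h3, hG.D_h _ _ h2, add_assoc]
    · have h2 : F.D (Finsupp.single p.1 1) q.1 ≠ 0 := fun h0 => h1 (by
        rw [h0, TensorProduct.zero_tmul])
      have h3 : p.2 = q.2 := by
        by_contra hne
        exact h1 (by rw [Finsupp.single_eq_of_ne' hne, TensorProduct.tmul_zero])
      rw [h3, hF.D_h _ _ h2]; ring
  aug_h p h := by
    have h' : F.h p.1 + G.h p.2 ≠ 0 := h
    rw [show (Finsupp.single p 1 : F.X × G.X →₀ R ⊗[k] S) =
      tp k (Finsupp.single p.1 1) (Finsupp.single p.2 1) by rw [tp_single]; rfl]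
    rw [boxAug_tp]
    by_cases h1 : F.h p.1 = 0
    · rw [hG.aug_h p.2 (by omega), TensorProduct.tmul_zero]
    · rw [hF.aug_h p.1 h1, TensorProduct.zero_tmul]
  D_D z := by
    induction z using tp_induction (k := k) with
    | h0 => simp
    | htp a b =>
      rw [tensorCx_D_tp, map_add, tensorCx_D_tp, tensorCx_D_tp, hF.D_D, hG.D_D, hF.sign_D]
      simp
    | hadd x y hx hy => rw [map_add, map_add, hx, hy, add_zero]
  aug_D z := by
    induction z using tp_induction (k := k) with
    | h0 => simp
    | htp a b =>
      rw [tensorCx_D_tp, map_add, boxAug_tp, boxAug_tp, hF.aug_D, hG.aug_D]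
      simp
    | hadd x y hx hy => rw [map_add, map_add, hx, hy, add_zero]
  exact z hz hz' := by
    obtain ⟨i, h, hh, hDi, hsi, hsh⟩ := hF.exists_contraction k
    obtain ⟨i', h', hh', -, -, -⟩ := hG.exists_contraction k
    let E := finsuppTensorFinsupp k k R S F.X G.X
    let H : (F.X × G.X →₀ R ⊗[k] S) →ₗ[k] (F.X × G.X →₀ R ⊗[k] S) := E.toLinearMap ∘ₗ
      (TensorProduct.map h LinearMap.id +
        TensorProduct.map (i ∘ₗ F.aug.restrictScalars k) h') ∘ₗ E.symm.toLinearMap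
    have hH : ∀ a b, H (tp k a b) = tp k (h a) b + tp k (i (F.aug a)) (h' b) := by
      intro a b
      simp [H, E, tp_def]
    let Q : (R ⊗[k] S) →ₗ[k] (F.X × G.X →₀ R ⊗[k] S) := E.toLinearMap ∘ₗ TensorProduct.map i i'
    have hQ : ∀ r s, Q (r ⊗ₜ s) = tp k (i r) (i' s) := fun r s => by simp [Q, E, tp_def]
    have key : ∀ w, (tensorCx k F G).D (H w) + H ((tensorCx k F G).D w) =
        w - Q ((tensorCx k F G).aug w) := by
      intro w
      induction w using tp_induction (k := k) with
      | h0 => simp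
      | htp a b =>
        rw [tensorCx_D_tp, map_add, hH, hH, hH, boxAug_tp, hQ, map_add, tensorCx_D_tp,
          tensorCx_D_tp, hDi, hF.aug_D, hsi, hsh, hF.aug_sign]
        have e1 : tp k (F.D (h a)) b + tp k (h (F.D a)) b = tp k a b - tp k (i (F.aug a)) b := by
          rw [← LinearMap.add_apply, ← map_add, hh, map_sub, LinearMap.sub_apply]
        have e2 : tp k (i (F.aug a)) (G.D (h' b)) + tp k (i (F.aug a)) (h' (G.D b)) =
            tp k (i (F.aug a)) b - tp k (i (F.aug a)) (i' (G.aug b)) := by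
          rw [← map_add, hh', map_sub]
        have e3 := congrArg₂ (· + ·) e1 e2
        simp only [map_neg, map_zero, LinearMap.neg_apply, LinearMap.zero_apply, zero_add,
          add_zero] at e3 ⊢
        rw [sub_add_sub_cancel] at e3
        rw [← e3]
        abel
      | hadd x y hx hy =>
        simp only [map_add]
        rw [add_add_add_comm, hx, hy]
        abel
    refine ⟨H z, ?_⟩
    have := key z
    rwa [hz, hz', map_zero, map_zero, add_zero, sub_zero] at this
  range_aug := range_boxAug hF.range_aug hG.range_aug

end TensorResolution

/-! ### Sums, products and intersections of extended ideals. -/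

section Ideals

variable {k R S : Type u} [Field k] [CommRing R] [Algebra k R] [CommRing S] [Algebra k S]

theorem tmul_mem_extend {A : Ideal R} {B : Ideal S} {r : R} {s : S} (hr : r ∈ A) (hs : s ∈ B) :
    r ⊗ₜ[k] s ∈ extendLeft (k := k) (S := S) A * extendRight (k := k) (R := R) B := by
  rw [show r ⊗ₜ[k] s = (r ⊗ₜ[k] (1 : S)) * ((1 : R) ⊗ₜ[k] s) by simp]
  exact Ideal.mul_mem_mul (Ideal.mem_map_of_mem Algebra.TensorProduct.includeLeft hr)
    (Ideal.mem_map_of_mem Algebra.TensorProduct.includeRight hs)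

variable (k) in
theorem exists_projection (A : Ideal R) :
    ∃ e : R →ₗ[k] R, (∀ r, e r ∈ A) ∧ e ∘ₗ (A.restrictScalars k).subtype =
      (A.restrictScalars k).subtype := by
  obtain ⟨g, hg⟩ := (A.restrictScalars k).subtype.exists_leftInverse_of_injective
    (by simp)
  refine ⟨(A.restrictScalars k).subtype ∘ₗ g, fun r => (g r).2, ?_⟩
  rw [LinearMap.comp_assoc, hg, LinearMap.comp_id]

/-- For `k`-linear projections `e` onto `A` and `f` onto `B`, `e ⊗ 1` fixes the extension of `A` and
`1 ⊗ f` that of `B`. So `e ⊗ f` fixes the intersection, while its values lie in the product. -/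
theorem extendLeft_inf_extendRight (A : Ideal R) (B : Ideal S) :
    extendLeft (k := k) (S := S) A ⊓ extendRight (k := k) (R := R) B =
      extendLeft A * extendRight B := by
  refine le_antisymm ?_ Ideal.mul_le_inf
  rintro x ⟨hx, hy⟩
  obtain ⟨e, he, he'⟩ := exists_projection k A
  obtain ⟨f, hf, hf'⟩ := exists_projection k B
  have h1 : TensorProduct.map e LinearMap.id x = x := by
    have : x ∈ (extendLeft (k := k) (S := S) A).restrictScalars k := hx
    rw [extendLeft, Ideal.map_includeLeft_eq] at this
    obtain ⟨y, rfl⟩ := this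
    change (e.rTensor S ∘ₗ (A.restrictScalars k).subtype.rTensor S) y = _
    rw [← LinearMap.rTensor_comp, he']
  have h2 : TensorProduct.map LinearMap.id f x = x := by
    have : x ∈ (extendRight (k := k) (R := R) B).restrictScalars k := hy
    rw [extendRight, Ideal.map_includeRight_eq] at this
    obtain ⟨y, rfl⟩ := this
    change (f.lTensor R ∘ₗ (B.restrictScalars k).subtype.lTensor R) y = _
    rw [← LinearMap.lTensor_comp, hf']
  have h3 : TensorProduct.map e f x = x := by
    conv_rhs => rw [← h1, ← h2]
    rw [← LinearMap.comp_apply, ← TensorProduct.map_comp, LinearMap.comp_id, LinearMap.id_comp]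
  rw [← h3]
  clear hx hy h1 h2 h3
  induction x with
  | zero => rw [map_zero]; exact Ideal.zero_mem _
  | tmul r s => exact tmul_mem_extend (he r) (hf s)
  | add x y hx hy => rw [map_add]; exact Ideal.add_mem _ hx hy

/-- In the inductive step the only mixed term is `A * B * (A + B) ^ s`, which `A * (A + B) ^ (s +
1)` absorbs. -/
theorem pow_succ_add_eq {T : Type u} [CommRing T] (A B : Ideal T) (s : ℕ) :
    (A + B) ^ (s + 1) = A * (A + B) ^ s + B ^ (s + 1) := by
  induction s with
  | zero => simp
  | succ s ih =>
    have h : A * B * (A + B) ^ s ≤ A * (A + B) ^ (s + 1) := by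
      rw [mul_assoc, pow_succ' (A + B)]
      exact Ideal.mul_mono_right (Ideal.mul_mono_left le_sup_right)
    calc (A + B) ^ (s + 2) = A * (A + B) ^ (s + 1) + B * (A + B) ^ (s + 1) := by ring
      _ = A * (A + B) ^ (s + 1) + B * (A * (A + B) ^ s + B ^ (s + 1)) := by rw [← ih]
      _ = (A * (A + B) ^ (s + 1) + A * B * (A + B) ^ s) + B ^ (s + 2) := by ring
      _ = _ := by rw [Submodule.add_eq_sup (A * (A + B) ^ (s + 1)), sup_eq_left.2 h]

variable (k) in
theorem extendLeft_pow (I : Ideal R) (r : ℕ) :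
    extendLeft (k := k) (S := S) (I ^ r) = extendLeft I ^ r :=
  Ideal.map_pow _ _ _

variable (k) in
theorem extendRight_pow (J : Ideal S) (s : ℕ) :
    extendRight (k := k) (R := R) (J ^ s) = extendRight J ^ s :=
  Ideal.map_pow _ _ _

variable (I : Ideal R) (J : Ideal S)

theorem mixedSum_decomposition (r s : ℕ) :
    extendLeft (k := k) I ^ r * mixedSum I J ^ (s + 1) =
      extendLeft I ^ (r + 1) * mixedSum I J ^ s + extendLeft I ^ r * extendRight J ^ (s + 1) := by
  rw [mixedSum, pow_succ_add_eq]
  ring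

/-- The two ideals lie in the extensions of `I ^ (r + 1)` and `J ^ (s + 1)`, which meet in their
product. The reverse inclusion uses `J ≤ P` and `I ^ (r + 1) ≤ I ^ r`. -/
theorem mixedSum_inf (r s : ℕ) :
    (extendLeft (k := k) I ^ (r + 1) * mixedSum I J ^ s) ⊓
        (extendLeft I ^ r * extendRight J ^ (s + 1)) =
      extendLeft I ^ (r + 1) * extendRight J ^ (s + 1) := by
  apply le_antisymm
  · rw [← extendLeft_pow k I (r + 1), ← extendRight_pow k J (s + 1),
      ← extendLeft_inf_extendRight]
    exact inf_le_inf Ideal.mul_le_left Ideal.mul_le_right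
  · refine le_inf (Ideal.mul_mono_right ?_) (Ideal.mul_mono_left (Ideal.pow_le_pow_right
      (Nat.le_succ r)))
    exact (Ideal.pow_le_pow_right (Nat.le_succ s)).trans (Ideal.pow_right_mono le_sup_right s)

end Ideals

/-! ### The iterated cone resolving `I ^ r * P ^ s` and the lift of `P ^ (s + 1) → P ^ s`. -/

section Total

variable {k R S : Type u} [Field k] [CommRing R] [Algebra k R] [CommRing S] [Algebra k S]

theorem isLift_id (F : Cx R) : IsLift F F ⊤ LinearMap.id :=
  ⟨fun _ => rfl, fun _ => rfl, fun _ _ => trivial⟩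

theorem preservesH_id (F : Cx R) : PreservesH F F LinearMap.id := by
  intro j i h
  by_contra hne
  exact h (Finsupp.single_eq_of_ne' fun hji => hne (congrArg F.h hji))

theorem PreservesH.sign {F G : Cx R} {φ : (F.X →₀ R) →ₗ[R] (G.X →₀ R)} (h : PreservesH F G φ)
    (x : F.X →₀ R) : G.sign (φ x) = φ (F.sign x) := by
  suffices hyp : G.sign ∘ₗ φ = φ ∘ₗ F.sign from LinearMap.congr_fun hyp x
  refine linearMap_ext_single fun j => ?_
  have key : ∀ b, G.parity b (φ (Finsupp.single j 1)) =
      if F.h j % 2 = b then φ (Finsupp.single j 1) else 0 := by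
    intro b
    refine (Cx.apply_eq_of_eq_on_degree (G.parity b)
      (if F.h j % 2 = b then LinearMap.id else 0) (F.h j) (fun i hi => ?_) _
      fun i hi => (h j i hi).symm).trans ?_
    · rw [G.parity_single, hi]; split_ifs <;> rfl
    · split_ifs <;> rfl
  rw [LinearMap.comp_apply, LinearMap.comp_apply, Cx.sign, Cx.sign, LinearMap.sub_apply,
    LinearMap.sub_apply, key, key, map_sub, F.parity_single, F.parity_single]
  split_ifs <;> simp

theorem PreservesH.comp {F G H : Cx R} {φ : (F.X →₀ R) →ₗ[R] (G.X →₀ R)}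
    {ψ : (G.X →₀ R) →ₗ[R] (H.X →₀ R)} (hψ : PreservesH G H ψ) (hφ : PreservesH F G φ) :
    PreservesH F H (ψ ∘ₗ φ) := by
  intro j i h
  by_contra hne
  refine h ?_
  refine Cx.apply_eq_of_eq_on_degree (F := G) (Finsupp.lapply i ∘ₗ ψ) 0 (F.h j)
    (fun l hl => ?_) (φ (Finsupp.single j 1)) fun l hl => (hφ j l hl).symm
  by_contra h0
  exact hne (hl.symm.trans (hψ l i h0))

theorem box_apply_single {X Y X' Y' : Type u} (f : (X →₀ R) →ₗ[R] (X' →₀ R))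
    (g : (Y →₀ S) →ₗ[S] (Y' →₀ S)) (p : X × Y) (q : X' × Y') :
    box (k := k) f g (Finsupp.single p 1) q =
      f (Finsupp.single p.1 1) q.1 ⊗ₜ g (Finsupp.single p.2 1) q.2 := by
  rw [show (Finsupp.single p 1 : X × Y →₀ R ⊗[k] S) =
      tp k (Finsupp.single p.1 1) (Finsupp.single p.2 1) by rw [tp_single]; rfl]
  rw [box_tp, tp_apply]

theorem box_box {X Y X' Y' X'' Y'' : Type u} (f : (X →₀ R) →ₗ[R] (X' →₀ R))
    (g : (Y →₀ S) →ₗ[S] (Y' →₀ S)) (f' : (X' →₀ R) →ₗ[R] (X'' →₀ R))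
    (g' : (Y' →₀ S) →ₗ[S] (Y'' →₀ S)) (z : X × Y →₀ R ⊗[k] S) :
    box f' g' (box f g z) = box (f' ∘ₗ f) (g' ∘ₗ g) z := by
  induction z using tp_induction (k := k) with
  | h0 => simp
  | htp a b => simp
  | hadd x y hx hy => simp only [map_add, hx, hy]

/-- Only `φ` has to preserve homological degree, because the sign in the differential sits on the
left factor. -/
theorem box_isLift {F F' : Cx R} {G G' : Cx S} {c : Ideal R} {d : Ideal S}
    {φ : (F.X →₀ R) →ₗ[R] (F'.X →₀ R)} {ψ : (G.X →₀ S) →ₗ[S] (G'.X →₀ S)}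
    (hφ : IsLift F F' c φ) (hφh : PreservesH F F' φ) (hψ : IsLift G G' d ψ) :
    IsLift (tensorCx k F G) (tensorCx k F' G') (extendLeft c * extendRight d) (box φ ψ) where
  comm_D z := by
    induction z using tp_induction (k := k) with
    | h0 => simp
    | htp a b =>
      rw [box_tp, tensorCx_D_tp, tensorCx_D_tp, map_add, box_tp, box_tp, hφ.comm_D, hψ.comm_D,
        hφh.sign]
    | hadd x y hx hy => simp only [map_add] at hx hy ⊢; rw [hx, hy]
  comm_aug z := by
    induction z using tp_induction (k := k) with
    | h0 => simp
    | htp a b => rw [box_tp, boxAug_tp, boxAug_tp, hφ.comm_aug, hψ.comm_aug]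
    | hadd x y hx hy => simp only [map_add] at hx hy ⊢; rw [hx, hy]
  mem := apply_mem_of_single _ fun p q => by
    rw [box_apply_single]
    exact tmul_mem_extend (hφ.mem _ _) (hψ.mem _ _)

theorem box_preservesH {F F' : Cx R} {G G' : Cx S} {φ : (F.X →₀ R) →ₗ[R] (F'.X →₀ R)}
    {ψ : (G.X →₀ S) →ₗ[S] (G'.X →₀ S)} (hφ : PreservesH F F' φ) (hψ : PreservesH G G' ψ) :
    PreservesH (tensorCx k F G) (tensorCx k F' G') (box φ ψ) := by
  intro p q h
  rw [box_apply_single] at h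
  have h1 := hφ p.1 q.1 fun h0 => h (by rw [h0, TensorProduct.zero_tmul])
  have h2 := hψ p.2 q.2 fun h0 => h (by rw [h0, TensorProduct.tmul_zero])
  exact congrArg₂ (· + ·) h1 h2

variable (k) (F : ℕ → Cx R) (G : ℕ → Cx S)
  (φ : ∀ a, ((F (a + 1)).X →₀ R) →ₗ[R] ((F a).X →₀ R))
  (ψ : ∀ b, ((G (b + 1)).X →₀ S) →ₗ[S] ((G b).X →₀ S))

/-- The resolution of `I ^ r * (I + J) ^ s` obtained from resolutions `F a` of `I ^ a` and `G b`
of `J ^ b` by iterated mapping cones, with the inclusion of `F r ⊗ G s`. -/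
def tot : ∀ s r : ℕ, Σ C : Cx (R ⊗[k] S),
    (((tensorCx k (F r) (G s)).X →₀ R ⊗[k] S) →ₗ[R ⊗[k] S] (C.X →₀ R ⊗[k] S))
  | 0, r => ⟨tensorCx k (F r) (G 0), LinearMap.id⟩
  | s + 1, r => ⟨cone (tot s (r + 1)).1 (tensorCx k (F r) (G (s + 1)))
      (tensorCx k (F (r + 1)) (G (s + 1))) ((tot s (r + 1)).2 ∘ₗ box LinearMap.id (ψ s))
      (box (φ r) LinearMap.id), coneInr _ _ _ _ _⟩

/-- The lift of the inclusion of `I ^ r * (I + J) ^ (s + 1)` in `I ^ r * (I + J) ^ s`. -/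
def totMap : ∀ s r : ℕ, ((tot k F G φ ψ (s + 1) r).1.X →₀ R ⊗[k] S) →ₗ[R ⊗[k] S]
    ((tot k F G φ ψ s r).1.X →₀ R ⊗[k] S)
  | 0, r => coneDesc _ _ (box (φ r) LinearMap.id) (box LinearMap.id (ψ 0))
  | s + 1, r => coneMap _ _ _ _ (totMap s (r + 1)) (box LinearMap.id (ψ (s + 1)))
      (box LinearMap.id (ψ (s + 1)))

variable {F G φ ψ} {I : Ideal R} {J : Ideal S} {c : Ideal R} {d : Ideal S}

/-- Each step is Mayer–Vietoris for `mixedSum_decomposition` with the intersection from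
`mixedSum_inf`. Level `s + 1` at `r` is built from level `s` at `r + 1`, so `r` varies in the
induction; the inclusion of `F r ⊗ G s` is carried along because the next attaching map factors
through it. -/
theorem tot_spec (hF : ∀ a, (F a).IsRes (I ^ a)) (hG : ∀ b, (G b).IsRes (J ^ b))
    (hφ : ∀ a, IsLift (F (a + 1)) (F a) c (φ a)) (hφh : ∀ a, PreservesH (F (a + 1)) (F a) (φ a))
    (hψ : ∀ b, IsLift (G (b + 1)) (G b) d (ψ b)) (hψh : ∀ b, PreservesH (G (b + 1)) (G b) (ψ b))
    (s r : ℕ) :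
    (tot k F G φ ψ s r).1.IsRes (extendLeft I ^ r * mixedSum I J ^ s) ∧
    IsLift (tensorCx k (F r) (G s)) (tot k F G φ ψ s r).1 ⊤ (tot k F G φ ψ s r).2 ∧
    PreservesH (tensorCx k (F r) (G s)) (tot k F G φ ψ s r).1 (tot k F G φ ψ s r).2 := by
  have htens : ∀ r s, (tensorCx k (F r) (G s)).IsRes (extendLeft I ^ r * extendRight J ^ s) := by
    intro r s
    rw [← extendLeft_pow, ← extendRight_pow]
    exact tensorCx_isRes (hF r) (hG s)
  induction s generalizing r with
  | zero => exact ⟨htens r 0, isLift_id _, preservesH_id _⟩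
  | succ s ih =>
    obtain ⟨h1, h2, h3⟩ := ih (r + 1)
    refine ⟨?_, coneInr_isLift, coneInr_preservesH⟩
    rw [mixedSum_decomposition]
    refine cone_isRes h1 (htens r (s + 1)) ?_
      (h2.comp (box_isLift (isLift_id _) (preservesH_id _) (hψ s)))
      (box_isLift (hφ r) (hφh r) (isLift_id _))
      (h3.comp (box_preservesH (preservesH_id _) (hψh s)))
      (box_preservesH (hφh r) (preservesH_id _))
    rw [mixedSum_inf]
    exact htens _ _

/-- This strict commutation is the square that makes the block diagonal map on the next cone a chain
map. -/
theorem totMap_inc (s r : ℕ) (x) : totMap k F G φ ψ s r ((tot k F G φ ψ (s + 1) r).2 x) =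
    (tot k F G φ ψ s r).2 (box LinearMap.id (ψ s) x) := by
  cases s with
  | zero =>
    change coneDesc (G := tensorCx k (F r) (G 0)) _ _ _ _ (coneInr _ _ _ _ _ x) =
      box LinearMap.id (ψ 0) x
    exact coneDesc_coneInr _ _ _
  | succ s =>
    change coneMap _ _ _ _ _ _ _ (coneInr _ _ _ _ _ x) = coneInr _ _ _ _ _ _
    rw [coneInr_apply, coneInr_apply, coneMap_apply, map_zero, map_zero]

/-- Every block is `φ ⊗ 1` or `1 ⊗ ψ`, so all entries lie in `e`. Leaving `c`, `d`, `e` arbitrary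
treats the maximal ideals and their squares at once. -/
theorem totMap_isLift {e : Ideal (R ⊗[k] S)} (hc : extendLeft c ≤ e) (hd : extendRight d ≤ e)
    (hφ : ∀ a, IsLift (F (a + 1)) (F a) c (φ a)) (hφh : ∀ a, PreservesH (F (a + 1)) (F a) (φ a))
    (hψ : ∀ b, IsLift (G (b + 1)) (G b) d (ψ b)) (s r : ℕ) :
    IsLift (tot k F G φ ψ (s + 1) r).1 (tot k F G φ ψ s r).1 e (totMap k F G φ ψ s r) := by
  have h1 : ∀ r s, IsLift (tensorCx k (F (r + 1)) (G s)) (tensorCx k (F r) (G s)) e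
      (box (φ r) LinearMap.id) := fun r s =>
    (box_isLift (hφ r) (hφh r) (isLift_id _)).mono (Ideal.mul_le_left.trans hc)
  have h2 : ∀ r s, IsLift (tensorCx k (F r) (G (s + 1))) (tensorCx k (F r) (G s)) e
      (box LinearMap.id (ψ s)) := fun r s =>
    (box_isLift (isLift_id _) (preservesH_id _) (hψ s)).mono (Ideal.mul_le_right.trans hd)
  induction s generalizing r with
  | zero =>
    refine coneDesc_isLift (h1 r 0) (h2 r 0) fun x => ?_
    -- Both composites around the square equal `φ ⊗ ψ`.
    exact (box_box LinearMap.id (ψ 0) (φ r) LinearMap.id x).trans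
      (box_box (φ r) LinearMap.id LinearMap.id (ψ 0) x).symm
  | succ s ih =>
    refine coneMap_isLift (ih (r + 1)) (h2 _ _) (h2 _ _) (fun x => ?_) (fun x => ?_)
    · exact totMap_inc k s (r + 1) _
    · rw [box_box, box_box]
      rfl

end Total

/-! ### Internal degrees and homogeneous maps. -/

section Homogeneous

variable {k R : Type u} [Field k] [CommRing R] [Algebra k R] (𝒜 : ℕ → Submodule k R)

/-- The matrix entries are homogeneous, so that the map preserves internal degrees. -/
def IsHomog (F G : Cx R) (φ : (F.X →₀ R) →ₗ[R] (G.X →₀ R)) : Prop :=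
  ∀ j i, φ (Finsupp.single j 1) i ∈ component 𝒜 (F.deg j - G.deg i)

/-- The differential and the augmentation preserve internal degrees. -/
structure Cx.IsGraded (F : Cx R) : Prop where
  D_deg : IsHomog 𝒜 F F F.D
  aug_deg : ∀ j, F.aug (Finsupp.single j 1) ∈ component 𝒜 (F.deg j)

/-- The family of subspaces satisfies the axioms of a graded monoid. -/
structure IsMulGrading : Prop where
  one_mem : (1 : R) ∈ 𝒜 0
  mul_mem : ∀ {m n : ℕ} {x y : R}, x ∈ 𝒜 m → y ∈ 𝒜 n → x * y ∈ 𝒜 (m + n)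

variable {𝒜}

theorem component_mul_mem (h : IsMulGrading 𝒜) {z w : ℤ} {x y : R} (hx : x ∈ component 𝒜 z)
    (hy : y ∈ component 𝒜 w) : x * y ∈ component 𝒜 (z + w) := by
  cases z with
  | ofNat m =>
    cases w with
    | ofNat n => exact h.mul_mem hx hy
    | negSucc n => rw [(Submodule.mem_bot k).1 hy, mul_zero]; exact Submodule.zero_mem _
  | negSucc m => rw [(Submodule.mem_bot k).1 hx, zero_mul]; exact Submodule.zero_mem _

theorem isHomog_id (h : IsMulGrading 𝒜) (F : Cx R) : IsHomog 𝒜 F F LinearMap.id := by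
  intro j i
  by_cases hji : j = i
  · subst hji
    rw [sub_self, LinearMap.id_apply, Finsupp.single_eq_same]
    exact h.one_mem
  · rw [LinearMap.id_apply, Finsupp.single_eq_of_ne' hji]
    exact Submodule.zero_mem _

theorem isHomog_sign (h : IsMulGrading 𝒜) (F : Cx R) : IsHomog 𝒜 F F F.sign := by
  intro j i
  have hid := isHomog_id h F j i
  rw [LinearMap.id_apply] at hid
  rw [Cx.sign, LinearMap.sub_apply, F.parity_single, F.parity_single, Finsupp.sub_apply]
  refine Submodule.sub_mem _ ?_ ?_ <;> split_ifs <;>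
    first | exact hid | exact Submodule.zero_mem _

theorem IsHomog.comp (h : IsMulGrading 𝒜) {F G H : Cx R} {φ : (F.X →₀ R) →ₗ[R] (G.X →₀ R)}
    {ψ : (G.X →₀ R) →ₗ[R] (H.X →₀ R)} (hψ : IsHomog 𝒜 G H ψ) (hφ : IsHomog 𝒜 F G φ) :
    IsHomog 𝒜 F H (ψ ∘ₗ φ) := by
  intro j i
  rw [LinearMap.comp_apply, ← Finsupp.sum_single (φ (Finsupp.single j 1)), Finsupp.sum, map_sum,
    Finsupp.finsetSum_apply]
  refine Submodule.sum_mem _ fun l _ => ?_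
  rw [← mul_one (φ (Finsupp.single j 1) l), ← smul_eq_mul, ← Finsupp.smul_single, map_smul,
    Finsupp.smul_apply, smul_eq_mul]
  have := component_mul_mem h (hφ j l) (hψ l i)
  rwa [sub_add_sub_cancel] at this

variable {A B K : Cx R} {φ : (K.X →₀ R) →ₗ[R] (A.X →₀ R)} {ψ : (K.X →₀ R) →ₗ[R] (B.X →₀ R)}

theorem cone_isGraded (hA : A.IsGraded 𝒜) (hB : B.IsGraded 𝒜) (hK : IsHomog 𝒜 K K K.D)
    (hφ : IsHomog 𝒜 K A φ) (hψ : IsHomog 𝒜 K B ψ) : (cone A B K φ ψ).IsGraded 𝒜 where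
  D_deg := by
    rintro (j | j | j) (i | i | i) <;>
      simp only [cone, coneD, LinearMap.comp_apply, LinearEquiv.coe_coe, blocks_single_inl,
        blocks_single_inr_inl, blocks_single_inr_inr, LinearMap.coe_mk, AddHom.coe_mk,
        blocks_symm_inl, blocks_symm_inr_inl, blocks_symm_inr_inr, map_zero, add_zero, zero_add,
        sub_zero, zero_sub, neg_zero, Finsupp.neg_apply]
    · exact hA.D_deg j i
    · exact Submodule.zero_mem _
    · exact Submodule.zero_mem _
    · exact Submodule.zero_mem _
    · exact hB.D_deg j i
    · exact Submodule.zero_mem _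
    · exact hφ j i
    · exact Submodule.neg_mem _ (hψ j i)
    · exact Submodule.neg_mem _ (hK j i)
  aug_deg := by
    rintro (j | j | j)
    · simpa [cone] using hA.aug_deg j
    · simpa [cone] using hB.aug_deg j
    · simp [cone]

theorem coneInr_isHomog (h : IsMulGrading 𝒜) :
    IsHomog 𝒜 B (cone A B K φ ψ) (coneInr A B K φ ψ) := by
  rintro j (i | i | i)
  · rw [coneInr_apply, blocks_symm_inl]; exact Submodule.zero_mem _
  · rw [coneInr_apply, blocks_symm_inr_inl]; exact isHomog_id h B j i
  · rw [coneInr_apply, blocks_symm_inr_inr]; exact Submodule.zero_mem _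

theorem coneMap_isHomog {A' B' K' : Cx R} {φ' : (K'.X →₀ R) →ₗ[R] (A'.X →₀ R)}
    {ψ' : (K'.X →₀ R) →ₗ[R] (B'.X →₀ R)} {α : (A.X →₀ R) →ₗ[R] (A'.X →₀ R)}
    {β : (B.X →₀ R) →ₗ[R] (B'.X →₀ R)} {γ : (K.X →₀ R) →ₗ[R] (K'.X →₀ R)}
    (hα : IsHomog 𝒜 A A' α) (hβ : IsHomog 𝒜 B B' β) (hγ : IsHomog 𝒜 K K' γ) :
    IsHomog 𝒜 (cone A B K φ ψ) (cone A' B' K' φ' ψ') (coneMap φ ψ φ' ψ' α β γ) := by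
  rintro (j | j | j) (i | i | i) <;>
    simp only [coneMap, LinearMap.comp_apply, LinearEquiv.coe_coe, blocks_single_inl,
      blocks_single_inr_inl, blocks_single_inr_inr, LinearMap.prodMap_apply,
      blocks_symm_inl, blocks_symm_inr_inl, blocks_symm_inr_inr, map_zero]
  · exact hα j i
  · exact Submodule.zero_mem _
  · exact Submodule.zero_mem _
  · exact Submodule.zero_mem _
  · exact hβ j i
  · exact Submodule.zero_mem _
  · exact Submodule.zero_mem _
  · exact Submodule.zero_mem _
  · exact hγ j i

theorem coneDesc_isHomog {G : Cx R} {α : (A.X →₀ R) →ₗ[R] (G.X →₀ R)}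
    {β : (B.X →₀ R) →ₗ[R] (G.X →₀ R)} (hα : IsHomog 𝒜 A G α) (hβ : IsHomog 𝒜 B G β) :
    IsHomog 𝒜 (cone A B K φ ψ) G (coneDesc φ ψ α β) := by
  rintro (j | j | j) i <;>
    simp only [coneDesc, LinearMap.comp_apply, LinearEquiv.coe_coe, blocks_single_inl,
      blocks_single_inr_inl, blocks_single_inr_inr, LinearMap.coprod_apply, map_zero, add_zero,
      zero_add, LinearMap.zero_apply]
  · exact hα j i
  · exact hβ j i
  · exact Submodule.zero_mem _

end Homogeneous

/-! ### The total grading on the tensor product and on the iterated cones. -/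

section TensorGrading

variable {k R S : Type u} [Field k] [CommRing R] [Algebra k R] [CommRing S] [Algebra k S]
  {𝒜 : ℕ → Submodule k R} {ℬ : ℕ → Submodule k S}

theorem tmul_mem_tensorGrading {m n p : ℕ} (hp : m + n = p) {r : R} {s : S} (hr : r ∈ 𝒜 m)
    (hs : s ∈ ℬ n) : r ⊗ₜ[k] s ∈ tensorGrading 𝒜 ℬ p :=
  Submodule.mem_iSup_of_mem (m, n) (Submodule.mem_iSup_of_mem
    (Finset.HasAntidiagonal.mem_antidiagonal.2 hp) (Submodule.apply_mem_map₂ _ hr hs))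

theorem tensorGrading_le {n : ℕ} {N : Submodule k (R ⊗[k] S)}
    (h : ∀ p q, p + q = n → ∀ r ∈ 𝒜 p, ∀ s ∈ ℬ q, r ⊗ₜ[k] s ∈ N) :
    tensorGrading 𝒜 ℬ n ≤ N :=
  iSup₂_le fun p hp => Submodule.map₂_le.2 fun r hr s hs =>
    h p.1 p.2 (Finset.HasAntidiagonal.mem_antidiagonal.1 hp) r hr s hs

theorem tensorGrading_mul_mem (hA : IsMulGrading 𝒜) (hB : IsMulGrading ℬ) {m n : ℕ}
    {x y : R ⊗[k] S} (hx : x ∈ tensorGrading 𝒜 ℬ m) (hy : y ∈ tensorGrading 𝒜 ℬ n) :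
    x * y ∈ tensorGrading 𝒜 ℬ (m + n) := by
  have h1 : ∀ p q, p + q = m → ∀ r ∈ 𝒜 p, ∀ s ∈ ℬ q, tensorGrading 𝒜 ℬ n ≤
      (tensorGrading 𝒜 ℬ (m + n)).comap (LinearMap.mulLeft k (r ⊗ₜ[k] s)) := by
    intro p q hpq r hr s hs
    refine tensorGrading_le fun p' q' hpq' r' hr' s' hs' => ?_
    rw [Submodule.mem_comap, LinearMap.mulLeft_apply, Algebra.TensorProduct.tmul_mul_tmul]
    exact tmul_mem_tensorGrading (m := p + p') (n := q + q') (by omega) (hA.mul_mem hr hr')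
      (hB.mul_mem hs hs')
  have h2 : tensorGrading 𝒜 ℬ m ≤
      (tensorGrading 𝒜 ℬ (m + n)).comap (LinearMap.mulRight k y) := by
    refine tensorGrading_le fun p q hpq r hr s hs => ?_
    have := h1 p q hpq r hr s hs hy
    rwa [Submodule.mem_comap, LinearMap.mulLeft_apply] at this
  have := h2 hx
  rwa [Submodule.mem_comap, LinearMap.mulRight_apply] at this

theorem isMulGrading_tensorGrading (hA : IsMulGrading 𝒜) (hB : IsMulGrading ℬ) :
    IsMulGrading (tensorGrading 𝒜 ℬ) where
  one_mem := by
    rw [Algebra.TensorProduct.one_def]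
    exact tmul_mem_tensorGrading (m := 0) (n := 0) rfl hA.one_mem hB.one_mem
  mul_mem := tensorGrading_mul_mem hA hB

theorem tmul_mem_component {z w : ℤ} {r : R} {s : S} (hr : r ∈ component 𝒜 z)
    (hs : s ∈ component ℬ w) : r ⊗ₜ[k] s ∈ component (tensorGrading 𝒜 ℬ) (z + w) := by
  cases z with
  | ofNat m =>
    cases w with
    | ofNat n => exact tmul_mem_tensorGrading rfl hr hs
    | negSucc n =>
      rw [(Submodule.mem_bot k).1 hs, TensorProduct.tmul_zero]; exact Submodule.zero_mem _
  | negSucc m =>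
    rw [(Submodule.mem_bot k).1 hr, TensorProduct.zero_tmul]; exact Submodule.zero_mem _

theorem box_isHomog {F F' : Cx R} {G G' : Cx S} {φ : (F.X →₀ R) →ₗ[R] (F'.X →₀ R)}
    {ψ : (G.X →₀ S) →ₗ[S] (G'.X →₀ S)} (hφ : IsHomog 𝒜 F F' φ) (hψ : IsHomog ℬ G G' ψ) :
    IsHomog (tensorGrading 𝒜 ℬ) (tensorCx k F G) (tensorCx k F' G') (box φ ψ) := by
  intro p q
  rw [box_apply_single]
  have := tmul_mem_component (hφ p.1 q.1) (hψ p.2 q.2)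
  rwa [sub_add_sub_comm] at this

theorem tensorCx_isGraded (hA : IsMulGrading 𝒜) (hB : IsMulGrading ℬ) {F : Cx R} {G : Cx S}
    (hF : F.IsGraded 𝒜) (hG : G.IsGraded ℬ) :
    (tensorCx k F G).IsGraded (tensorGrading 𝒜 ℬ) where
  D_deg p q := Submodule.add_mem _ (box_isHomog hF.D_deg (isHomog_id hB G) p q)
    (box_isHomog (isHomog_sign hA F) hG.D_deg p q)
  aug_deg p := by
    rw [show (Finsupp.single p 1 : F.X × G.X →₀ R ⊗[k] S) =
      tp k (Finsupp.single p.1 1) (Finsupp.single p.2 1) by rw [tp_single]; rfl]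
    rw [boxAug_tp]
    exact tmul_mem_component (hF.aug_deg _) (hG.aug_deg _)

variable {F : ℕ → Cx R} {G : ℕ → Cx S}
  {φ : ∀ a, ((F (a + 1)).X →₀ R) →ₗ[R] ((F a).X →₀ R)}
  {ψ : ∀ b, ((G (b + 1)).X →₀ S) →ₗ[S] ((G b).X →₀ S)}

theorem tot_isGraded (hA : IsMulGrading 𝒜) (hB : IsMulGrading ℬ) (hF : ∀ a, (F a).IsGraded 𝒜)
    (hG : ∀ b, (G b).IsGraded ℬ) (hφ : ∀ a, IsHomog 𝒜 (F (a + 1)) (F a) (φ a))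
    (hψ : ∀ b, IsHomog ℬ (G (b + 1)) (G b) (ψ b)) (s r : ℕ) :
    (tot k F G φ ψ s r).1.IsGraded (tensorGrading 𝒜 ℬ) ∧
    IsHomog (tensorGrading 𝒜 ℬ) (tensorCx k (F r) (G s)) (tot k F G φ ψ s r).1
      (tot k F G φ ψ s r).2 := by
  have hAB := isMulGrading_tensorGrading hA hB
  induction s generalizing r with
  | zero => exact ⟨tensorCx_isGraded hA hB (hF r) (hG 0), isHomog_id hAB _⟩
  | succ s ih =>
    obtain ⟨h1, h2⟩ := ih (r + 1)
    exact ⟨cone_isGraded h1 (tensorCx_isGraded hA hB (hF _) (hG _))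
      (tensorCx_isGraded hA hB (hF _) (hG _)).D_deg
      (h2.comp hAB (box_isHomog (isHomog_id hA _) (hψ s)))
      (box_isHomog (hφ r) (isHomog_id hB _)), coneInr_isHomog hAB⟩

theorem totMap_isHomog (hA : IsMulGrading 𝒜) (hB : IsMulGrading ℬ)
    (hφ : ∀ a, IsHomog 𝒜 (F (a + 1)) (F a) (φ a))
    (hψ : ∀ b, IsHomog ℬ (G (b + 1)) (G b) (ψ b)) (s r : ℕ) :
    IsHomog (tensorGrading 𝒜 ℬ) (tot k F G φ ψ (s + 1) r).1 (tot k F G φ ψ s r).1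
      (totMap k F G φ ψ s r) := by
  induction s generalizing r with
  | zero =>
    exact coneDesc_isHomog (A := tensorCx k (F (r + 1)) (G 0)) (G := tensorCx k (F r) (G 0))
      (box_isHomog (hφ r) (isHomog_id hB _)) (box_isHomog (isHomog_id hA _) (hψ 0))
  | succ s ih =>
    exact coneMap_isHomog (ih (r + 1)) (box_isHomog (isHomog_id hA _) (hψ _))
      (box_isHomog (isHomog_id hA _) (hψ _))

end TensorGrading

/-! ### Homogeneous components, homogenization of lifts, and the graded maximal ideal. -/

section Homogenize

variable {k R : Type u} [Field k] [CommRing R] [Algebra k R] (𝒜 : ℕ → Submodule k R)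
  [GradedAlgebra 𝒜]

theorem isMulGrading_of_gradedAlgebra : IsMulGrading 𝒜 :=
  ⟨SetLike.one_mem_graded 𝒜, fun hx hy => SetLike.mul_mem_graded hx hy⟩

/-- The homogeneous component of degree `z ∈ ℤ`. -/
def homComp : ℤ → R →+ R
  | Int.ofNat n => GradedRing.proj 𝒜 n
  | Int.negSucc _ => 0

theorem homComp_mem (z : ℤ) (x : R) : homComp 𝒜 z x ∈ component 𝒜 z := by
  cases z with
  | ofNat n => exact (DirectSum.decompose 𝒜 x n).2
  | negSucc n => exact Submodule.zero_mem _

theorem homComp_of_mem {z : ℤ} {x : R} (hx : x ∈ component 𝒜 z) : homComp 𝒜 z x = x := by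
  cases z with
  | ofNat n => exact DirectSum.decompose_of_mem_same 𝒜 hx
  | negSucc n => rw [(Submodule.mem_bot k).1 hx, map_zero]

theorem homComp_mul {w : ℤ} {y : R} (hy : y ∈ component 𝒜 w) (z : ℤ) (x : R) :
    homComp 𝒜 (z + w) (x * y) = homComp 𝒜 z x * y := by
  cases w with
  | negSucc n => rw [(Submodule.mem_bot k).1 hy, mul_zero, mul_zero, map_zero]
  | ofNat n =>
    cases z with
    | ofNat m => exact DirectSum.coe_decompose_mul_add_of_right_mem 𝒜 hy
    | negSucc m =>
      change _ = 0 * y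
      rw [zero_mul]
      generalize hp : Int.negSucc m + Int.ofNat n = p
      cases p with
      | ofNat p =>
        -- Here `p < n`, and a multiple of an element of degree `n` has no component below `n`.
        exact DirectSum.coe_decompose_mul_of_right_mem_of_not_le 𝒜 hy (by grind)
      | negSucc p => rfl

theorem homComp_mem_ideal {c : Ideal R} (hc : c.IsHomogeneous 𝒜) (z : ℤ) {x : R} (hx : x ∈ c) :
    homComp 𝒜 z x ∈ c := by
  cases z with
  | ofNat n => exact hc n hx
  | negSucc n => exact c.zero_mem

/-- The component of internal degree `z` of an element of a graded free module. -/
def Cx.homPart (F : Cx R) (z : ℤ) : (F.X →₀ R) →+ (F.X →₀ R) where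
  toFun x := Finsupp.onFinset x.support (fun i => homComp 𝒜 (z - F.deg i) (x i)) fun i hi => by
    rw [Finsupp.mem_support_iff]
    intro h
    exact hi (by rw [h, map_zero])
  map_zero' := by ext i; simp
  map_add' x y := by ext i; simp

theorem Cx.homPart_apply (F : Cx R) (z : ℤ) (x : F.X →₀ R) (i : F.X) :
    F.homPart 𝒜 z x i = homComp 𝒜 (z - F.deg i) (x i) := rfl

theorem Cx.homPart_single (F : Cx R) (z : ℤ) (j : F.X) (a : R) :
    F.homPart 𝒜 z (Finsupp.single j a) = Finsupp.single j (homComp 𝒜 (z - F.deg j) a) := by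
  ext i
  rw [F.homPart_apply 𝒜]
  by_cases h : j = i
  · subst h; simp
  · simp [Finsupp.single_eq_of_ne' h]

theorem Cx.homPart_smul (F : Cx R) {w : ℤ} {a : R} (ha : a ∈ component 𝒜 w) (z : ℤ)
    (x : F.X →₀ R) : F.homPart 𝒜 (z + w) (a • x) = a • F.homPart 𝒜 z x := by
  ext i
  rw [Finsupp.smul_apply, F.homPart_apply 𝒜, F.homPart_apply 𝒜, Finsupp.smul_apply, smul_eq_mul,
    smul_eq_mul, mul_comm a, mul_comm a, ← homComp_mul 𝒜 ha, sub_add_eq_add_sub]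

theorem map_single_eq_smul {X N : Type*} [AddCommGroup N] [Module R N] (f : (X →₀ R) →ₗ[R] N)
    (j : X) (a : R) : f (Finsupp.single j a) = a • f (Finsupp.single j 1) := by
  rw [← map_smul, Finsupp.smul_single, smul_eq_mul, mul_one]

theorem IsHomog.homPart {F G : Cx R} {φ : (F.X →₀ R) →ₗ[R] (G.X →₀ R)} (hφ : IsHomog 𝒜 F G φ)
    (z : ℤ) (x : F.X →₀ R) : G.homPart 𝒜 z (φ x) = φ (F.homPart 𝒜 z x) := by
  induction x using Finsupp.induction_linear with
  | zero => simp
  | add f g hf hg => simp only [map_add, hf, hg]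
  | single j a =>
    rw [F.homPart_single 𝒜, map_single_eq_smul φ j a, map_single_eq_smul φ j (homComp 𝒜 _ a)]
    ext i
    rw [G.homPart_apply 𝒜, Finsupp.smul_apply, Finsupp.smul_apply, smul_eq_mul, smul_eq_mul,
      ← homComp_mul 𝒜 (hφ j i), sub_add_sub_cancel]

theorem Cx.IsGraded.aug_homPart {F : Cx R} (hF : F.IsGraded 𝒜) (z : ℤ) (x : F.X →₀ R) :
    F.aug (F.homPart 𝒜 z x) = homComp 𝒜 z (F.aug x) := by
  induction x using Finsupp.induction_linear with
  | zero => simp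
  | add f g hf hg => simp only [map_add, hf, hg]
  | single j a =>
    rw [F.homPart_single 𝒜, map_single_eq_smul F.aug j a,
      map_single_eq_smul F.aug j (homComp 𝒜 _ a), smul_eq_mul,
      smul_eq_mul, ← homComp_mul 𝒜 (hF.aug_deg j), sub_add_cancel]

/-- The degree-preserving part of a linear map. -/
def homogenize (F G : Cx R) (φ : (F.X →₀ R) →ₗ[R] (G.X →₀ R)) :
    (F.X →₀ R) →ₗ[R] (G.X →₀ R) :=
  Finsupp.linearCombination R fun j => G.homPart 𝒜 (F.deg j) (φ (Finsupp.single j 1))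

theorem homogenize_single (F G : Cx R) (φ : (F.X →₀ R) →ₗ[R] (G.X →₀ R)) (j : F.X) :
    homogenize 𝒜 F G φ (Finsupp.single j 1) =
      G.homPart 𝒜 (F.deg j) (φ (Finsupp.single j 1)) := by
  simp [homogenize]

theorem homogenize_apply (F G : Cx R) (φ : (F.X →₀ R) →ₗ[R] (G.X →₀ R)) (z : ℤ) (x : F.X →₀ R)
    (hx : ∀ j, x j ∈ component 𝒜 (z - F.deg j)) :
    homogenize 𝒜 F G φ x = G.homPart 𝒜 z (φ x) := by
  rw [← Finsupp.sum_single x, Finsupp.sum, map_sum, map_sum, map_sum]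
  refine Finset.sum_congr rfl fun j _ => ?_
  rw [← mul_one (x j), ← smul_eq_mul, ← Finsupp.smul_single, map_smul, map_smul,
    homogenize_single 𝒜, ← G.homPart_smul 𝒜 (hx j), add_sub_cancel]

/-- Differentials and augmentations are homogeneous, so they commute with taking homogeneous
components; homogeneity of `c` keeps the entries in `c`. -/
theorem IsLift.homogenize {F G : Cx R} {c : Ideal R} {φ : (F.X →₀ R) →ₗ[R] (G.X →₀ R)}
    (hF : F.IsGraded 𝒜) (hG : G.IsGraded 𝒜) (hc : c.IsHomogeneous 𝒜) (hφ : IsLift F G c φ) :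
    IsLift F G c (homogenize 𝒜 F G φ) where
  comm_D x := by
    suffices h : G.D ∘ₗ MixedSum.homogenize 𝒜 F G φ = MixedSum.homogenize 𝒜 F G φ ∘ₗ F.D from
      LinearMap.congr_fun h x
    refine linearMap_ext_single fun j => ?_
    rw [LinearMap.comp_apply, LinearMap.comp_apply,
      homogenize_apply 𝒜 F G φ (F.deg j) _ (hF.D_deg j), homogenize_single 𝒜, ← hφ.comm_D,
      hG.D_deg.homPart 𝒜]
  comm_aug x := by
    suffices h : G.aug ∘ₗ MixedSum.homogenize 𝒜 F G φ = F.aug from LinearMap.congr_fun h x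
    refine linearMap_ext_single fun j => ?_
    rw [LinearMap.comp_apply, homogenize_single 𝒜, hG.aug_homPart 𝒜, hφ.comm_aug,
      homComp_of_mem 𝒜 (hF.aug_deg j)]
  mem := apply_mem_of_single _ fun j i => by
    rw [homogenize_single 𝒜, G.homPart_apply 𝒜]
    exact homComp_mem_ideal 𝒜 hc _ (hφ.mem _ _)

theorem homogenize_isHomog (F G : Cx R) (φ : (F.X →₀ R) →ₗ[R] (G.X →₀ R)) :
    IsHomog 𝒜 F G (homogenize 𝒜 F G φ) := fun j i => by
  rw [homogenize_single 𝒜, G.homPart_apply 𝒜]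
  exact homComp_mem 𝒜 _ _

theorem PreservesH.homogenize {F G : Cx R} {φ : (F.X →₀ R) →ₗ[R] (G.X →₀ R)}
    (hφ : PreservesH F G φ) : PreservesH F G (homogenize 𝒜 F G φ) := fun j i h => by
  rw [homogenize_single 𝒜, G.homPart_apply 𝒜] at h
  exact hφ j i fun h0 => h (by rw [h0, map_zero])

theorem HasLift.exists_isHomog {F G : Cx R} {A B c : Ideal R} (hF : F.IsRes A)
    (hG : G.IsRes B) (hFg : F.IsGraded 𝒜) (hGg : G.IsGraded 𝒜) (hc : c.IsHomogeneous 𝒜)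
    (h : HasLift F G c) : ∃ φ, IsLift F G c φ ∧ PreservesH F G φ ∧ IsHomog 𝒜 F G φ := by
  obtain ⟨φ, hφ, hφh⟩ := h.exists_preservesH hF hG
  exact ⟨_, hφ.homogenize 𝒜 hFg hGg hc, hφh.homogenize 𝒜, homogenize_isHomog 𝒜 F G φ⟩

theorem gradedMax_eq_irrelevant :
    gradedMax 𝒜 = (HomogeneousIdeal.irrelevant 𝒜).toIdeal := by
  rw [HomogeneousIdeal.irrelevant_eq_span, gradedMax]
  congr 1
  ext x
  simp [Nat.one_le_iff_ne_zero, Nat.pos_iff_ne_zero]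

theorem gradedMax_isHomogeneous : (gradedMax 𝒜).IsHomogeneous 𝒜 := by
  rw [gradedMax_eq_irrelevant]
  exact (HomogeneousIdeal.irrelevant 𝒜).isHomogeneous

theorem gradedMax_sq_isHomogeneous : (gradedMax 𝒜 ^ 2).IsHomogeneous 𝒜 := by
  rw [pow_two]
  exact (gradedMax_isHomogeneous 𝒜).mul (gradedMax_isHomogeneous 𝒜)

/-- Modulo `gradedMax` every element equals its degree-zero component, a scalar since `𝒜 0` is the
image of `k`; nonzero scalars are units. -/
theorem IsStandardGraded.gradedMax_isMaximal (h : IsStandardGraded 𝒜) :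
    (gradedMax 𝒜).IsMaximal := by
  have := h.nontrivial
  have hmem : ∀ x, x ∈ gradedMax 𝒜 ↔ GradedRing.proj 𝒜 0 x = 0 := fun x => by
    rw [gradedMax_eq_irrelevant]; exact HomogeneousIdeal.mem_irrelevant_iff 𝒜 x
  have h0 : ∀ x ∈ 𝒜 0, GradedRing.proj 𝒜 0 x = x := fun x hx =>
    DirectSum.decompose_of_mem_same 𝒜 hx
  rw [Ideal.isMaximal_iff]
  refine ⟨fun h1 => ?_, fun J x hJ hx hxJ => ?_⟩
  · rw [hmem, h0 1 (SetLike.one_mem_graded 𝒜)] at h1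
    exact one_ne_zero h1
  · have hx0 : GradedRing.proj 𝒜 0 x ∈ 𝒜 0 := (DirectSum.decompose 𝒜 x 0).2
    have hsub : x - GradedRing.proj 𝒜 0 x ∈ gradedMax 𝒜 := by
      rw [hmem, map_sub, h0 _ hx0, sub_self]
    have hJ0 : GradedRing.proj 𝒜 0 x ∈ J := by
      rw [← sub_sub_cancel x (GradedRing.proj 𝒜 0 x)]
      exact J.sub_mem hxJ (hJ hsub)
    rw [hmem] at hx
    rw [h.degree_zero] at hx0
    obtain ⟨a, ha⟩ := hx0
    rw [← ha] at hx hJ0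
    have ha0 : a ≠ 0 := by rintro rfl; exact hx (map_zero _)
    have := J.mul_mem_left (algebraMap k R a⁻¹) hJ0
    rwa [Algebra.linearMap_apply, ← map_mul, inv_mul_cancel₀ ha0, map_one] at this

end Homogenize

/-! ### The graded maximal ideals of the factors inside that of the tensor product. -/

section TensorMax

variable {k R S : Type u} [Field k] [CommRing R] [Algebra k R] [CommRing S] [Algebra k S]
  {𝒜 : ℕ → Submodule k R} {ℬ : ℕ → Submodule k S}

theorem extendLeft_gradedMax_le (hB : IsMulGrading ℬ) :
    extendLeft (gradedMax 𝒜) ≤ gradedMax (tensorGrading 𝒜 ℬ) := by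
  rw [extendLeft, gradedMax, Ideal.map_span, Ideal.span_le]
  rintro _ ⟨x, ⟨n, hn, hx⟩, rfl⟩
  exact Ideal.subset_span ⟨n, hn, tmul_mem_tensorGrading (add_zero n) hx hB.one_mem⟩

theorem extendRight_gradedMax_le (hA : IsMulGrading 𝒜) :
    extendRight (gradedMax ℬ) ≤ gradedMax (tensorGrading 𝒜 ℬ) := by
  rw [extendRight, gradedMax, Ideal.map_span, Ideal.span_le]
  rintro _ ⟨x, ⟨n, hn, hx⟩, rfl⟩
  exact Ideal.subset_span ⟨n, hn, tmul_mem_tensorGrading (zero_add n) hA.one_mem hx⟩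

theorem extendLeft_gradedMax_sq_le (hB : IsMulGrading ℬ) :
    extendLeft (gradedMax 𝒜 ^ 2) ≤ gradedMax (tensorGrading 𝒜 ℬ) ^ 2 := by
  rw [extendLeft_pow]
  exact Ideal.pow_right_mono (extendLeft_gradedMax_le hB) 2

theorem extendRight_gradedMax_sq_le (hA : IsMulGrading 𝒜) :
    extendRight (gradedMax ℬ ^ 2) ≤ gradedMax (tensorGrading 𝒜 ℬ) ^ 2 := by
  rw [extendRight_pow]
  exact Ideal.pow_right_mono (extendRight_gradedMax_le hA) 2

end TensorMax

/-! ### From single-module data to graded free resolutions. -/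

section Conversion

variable {k R : Type u} [Field k] [CommRing R] [Algebra k R] {𝒜 : ℕ → Submodule k R}

/-- The graded free resolution given by single-module data. -/
abbrev Cx.IsRes.gradedFreeResolution {F : Cx R} {A : Ideal R} (hF : F.IsRes A)
    (hFg : F.IsGraded 𝒜) : GradedFreeResolution 𝒜 (idealComponent 𝒜 A) where
  ι := F.Xn
  deg _ j := F.deg j.1
  d n := F.dd (n + 1) n
  aug := hF.augTo
  d_deg n j i := by
    have h : F.dd (n + 1) n (Finsupp.single j 1) i = F.D (Finsupp.single j.1 1) i.1 := by
      rw [← F.incl_single]; rfl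
    rw [h]
    exact hFg.D_deg j.1 i.1
  aug_deg j := by
    change F.aug (F.incl 0 (Finsupp.single j 1)) ∈ component 𝒜 (F.deg j.1)
    rw [F.incl_single]
    exact hFg.aug_deg j.1
  aug_surjective := hF.augTo_surjective
  exact_aug x := by
    constructor
    · exact fun hx => hF.exact_aug x (congrArg Subtype.val hx)
    · rintro ⟨y, rfl⟩
      refine Subtype.ext ?_
      change F.aug (F.incl 0 (F.dd 1 0 y)) = 0
      rw [hF.incl_dd, hF.aug_D]
  exact_d n x := by
    constructor
    · exact fun hx => hF.exact_dd n x hx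
    · rintro ⟨y, rfl⟩
      exact hF.dd_dd n y

theorem IsLift.inclusionDoublyTorVanishing {F G : Cx R} {A B : Ideal R}
    {φ : (F.X →₀ R) →ₗ[R] (G.X →₀ R)} (hφ : IsLift F G (gradedMax 𝒜 ^ 2) φ)
    (hF : F.IsRes A) (hG : G.IsRes B) (hFg : F.IsGraded 𝒜) (hGg : G.IsGraded 𝒜)
    (hφg : IsHomog 𝒜 F G φ) : InclusionDoublyTorVanishing 𝒜 A B := by
  refine ⟨hφ.le hF hG, hF.gradedFreeResolution hFg, hG.gradedFreeResolution hGg,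
    { map := fun n => G.restr n ∘ₗ φ ∘ₗ F.incl n, map_deg := ?_, comm_aug := ?_, comm_d := ?_ }, ?_⟩
  · intro n (j : F.Xn n) (i : G.Xn n)
    change φ (F.incl n (Finsupp.single j 1)) i.1 ∈ _
    rw [F.incl_single]
    exact hφg j.1 i.1
  · refine LinearMap.ext fun x => Subtype.ext ?_
    change G.aug (G.incl 0 (G.restr 0 (φ (F.incl 0 x)))) = F.aug (F.incl 0 x)
    rw [G.incl_restr, hG.aug_proj_zero, hφ.comm_aug]
  · intro n
    refine LinearMap.ext fun (x : F.Xn (n + 1) →₀ R) => ?_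
    change G.dd (n + 1) n (G.restr (n + 1) (φ (F.incl (n + 1) x))) =
      G.restr n (φ (F.incl n (F.dd (n + 1) n x)))
    rw [hG.dd_restr, hF.incl_dd, hφ.comm_D]
  · rintro n _ ⟨x, rfl⟩
    exact (mem_smul_top_iff _).2 fun i => hφ.mem _ i.1

end Conversion

/-! ### From resolutions indexed by homological degree to single-module data. -/

section Assemble

variable {R : Type u} [CommRing R] (ι : ℕ → Type u) (deg : ∀ n, ι n → ℤ)
  (d : ∀ n, (ι (n + 1) →₀ R) →ₗ[R] (ι n →₀ R)) (aug : (ι 0 →₀ R) →ₗ[R] R)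

/-- The inclusion of the `n`-th module in the direct sum of all. -/
def level (n : ℕ) : (ι n →₀ R) →ₗ[R] ((Σ n, ι n) →₀ R) :=
  Finsupp.lmapDomain R R (Sigma.mk n)

/-- The projection of the direct sum onto the `n`-th module. -/
def unlevel (n : ℕ) : ((Σ n, ι n) →₀ R) →ₗ[R] (ι n →₀ R) :=
  Finsupp.lcomapDomain (Sigma.mk n) sigma_mk_injective

theorem level_single (n : ℕ) (j : ι n) (a : R) :
    level ι n (Finsupp.single j a) = Finsupp.single ⟨n, j⟩ a := by
  simp [level]

theorem level_apply (n : ℕ) (x : ι n →₀ R) (i : ι n) : level ι n x ⟨n, i⟩ = x i :=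
  Finsupp.mapDomain_apply sigma_mk_injective x i

theorem level_apply_of_ne {m n : ℕ} (h : m ≠ n) (x : ι n →₀ R) (i : ι m) :
    level ι n x ⟨m, i⟩ = 0 :=
  Finsupp.mapDomain_of_notMem_range _ _ (by rintro ⟨j, hj⟩; exact h (congrArg Sigma.fst hj).symm)

theorem unlevel_apply (n : ℕ) (x : (Σ n, ι n) →₀ R) (i : ι n) :
    unlevel ι n x i = x ⟨n, i⟩ := rfl

theorem unlevel_level (n : ℕ) (x : ι n →₀ R) : unlevel ι n (level ι n x) = x := by
  ext i; rw [unlevel_apply, level_apply]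

theorem unlevel_level_of_ne {m n : ℕ} (h : m ≠ n) (x : ι n →₀ R) :
    unlevel ι m (level ι n x) = 0 := by
  ext i; rw [unlevel_apply, level_apply_of_ne ι h]; rfl

/-- The value of the assembled differential on the basis. -/
def assembleD : (Σ n, ι n) → ((Σ n, ι n) →₀ R)
  | ⟨0, _⟩ => 0
  | ⟨n + 1, j⟩ => level ι n (d n (Finsupp.single j 1))

/-- The value of the assembled augmentation on the basis. -/
def assembleAug : (Σ n, ι n) → R
  | ⟨0, j⟩ => aug (Finsupp.single j 1)
  | ⟨_ + 1, _⟩ => 0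

/-- The direct sum of the modules of a complex of free modules. -/
abbrev assemble : Cx R where
  X := Σ n, ι n
  h := Sigma.fst
  deg j := deg j.1 j.2
  D := Finsupp.linearCombination R (assembleD ι d)
  aug := Finsupp.linearCombination R (assembleAug ι aug)

theorem assemble_D_level_zero (x : ι 0 →₀ R) : (assemble ι deg d aug).D (level ι 0 x) = 0 := by
  suffices h : (assemble ι deg d aug).D ∘ₗ level ι 0 = 0 from LinearMap.congr_fun h x
  refine linearMap_ext_single fun j => ?_
  rw [LinearMap.comp_apply, level_single, Finsupp.linearCombination_single, one_smul]
  rfl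

theorem assemble_D_level_succ (n : ℕ) (x : ι (n + 1) →₀ R) :
    (assemble ι deg d aug).D (level ι (n + 1) x) = level ι n (d n x) := by
  suffices h : (assemble ι deg d aug).D ∘ₗ level ι (n + 1) = level ι n ∘ₗ d n from
    LinearMap.congr_fun h x
  refine linearMap_ext_single fun j => ?_
  rw [LinearMap.comp_apply, level_single, Finsupp.linearCombination_single, one_smul]
  rfl

theorem assemble_aug_level_zero (x : ι 0 →₀ R) :
    (assemble ι deg d aug).aug (level ι 0 x) = aug x := by
  suffices h : (assemble ι deg d aug).aug ∘ₗ level ι 0 = aug from LinearMap.congr_fun h x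
  refine linearMap_ext_single fun j => ?_
  rw [LinearMap.comp_apply, level_single, Finsupp.linearCombination_single, one_smul]
  rfl

theorem assemble_aug_level_succ (n : ℕ) (x : ι (n + 1) →₀ R) :
    (assemble ι deg d aug).aug (level ι (n + 1) x) = 0 := by
  suffices h : (assemble ι deg d aug).aug ∘ₗ level ι (n + 1) = 0 from LinearMap.congr_fun h x
  refine linearMap_ext_single fun j => ?_
  rw [LinearMap.comp_apply, level_single, Finsupp.linearCombination_single, one_smul]
  rfl

theorem unlevel_assemble_D (n : ℕ) (x : (Σ n, ι n) →₀ R) :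
    unlevel ι n ((assemble ι deg d aug).D x) = d n (unlevel ι (n + 1) x) := by
  suffices h : unlevel ι n ∘ₗ (assemble ι deg d aug).D = d n ∘ₗ unlevel ι (n + 1) from
    LinearMap.congr_fun h x
  refine linearMap_ext_single fun ⟨m, j⟩ => ?_
  rw [LinearMap.comp_apply, LinearMap.comp_apply, ← level_single]
  cases m with
  | zero => rw [assemble_D_level_zero, unlevel_level_of_ne ι (by omega), map_zero, map_zero]
  | succ m =>
    rw [assemble_D_level_succ]
    by_cases h : n = m
    · subst h; rw [unlevel_level, unlevel_level]
    · rw [unlevel_level_of_ne ι h, unlevel_level_of_ne ι (by omega), map_zero]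

theorem aug_unlevel (x : (Σ n, ι n) →₀ R) :
    aug (unlevel ι 0 x) = (assemble ι deg d aug).aug x := by
  suffices h : aug ∘ₗ unlevel ι 0 = (assemble ι deg d aug).aug from LinearMap.congr_fun h x
  refine linearMap_ext_single fun ⟨m, j⟩ => ?_
  rw [LinearMap.comp_apply, ← level_single]
  cases m with
  | zero => rw [assemble_aug_level_zero, unlevel_level]
  | succ m => rw [assemble_aug_level_succ, unlevel_level_of_ne ι (by omega), map_zero]

theorem sum_level_unlevel (x : (Σ n, ι n) →₀ R) :
    ∑ n ∈ x.splitSupport, level ι n (unlevel ι n x) = x := by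
  ext ⟨m, i⟩
  rw [Finsupp.finsetSum_apply, Finset.sum_eq_single m]
  · rw [level_apply, unlevel_apply]
  · exact fun n _ hn => level_apply_of_ne ι hn.symm _ _
  · intro hm
    rw [level_apply, unlevel_apply]
    by_contra h
    exact hm (by
      rw [Finsupp.mem_splitSupport_iff_nonzero]
      intro h0
      exact h (by rw [← Finsupp.split_apply, h0]; rfl))

variable {ι deg d aug}

theorem assemble_isRes {A : Ideal R} (haug : LinearMap.range aug = A)
    (h0 : Function.Exact (d 0) aug) (hd : ∀ n, Function.Exact (d (n + 1)) (d n)) :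
    (assemble ι deg d aug).IsRes A where
  D_h := by
    rintro ⟨_ | n, j⟩ ⟨m, i⟩ h
    · rw [← level_single, assemble_D_level_zero] at h
      exact absurd rfl h
    · rw [← level_single, assemble_D_level_succ] at h
      by_contra hne
      exact h (level_apply_of_ne ι (fun hmn => hne (by subst hmn; rfl)) _ _)
  aug_h := by
    rintro ⟨_ | n, j⟩ h
    · exact absurd rfl h
    · rw [← level_single, assemble_aug_level_succ]
  D_D x := by
    suffices h : (assemble ι deg d aug).D ∘ₗ (assemble ι deg d aug).D = 0 from
      LinearMap.congr_fun h x
    refine linearMap_ext_single fun ⟨m, j⟩ => ?_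
    rw [LinearMap.comp_apply, ← level_single]
    rcases m with _ | _ | m
    · rw [assemble_D_level_zero, map_zero]; rfl
    · rw [assemble_D_level_succ, assemble_D_level_zero]; rfl
    · rw [assemble_D_level_succ, assemble_D_level_succ, (hd m).apply_apply_eq_zero, map_zero]; rfl
  aug_D x := by
    rw [← aug_unlevel, unlevel_assemble_D, h0.apply_apply_eq_zero]
  exact x hx ha := by
    have hex : ∀ n, ∃ y, d n y = unlevel ι n x := by
      rintro (_ | n)
      · exact (h0 _).1 (by rw [aug_unlevel ι deg d, ha])
      · exact (hd n _).1 (by rw [← unlevel_assemble_D ι deg d aug, hx, map_zero])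
    choose y hy using hex
    -- Only finitely many levels meet the support of `x`, so the levelwise preimages can be summed.
    refine ⟨∑ n ∈ x.splitSupport, level ι (n + 1) (y n), ?_⟩
    rw [map_sum]
    refine (Finset.sum_congr rfl fun n _ => ?_).trans (sum_level_unlevel ι x)
    rw [assemble_D_level_succ, hy]
  range_aug := by
    rw [← haug]
    ext a
    constructor
    · rintro ⟨x, rfl⟩
      exact ⟨unlevel ι 0 x, aug_unlevel ι deg d aug x⟩
    · rintro ⟨x, rfl⟩
      exact ⟨level ι 0 x, assemble_aug_level_zero ι deg d aug x⟩

end Assemble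

/-! ### Existence of resolutions and extraction of lifts. -/

section Existence

variable {R : Type u} [CommRing R]

/-- Iterated syzygies, each generated by all of its elements. -/
def syzygy (A : Ideal R) : ℕ → Σ ι : Type u, Submodule R (ι →₀ R)
  | 0 => ⟨A, LinearMap.ker (Finsupp.linearCombination R (Subtype.val : A → R))⟩
  | n + 1 => ⟨(syzygy A n).2, LinearMap.ker (Finsupp.linearCombination R
      (Subtype.val : (syzygy A n).2 → ((syzygy A n).1 →₀ R)))⟩

theorem range_linearCombination_val {M : Type u} [AddCommGroup M] [Module R M]
    (N : Submodule R M) :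
    LinearMap.range (Finsupp.linearCombination R (Subtype.val : N → M)) = N := by
  rw [Finsupp.range_linearCombination, Subtype.range_coe_subtype]
  exact Submodule.span_eq N

/-- Every syzygy is generated by all of its elements, so no finiteness is needed. The internal
degree `0` is a placeholder: these resolutions serve Tor-vanishing, which ignores the grading. -/
theorem exists_isRes (A : Ideal R) : ∃ F : Cx R, F.IsRes A :=
  ⟨_, assemble_isRes (ι := fun n => (syzygy A n).1) (deg := fun _ _ => 0)
    (d := fun n => Finsupp.linearCombination R
      (Subtype.val : (syzygy A n).2 → ((syzygy A n).1 →₀ R)))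
    (aug := Finsupp.linearCombination R (Subtype.val : A → R))
    (range_linearCombination_val A)
    (LinearMap.exact_iff.2 (range_linearCombination_val (syzygy A 0).2).symm)
    fun n => LinearMap.exact_iff.2 (range_linearCombination_val (syzygy A (n + 1)).2).symm⟩

variable {k : Type u} [Field k] [Algebra k R] {𝒜 : ℕ → Submodule k R}

/-- The single-module data of a graded free resolution of an ideal. -/
abbrev GradedFreeResolution.toCx {A : Ideal R}
    (F : GradedFreeResolution 𝒜 (idealComponent 𝒜 A)) : Cx R :=
  assemble F.ι F.deg F.d (A.subtype ∘ₗ F.aug)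

theorem GradedFreeResolution.toCx_isRes {A : Ideal R}
    (F : GradedFreeResolution 𝒜 (idealComponent 𝒜 A)) : F.toCx.IsRes A :=
  assemble_isRes
    (by rw [LinearMap.range_comp, LinearMap.range_eq_top.2 F.aug_surjective, Submodule.map_top,
      Submodule.range_subtype])
    (fun x => Iff.trans (by simp) (F.exact_aug x)) F.exact_d

theorem GradedFreeResolution.toCx_isGraded {A : Ideal R}
    (F : GradedFreeResolution 𝒜 (idealComponent 𝒜 A)) : F.toCx.IsGraded 𝒜 where
  D_deg := by
    rintro ⟨_ | n, j⟩ ⟨m, i⟩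
    · rw [← level_single, assemble_D_level_zero]; exact Submodule.zero_mem _
    · rw [← level_single, assemble_D_level_succ]
      by_cases h : m = n
      · subst h; rw [level_apply]; exact F.d_deg m j i
      · rw [level_apply_of_ne _ h]; exact Submodule.zero_mem _
  aug_deg := by
    rintro ⟨_ | n, j⟩
    · rw [← level_single, assemble_aug_level_zero]; exact F.aug_deg j
    · rw [← level_single, assemble_aug_level_succ]; exact Submodule.zero_mem _

theorem InclusionDoublyTorVanishing.exists_hasLift {A B : Ideal R}
    (h : InclusionDoublyTorVanishing 𝒜 A B) : ∃ F G : Cx R, F.IsRes A ∧ G.IsRes B ∧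
      F.IsGraded 𝒜 ∧ G.IsGraded 𝒜 ∧ HasLift F G (gradedMax 𝒜 ^ 2) := by
  obtain ⟨hAB, F, G, φ, hφ⟩ := h
  let Φ : (F.toCx.X →₀ R) →ₗ[R] (G.toCx.X →₀ R) :=
    Finsupp.linearCombination R fun j => level G.ι j.1 (φ.map j.1 (Finsupp.single j.2 1))
  have hΦ : ∀ n x, Φ (level F.ι n x) = level G.ι n (φ.map n x) := by
    intro n x
    suffices h : Φ ∘ₗ level F.ι n = level G.ι n ∘ₗ φ.map n from LinearMap.congr_fun h x
    refine linearMap_ext_single fun j => ?_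
    rw [LinearMap.comp_apply, level_single, Finsupp.linearCombination_single, one_smul]
    rfl
  refine ⟨F.toCx, G.toCx, F.toCx_isRes, G.toCx_isRes, F.toCx_isGraded, G.toCx_isGraded, Φ,
    fun x => ?_, fun x => ?_, apply_mem_of_single _ ?_⟩
  · suffices h : G.toCx.D ∘ₗ Φ = Φ ∘ₗ F.toCx.D from LinearMap.congr_fun h x
    refine linearMap_ext_single fun ⟨n, j⟩ => ?_
    rw [LinearMap.comp_apply, LinearMap.comp_apply, ← level_single, hΦ]
    cases n with
    | zero => rw [assemble_D_level_zero, assemble_D_level_zero, map_zero]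
    | succ n =>
      rw [assemble_D_level_succ, assemble_D_level_succ, hΦ]
      exact congrArg _ (LinearMap.congr_fun (φ.comm_d n) _)
  · suffices h : G.toCx.aug ∘ₗ Φ = F.toCx.aug from LinearMap.congr_fun h x
    refine linearMap_ext_single fun ⟨n, j⟩ => ?_
    rw [LinearMap.comp_apply, ← level_single, hΦ]
    cases n with
    | zero =>
      rw [assemble_aug_level_zero, assemble_aug_level_zero]
      exact congrArg Subtype.val (LinearMap.congr_fun φ.comm_aug _)
    | succ n => rw [assemble_aug_level_succ, assemble_aug_level_succ]
  · rintro ⟨n, j⟩ ⟨m, i⟩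
    rw [← level_single, hΦ]
    by_cases h : m = n
    · subst h
      rw [level_apply]
      exact (mem_smul_top_iff _).1 (hφ m ⟨_, rfl⟩) i
    · rw [level_apply_of_ne _ h]; exact Ideal.zero_mem _

end Existence

/-! ### Small and doubly small type of the mixed sum. -/

section Main

variable {k R S : Type u} [Field k] [CommRing R] [Algebra k R] [CommRing S] [Algebra k S]

theorem IsSmallType.exists_resolutions (𝒜 : ℕ → Submodule k R) [(gradedMax 𝒜).IsMaximal]
    {I : Ideal R} (h : IsSmallType 𝒜 I) :
    ∃ (F : ℕ → Cx R) (φ : ∀ a, ((F (a + 1)).X →₀ R) →ₗ[R] ((F a).X →₀ R)),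
      (∀ a, (F a).IsRes (I ^ a)) ∧ (∀ a, IsLift (F (a + 1)) (F a) (gradedMax 𝒜) (φ a)) ∧
      ∀ a, PreservesH (F (a + 1)) (F a) (φ a) := by
  choose F hF using fun a => exists_isRes (I ^ a)
  have hφ := fun a => ((h (a + 1) (Nat.le_add_left 1 a)).hasLift 𝒜 (hF (a + 1))
    (hF a)).exists_preservesH (hF (a + 1)) (hF a)
  choose φ hφ hφh using hφ
  exact ⟨F, φ, hF, hφ, hφh⟩

/-- Each inclusion comes with its own pair of resolutions, so a given power is resolved in two
unrelated ways. The targets `F a` are kept for all powers; comparison maps transfer the lifts to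
them, and homogenization then restores the internal degrees. -/
theorem IsDoublySmallType.exists_resolutions (𝒜 : ℕ → Submodule k R) [GradedAlgebra 𝒜]
    {I : Ideal R} (h : IsDoublySmallType 𝒜 I) :
    ∃ (F : ℕ → Cx R) (φ : ∀ a, ((F (a + 1)).X →₀ R) →ₗ[R] ((F a).X →₀ R)),
      (∀ a, (F a).IsRes (I ^ a)) ∧ (∀ a, IsLift (F (a + 1)) (F a) (gradedMax 𝒜 ^ 2) (φ a)) ∧
      (∀ a, PreservesH (F (a + 1)) (F a) (φ a)) ∧ (∀ a, (F a).IsGraded 𝒜) ∧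
      ∀ a, IsHomog 𝒜 (F (a + 1)) (F a) (φ a) := by
  choose K F hK hF hKg hFg hlift using fun a =>
    InclusionDoublyTorVanishing.exists_hasLift (h (a + 1) (Nat.le_add_left 1 a))
  have hφ := fun a => ((hlift a).of_resolutions (hK a) (hF a) (hF (a + 1))
    (hF a)).exists_isHomog 𝒜 (hF (a + 1)) (hF a) (hFg (a + 1)) (hFg a)
    (gradedMax_sq_isHomogeneous 𝒜)
  choose φ hφ hφh hφg using hφ
  exact ⟨F, φ, hF, hφ, hφh, hFg, hφg⟩

section Lifts

variable {F : ℕ → Cx R} {G : ℕ → Cx S}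
  {φ : ∀ a, ((F (a + 1)).X →₀ R) →ₗ[R] ((F a).X →₀ R)}
  {ψ : ∀ b, ((G (b + 1)).X →₀ S) →ₗ[S] ((G b).X →₀ S)}
  {I : Ideal R} {J : Ideal S} {c : Ideal R} {d : Ideal S} {e : Ideal (R ⊗[k] S)}

theorem tensorCx_isRes_pow (hF : ∀ a, (F a).IsRes (I ^ a)) (hG : ∀ b, (G b).IsRes (J ^ b))
    (r s : ℕ) : (tensorCx k (F r) (G s)).IsRes (extendLeft I ^ r * extendRight J ^ s) := by
  rw [← extendLeft_pow, ← extendRight_pow]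
  exact tensorCx_isRes (hF r) (hG s)

theorem box_left_isLift (hc : extendLeft c ≤ e)
    (hφ : ∀ a, IsLift (F (a + 1)) (F a) c (φ a)) (hφh : ∀ a, PreservesH (F (a + 1)) (F a) (φ a))
    (r s : ℕ) : IsLift (tensorCx k (F (r + 1)) (G s)) (tensorCx k (F r) (G s)) e
      (box (φ r) LinearMap.id) :=
  (box_isLift (hφ r) (hφh r) (isLift_id _)).mono (Ideal.mul_le_left.trans hc)

theorem tot_inc_comp_box_isLift (hd : extendRight d ≤ e) (hF : ∀ a, (F a).IsRes (I ^ a))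
    (hG : ∀ b, (G b).IsRes (J ^ b)) (hφ : ∀ a, IsLift (F (a + 1)) (F a) c (φ a))
    (hφh : ∀ a, PreservesH (F (a + 1)) (F a) (φ a))
    (hψ : ∀ b, IsLift (G (b + 1)) (G b) d (ψ b))
    (hψh : ∀ b, PreservesH (G (b + 1)) (G b) (ψ b)) (s r : ℕ) :
    IsLift (tensorCx k (F r) (G (s + 1))) (tot k F G φ ψ s r).1 e
      ((tot k F G φ ψ s r).2 ∘ₗ box LinearMap.id (ψ s)) :=
  ((tot_spec k hF hG hφ hφh hψ hψh s r).2.1.comp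
    (box_isLift (isLift_id _) (preservesH_id _) (hψ s))).mono
    (inf_le_left.trans (Ideal.mul_le_right.trans hd))

end Lifts

variable {𝒜 : ℕ → Submodule k R} {ℬ : ℕ → Submodule k S} {I : Ideal R} {J : Ideal S}

theorem smallType_mixedSum [GradedAlgebra 𝒜] (hR : IsStandardGraded 𝒜) [GradedAlgebra ℬ]
    (hS : IsStandardGraded ℬ) (hI : IsSmallType 𝒜 I) (hJ : IsSmallType ℬ J) :
    (∀ r s : ℕ, IsBettiSplitting (tensorGrading 𝒜 ℬ) (extendLeft I ^ r * mixedSum I J ^ (s + 1))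
      (extendLeft I ^ (r + 1) * mixedSum I J ^ s) (extendLeft I ^ r * extendRight J ^ (s + 1))) ∧
    IsSmallType (tensorGrading 𝒜 ℬ) (mixedSum I J) := by
  have := hR.gradedMax_isMaximal
  have := hS.gradedMax_isMaximal
  obtain ⟨F, φ, hF, hφ, hφh⟩ := hI.exists_resolutions
  obtain ⟨G, ψ, hG, hψ, hψh⟩ := hJ.exists_resolutions
  have hc := extendLeft_gradedMax_le (𝒜 := 𝒜) (isMulGrading_of_gradedAlgebra ℬ)
  have hd := extendRight_gradedMax_le (ℬ := ℬ) (isMulGrading_of_gradedAlgebra 𝒜)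
  have hspec := tot_spec k hF hG hφ hφh hψ hψh
  refine ⟨fun r s => ?_, fun r hr => ?_⟩
  · refine isBettiSplitting_of_hasLift _ (mixedSum_decomposition I J r s) (hspec s (r + 1)).1
      (tensorCx_isRes_pow hF hG r (s + 1)) (K := tensorCx k (F (r + 1)) (G (s + 1))) ?_
      ⟨_, tot_inc_comp_box_isLift hd hF hG hφ hφh hψ hψh s (r + 1)⟩
      ⟨_, box_left_isLift hc hφ hφh r (s + 1)⟩
    rw [mixedSum_inf]
    exact tensorCx_isRes_pow hF hG _ _
  -- The powers of `P` are the case `r = 0` of the iterated cones.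
  · obtain ⟨s, rfl⟩ := Nat.exists_eq_add_of_le' hr
    have h1 := (hspec (s + 1) 0).1
    have h2 := (hspec s 0).1
    rw [pow_zero, one_mul] at h1 h2
    exact inclusionTorVanishing_of_hasLift _ h1 h2 ⟨_, totMap_isLift k hc hd hφ hφh hψ s 0⟩

theorem doublySmallType_mixedSum [GradedAlgebra 𝒜] [GradedAlgebra ℬ]
    (hI : IsDoublySmallType 𝒜 I) (hJ : IsDoublySmallType ℬ J) :
    (∀ r s : ℕ,
      InclusionDoublyTorVanishing (tensorGrading 𝒜 ℬ)
        (extendLeft I ^ (r + 1) * extendRight J ^ (s + 1))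
        (extendLeft I ^ r * extendRight J ^ (s + 1)) ∧
      InclusionDoublyTorVanishing (tensorGrading 𝒜 ℬ)
        (extendLeft I ^ (r + 1) * extendRight J ^ (s + 1))
        (extendLeft I ^ (r + 1) * mixedSum I J ^ s)) ∧
    IsDoublySmallType (tensorGrading 𝒜 ℬ) (mixedSum I J) := by
  obtain ⟨F, φ, hF, hφ, hφh, hFg, hφg⟩ := hI.exists_resolutions
  obtain ⟨G, ψ, hG, hψ, hψh, hGg, hψg⟩ := hJ.exists_resolutions
  have hA := isMulGrading_of_gradedAlgebra 𝒜
  have hB := isMulGrading_of_gradedAlgebra ℬ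
  have hc := extendLeft_gradedMax_sq_le (𝒜 := 𝒜) hB
  have hd := extendRight_gradedMax_sq_le (ℬ := ℬ) hA
  have hspec := tot_spec k hF hG hφ hφh hψ hψh
  have hgr := tot_isGraded hA hB hFg hGg hφg hψg
  have htens : ∀ r s, (tensorCx k (F r) (G s)).IsGraded (tensorGrading 𝒜 ℬ) := fun r s =>
    tensorCx_isGraded hA hB (hFg r) (hGg s)
  refine ⟨fun r s => ⟨?_, ?_⟩, fun r hr => ?_⟩
  -- The two attaching maps of the cone are themselves the doubly small lifts of the two inclusions.
  · exact (box_left_isLift hc hφ hφh r (s + 1)).inclusionDoublyTorVanishing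
      (tensorCx_isRes_pow hF hG _ _) (tensorCx_isRes_pow hF hG _ _) (htens _ _) (htens _ _)
      (box_isHomog (hφg r) (isHomog_id hB _))
  · exact (tot_inc_comp_box_isLift hd hF hG hφ hφh hψ hψh s (r + 1)).inclusionDoublyTorVanishing
      (tensorCx_isRes_pow hF hG _ _) (hspec s (r + 1)).1 (htens _ _) (hgr s (r + 1)).1
      ((hgr s (r + 1)).2.comp (isMulGrading_tensorGrading hA hB)
        (box_isHomog (isHomog_id hA _) (hψg s)))
  · obtain ⟨s, rfl⟩ := Nat.exists_eq_add_of_le' hr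
    have h1 := (hspec (s + 1) 0).1
    have h2 := (hspec s 0).1
    rw [pow_zero, one_mul] at h1 h2
    exact (totMap_isLift k hc hd hφ hφh hψ s 0).inclusionDoublyTorVanishing h1 h2
      (hgr (s + 1) 0).1 (hgr s 0).1 (totMap_isHomog hA hB hφg hψg s 0)

end Main

end MixedSum

end

theorem mainTheorem4 {k R S : Type u} [Field k] [CommRing R] [Algebra k R]
    [CommRing S] [Algebra k S]
    (𝒜 : ℕ → Submodule k R) [GradedAlgebra 𝒜] (hR : MixedSum.IsStandardGraded 𝒜)
    (ℬ : ℕ → Submodule k S) [GradedAlgebra ℬ] (hS : MixedSum.IsStandardGraded ℬ)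
    (I : Ideal R) (hI : I.IsHomogeneous 𝒜) (hI_ne_bot : I ≠ ⊥) (hI_ne_top : I ≠ ⊤)
    (J : Ideal S) (hJ : J.IsHomogeneous ℬ) (hJ_ne_bot : J ≠ ⊥) (hJ_ne_top : J ≠ ⊤)
    (𝒯 : ℕ → Submodule k (R ⊗[k] S)) (h𝒯 : 𝒯 = MixedSum.tensorGrading 𝒜 ℬ)
    (I' J' P : Ideal (R ⊗[k] S)) (hI' : I' = MixedSum.extendLeft I)
    (hJ' : J' = MixedSum.extendRight J) (hP : P = MixedSum.mixedSum I J) :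
    (MixedSum.IsSmallType 𝒜 I → MixedSum.IsSmallType ℬ J →
      (∀ r s : ℕ, 1 ≤ s →
        MixedSum.IsBettiSplitting 𝒯 (I' ^ r * P ^ s)
          (I' ^ (r + 1) * P ^ (s - 1)) (I' ^ r * J' ^ s)) ∧
      MixedSum.IsSmallType 𝒯 P) ∧
    (MixedSum.IsDoublySmallType 𝒜 I → MixedSum.IsDoublySmallType ℬ J →
      (∀ r s : ℕ, 1 ≤ s →
        MixedSum.InclusionDoublyTorVanishing 𝒯 (I' ^ (r + 1) * J' ^ s) (I' ^ r * J' ^ s) ∧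
        MixedSum.InclusionDoublyTorVanishing 𝒯 (I' ^ (r + 1) * J' ^ s)
          (I' ^ (r + 1) * P ^ (s - 1))) ∧
      MixedSum.IsDoublySmallType 𝒯 P) := by
  subst h𝒯 hI' hJ' hP
  refine ⟨fun hsI hsJ => ?_, fun hsI hsJ => ?_⟩
  · obtain ⟨h1, h2⟩ := MixedSum.smallType_mixedSum hR hS hsI hsJ
    refine ⟨fun r s hs => ?_, h2⟩
    obtain ⟨s, rfl⟩ := Nat.exists_eq_add_of_le' hs
    exact h1 r s
  · obtain ⟨h1, h2⟩ := MixedSum.doublySmallType_mixedSum hsI hsJ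
    refine ⟨fun r s hs => ?_, h2⟩
    obtain ⟨s, rfl⟩ := Nat.exists_eq_add_of_le' hs
    exact h1 r s
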